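/- Let $\mathbb K=\mathbb R$ or $\mathbb C$, let $d=p+q\ge 3$ with $p,q\ge 1$, $V=\mathbb K^d$, $G=\mathrm{PSL}(V)$, $\mathfrak g=\mathfrak{sl}(V)$. Let $o$ be the class, up to positive scalars, of a symmetric bilinear (resp. Hermitian) form $\langle\cdot,\cdot\rangle_o$ of signature $(p,q)$ on $V$; let $T^{*}$ be the $o$-adjoint of $T$, $\sigma^o(g)=(g^{*})^{-1}$, and let $H^o\subset G$ be the stabilizer of $o$. Let $\tau$ be the Cartan involution of $\mathfrak g$ defined by an inner product on $V$, such that $\tau$ commutes with $d\sigma^o$; let $K^\tau$ be its stabilizer, $\mathfrak p^\tau=\{\tau=-1\}$, $\mathfrak q^o=\{d\sigma^o=-1\}$, $\mathfrak b\subset\mathfrak p^\tau\cap\mathfrak q^o$ a maximal subalgebra, and $\mathcal C$ the set of the $d$ common eigenlines of $\mathfrak b$ in $V$. Fix a $K^\tau$-invariant inner product on $\mathfrak p^\tau$ (equivalently a $G$-invariant Riemannian metric on the symmetric space of $G$) and let $\|\cdot\|_{\mathfrak b}$ be its norm on $\mathfrak b$. Let $\hat W$ be the normalizer and $M$ the centralizer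 of $\mathfrak b$ in $K^\tau$, and $W=\hat W/M$. Fix a closed Weyl chamber $\mathfrak b^+$ of the set of restricted roots of $\mathfrak b$ in $\mathfrak g^{\tau o}=\{\tau\, d\sigma^o=1\}$, and a closed Weyl chamber $\mathfrak a^+\subset\mathfrak b^+$ of the system $\Sigma(\mathfrak g,\mathfrak b)$ of restricted roots of $\mathfrak b$ in $\mathfrak g$, with positive system $\Sigma^+$. A chamber of $\Sigma(\mathfrak g,\mathfrak b)$ is the same as a total order $\ell_1,\dots,\ell_d$ on $\mathcal C$ (decreasing eigenvalues), and hence as a full flag $\xi$, $\xi^j=\ell_1\oplus\dots\oplus\ell_j$; write $\xi_{\mathfrak c}$ for the flag of a chamber $\mathfrak c$ and $\mathfrak a^+_\xi$ for the chamber of such a flag $\xi$. The flag is $\mathfrak b^+$-compatible if $\mathfrak a^+_\xi\subset\mathfrak b^+$. For flags $\xi,\xi'$ spanned by $\mathcal C$ let $w_{\xi\xi'}\in W$ be the unique element with $w_{\xi\xi'}\cdot\xi'=\xi$. Let $w_{\mathfrak b^+}\in W$ be the unique element that preserves the sets of $o$-positive and of $o$-negative lines of $\mathcal C$ and reverses the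 total orders induced on them by $\mathfrak b^+$; put $\iota_{\mathfrak b^+}(X)=-w_{\mathfrak b^+}\cdot X$ and $\iota_{\mathfrak b^+}(\xi)=\xi_{\iota_{\mathfrak b^+}(\mathfrak a^+_\xi)}$. Let $a^\tau:G\to\mathfrak a^+$ be the Cartan projection, $g=k\exp(a^\tau(g))l$ with $k,l\in K^\tau$, and $\lambda(g)=\lim_n a^\tau(g^n)/n$ the Jordan projection. If $\alpha(a^\tau(g))>0$ for all $\alpha\in\Sigma^+$, let $U^\tau(g)=k\cdot\xi_{\mathfrak a^+}$ be the Cartan attractor and $S^\tau(g)=U^\tau(g^{-1})$ the Cartan repellor. Let $\mathscr B_{o,G}$ be the set of $g\in G$ that take some $o$-orthogonal basis of lines of $V$ to an $o$-orthogonal basis of lines; for such $g$ the $(p,q)$-Cartan projection is the element $b^o(g)\in\mathfrak b^+$ with $g\in H^o\,\hat W\exp(b^o(g))\,H^o$. A full flag $\xi$ is $o$-generic if $\xi^j\cap(\xi^j)^{\perp_o}=0$ for all $j$. **Statement.** Let $\xi_s$ be a $\mathfrak b^+$-compatible flag, $C_s\subset H^o\cdot\xi_s$ a compact set of flags, and $C$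 a compact set of $o$-generic flags. Then there exist $L>0$ and $D>0$ such that every $g\in G$ with $$\min_{\alpha\in\Sigma^+}\alpha(a^\tau(g))>L,\qquad S^\tau(g)\in C_s,\qquad U^\tau(g)\in C$$ satisfies the following, with $w=w_{\iota_{\mathfrak b^+}(\xi_s)\,\xi_{\mathfrak a^+}}$: the element $g$ lies in $\mathscr B_{o,G}$, its $(p,q)$-Cartan projection $b^o(g)$ exists and is unique, the limit defining $\lambda(\sigma^o(g^{-1})g)$ exists, $$b^o(g)=\tfrac12\, w\cdot\lambda\big(\sigma^o(g^{-1})g\big)\qquad\text{and}\qquad \big\|b^o(g)-w\cdot a^\tau(g)\big\|_{\mathfrak b}\le D .$$ In particular, if $\iota_{\mathfrak b^+}(\xi_s)=\xi_{\mathfrak a^+}$ then $b^o(g)=\tfrac12\lambda(\sigma^o(g^{-1})g)$. -/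

import Mathlib

open Filter Topology
open scoped Matrix

/- The commutator bracket of matrices. -/
attribute [local instance 100] LieRing.ofAssociativeRing

noncomputable section

namespace PQCartan

/-- `d × d` matrices over `𝕜`, i.e. linear endomorphisms of `V = 𝕜 ^ d`. -/
abbrev Mat (d : ℕ) (𝕜 : Type*) := Matrix (Fin d) (Fin d) 𝕜

/-- The group `G = PSL(V)` for `V = 𝕜 ^ d`. -/
abbrev G (d : ℕ) (𝕜 : Type*) [RCLike 𝕜] := Matrix.ProjectiveSpecialLinearGroup (Fin d) 𝕜

/-- Linear subspaces of `V = 𝕜 ^ d`. -/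
abbrev Sub (d : ℕ) (𝕜 : Type*) [RCLike 𝕜] := Submodule 𝕜 (Fin d → 𝕜)

/-- A non degenerate Hermitian form on `V = 𝕜 ^ d` (a symmetric bilinear form if `𝕜 = ℝ`), given by
its Gram matrix.  It represents its homothety class; every notion below depends only on that
class, except the form itself. -/
structure HermForm (d : ℕ) (𝕜 : Type*) [RCLike 𝕜] where
  mat : Mat d 𝕜
  isHermitian : mat.IsHermitian
  isUnit_det : IsUnit mat.det

variable {d : ℕ} {𝕜 : Type*} [RCLike 𝕜]

/-! ### Actions of `G` -/

/-- Conjugation of matrices by elements of `SL(V)`. -/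
def AdSL : Matrix.SpecialLinearGroup (Fin d) 𝕜 →* Module.End ℝ (Mat d 𝕜) where
  toFun A :=
    { toFun := fun X => (A : Mat d 𝕜) * X * ((A⁻¹ : Matrix.SpecialLinearGroup (Fin d) 𝕜) : Mat d 𝕜)
      map_add' := fun X Y => by rw [mul_add, add_mul]
      map_smul' := fun c X => by simp }
  map_one' := by ext1 X; simp
  map_mul' A B := by
    ext1 X
    simp only [mul_inv_rev, Matrix.SpecialLinearGroup.coe_mul, Module.End.mul_apply,
      LinearMap.coe_mk, AddHom.coe_mk, mul_assoc]

/-- The adjoint action of `G` on matrices, by conjugation. -/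
def Ad : G d 𝕜 →* Module.End ℝ (Mat d 𝕜) :=
  QuotientGroup.lift _ AdSL (by
    intro A hA
    obtain ⟨r, -, hr⟩ := Matrix.SpecialLinearGroup.mem_center_iff.1 hA
    ext1 X
    have hc : (A : Mat d 𝕜) * X = X * (A : Mat d 𝕜) := by
      rw [← hr]; exact Matrix.scalar_commute r (Commute.all r) X
    have hi : (A : Mat d 𝕜) * ((A⁻¹ : Matrix.SpecialLinearGroup (Fin d) 𝕜) : Mat d 𝕜) = 1 := by
      rw [← Matrix.SpecialLinearGroup.coe_mul, mul_inv_cancel, Matrix.SpecialLinearGroup.coe_one]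
    change (A : Mat d 𝕜) * X * ((A⁻¹ : Matrix.SpecialLinearGroup (Fin d) 𝕜) : Mat d 𝕜) = X
    rw [hc, mul_assoc, hi, mul_one])

/-- The action of `SL(V)` on linear subspaces. -/
def subSL : Matrix.SpecialLinearGroup (Fin d) 𝕜 →* Function.End (Sub d 𝕜) where
  toFun A := fun W => W.map (Matrix.mulVecLin (A : Mat d 𝕜))
  map_one' := by funext W; simp; rfl
  map_mul' A B := by
    funext W
    change _ = (W.map (Matrix.mulVecLin (B : Mat d 𝕜))).map (Matrix.mulVecLin (A : Mat d 𝕜))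
    rw [Matrix.SpecialLinearGroup.coe_mul, Matrix.mulVecLin_mul, Submodule.map_comp]

/-- The action of `G` on linear subspaces. -/
def subG : G d 𝕜 →* Function.End (Sub d 𝕜) :=
  QuotientGroup.lift _ subSL (by
    intro A hA
    obtain ⟨r, hr1, hr⟩ := Matrix.SpecialLinearGroup.mem_center_iff.1 hA
    funext W
    change W.map (Matrix.mulVecLin (A : Mat d 𝕜)) = W
    have hv : ∀ v : Fin d → 𝕜, (A : Mat d 𝕜) *ᵥ v = r • v := by
      intro v; rw [← hr]; simp [Matrix.scalar_apply, ← Matrix.smul_one_eq_diagonal,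
        Matrix.smul_mulVec]
    have h0 : r ≠ 0 ∨ d = 0 := by
      by_cases h : d = 0
      · exact Or.inr h
      · left; rintro rfl; simp [h] at hr1
    rcases h0 with h0 | h0
    · ext v
      simp only [Submodule.mem_map, Matrix.mulVecLin_apply, hv]
      constructor
      · rintro ⟨w, hw, rfl⟩; exact W.smul_mem r hw
      · intro hw; exact ⟨r⁻¹ • v, W.smul_mem _ hw, smul_inv_smul₀ h0 v⟩
    · subst h0; exact Subsingleton.elim _ _)

instance : MulAction (G d 𝕜) (Sub d 𝕜) where
  smul g W := subG g W
  one_smul W := congrFun (map_one subG) W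
  mul_smul g h W := congrFun (map_mul subG g h) W

theorem mk_smul_sub (A : Matrix.SpecialLinearGroup (Fin d) 𝕜) (W : Sub d 𝕜) :
    (QuotientGroup.mk A : G d 𝕜) • W = W.map (Matrix.mulVecLin (A : Mat d 𝕜)) := rfl

theorem finrank_smul (g : G d 𝕜) (W : Sub d 𝕜) :
    Module.finrank 𝕜 (g • W : Sub d 𝕜) = Module.finrank 𝕜 W := by
  have key : ∀ (g : G d 𝕜) (W : Sub d 𝕜),
      Module.finrank 𝕜 (g • W : Sub d 𝕜) ≤ Module.finrank 𝕜 W := by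
    intro g W
    induction g using QuotientGroup.induction_on with
    | H A => rw [mk_smul_sub]; exact Submodule.finrank_map_le _ _
  apply le_antisymm (key g W)
  have h := key g⁻¹ (g • W)
  rwa [inv_smul_smul] at h

theorem smul_sub_mono (g : G d 𝕜) {W W' : Sub d 𝕜} (h : W ≤ W') : g • W ≤ g • W' := by
  induction g using QuotientGroup.induction_on with
  | H A => rw [mk_smul_sub, mk_smul_sub]; exact Submodule.map_mono h

/-! ### Full flags -/

/-- Full flags `0 = ξ⁰ ⊂ ξ¹ ⊂ ⋯ ⊂ ξᵈ = V` with `dim ξʲ = j`. -/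
@[ext]
structure FullFlag (d : ℕ) (𝕜 : Type*) [RCLike 𝕜] where
  sub : Fin (d + 1) → Sub d 𝕜
  mono : Monotone sub
  finrank_eq : ∀ j, Module.finrank 𝕜 (sub j) = j

instance : MulAction (G d 𝕜) (FullFlag d 𝕜) where
  smul g ξ := ⟨fun j => g • ξ.sub j, fun _ _ h => smul_sub_mono g (ξ.mono h),
    fun j => by rw [finrank_smul, ξ.finrank_eq]⟩
  one_smul ξ := FullFlag.ext (funext fun j => one_smul (G d 𝕜) (ξ.sub j))
  mul_smul g h ξ := FullFlag.ext (funext fun j => mul_smul g h (ξ.sub j))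

/-- The standard flag: `ξʲ` is spanned by the first `j` standard basis vectors. -/
def stdFlag : FullFlag d 𝕜 where
  sub := (Pi.basisFun 𝕜 (Fin d)).flag
  mono := (Pi.basisFun 𝕜 (Fin d)).flag_mono
  finrank_eq j := by
    have hli : LinearIndependent 𝕜
        (fun i : {i : Fin d | i.castSucc < j} => (Pi.basisFun 𝕜 (Fin d)) i) :=
      (Pi.basisFun 𝕜 (Fin d)).linearIndependent.comp _ Subtype.val_injective
    have h := finrank_span_eq_card hli
    rw [Module.Basis.flag, Set.image_eq_range]
    refine h.trans ?_
    have hj : (j : ℕ) ≤ d := Nat.lt_succ_iff.1 j.2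
    rw [← Fintype.card_fin (j : ℕ)]
    refine Fintype.card_congr
      { toFun := fun i => ⟨i.1, i.2⟩
        invFun := fun i => ⟨⟨i, lt_of_lt_of_le i.2 hj⟩, i.2⟩
        left_inv := fun _ => rfl
        right_inv := fun _ => rfl }

instance : Nonempty (FullFlag d 𝕜) := ⟨stdFlag⟩

/-- The topology of the flag manifold, as a homogeneous space of `SL(V)`. -/
instance : TopologicalSpace (FullFlag d 𝕜) :=
  TopologicalSpace.coinduced
    (fun A : Matrix.SpecialLinearGroup (Fin d) 𝕜 => (QuotientGroup.mk A : G d 𝕜) • stdFlag)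
    inferInstance

/-- Transversality: `ξʲ` and `η^(d-j)` are linearly disjoint for all `j`. -/
def Transverse (ξ η : Fin (d + 1) → Sub d 𝕜) : Prop :=
  ∀ j, Disjoint (ξ j) (η j.rev)

/-! ### Forms -/

namespace HermForm

variable (o : HermForm d 𝕜)

/-- The form `⟨u, v⟩`, linear in `v` and conjugate linear in `u`. -/
def form (u v : Fin d → 𝕜) : 𝕜 := star u ⬝ᵥ (o.mat *ᵥ v)

/-- The form has signature `(p, q)`: it has an orthonormal basis (the columns of `S`) with `p`
vectors of sign `1` and `q` vectors of sign `-1`. -/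
def HasSignature (p q : ℕ) : Prop :=
  p + q = d ∧ ∃ S : Mat d 𝕜, IsUnit S.det ∧
    Sᴴ * o.mat * S = Matrix.diagonal (fun i : Fin d => if (i : ℕ) < p then (1 : 𝕜) else -1)

/-- The adjoint with respect to the form, `⟨T u, v⟩ = ⟨u, T* v⟩`. -/
def adj (T : Mat d 𝕜) : Mat d 𝕜 := o.mat⁻¹ * Tᴴ * o.mat

theorem form_adj (T : Mat d 𝕜) (u v : Fin d → 𝕜) :
    o.form (T *ᵥ u) v = o.form u (o.adj T *ᵥ v) := by
  have h : o.mat * (o.mat⁻¹ * Tᴴ * o.mat) = Tᴴ * o.mat := by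
    rw [← mul_assoc, ← mul_assoc, Matrix.mul_nonsing_inv _ o.isUnit_det, one_mul]
  simp only [form, adj, Matrix.mulVec_mulVec, h]
  rw [Matrix.star_mulVec, ← Matrix.dotProduct_mulVec, Matrix.mulVec_mulVec]

theorem adj_mul (A B : Mat d 𝕜) : o.adj (A * B) = o.adj B * o.adj A := by
  simp only [adj, Matrix.conjTranspose_mul]
  have h := Matrix.mul_nonsing_inv o.mat o.isUnit_det
  calc o.mat⁻¹ * (Bᴴ * Aᴴ) * o.mat = o.mat⁻¹ * Bᴴ * 1 * (Aᴴ * o.mat) := by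
        simp only [mul_one, mul_assoc]
    _ = o.mat⁻¹ * Bᴴ * o.mat * (o.mat⁻¹ * Aᴴ * o.mat) := by rw [← h]; simp only [mul_assoc]

theorem adj_one : o.adj 1 = 1 := by
  simp [adj, Matrix.nonsing_inv_mul _ o.isUnit_det]

theorem det_adj (A : Mat d 𝕜) : (o.adj A).det = star A.det := by
  have h : o.mat⁻¹.det * o.mat.det = 1 := by
    rw [← Matrix.det_mul, Matrix.nonsing_inv_mul _ o.isUnit_det, Matrix.det_one]
  rw [adj, Matrix.det_mul, Matrix.det_mul, Matrix.det_conjTranspose, mul_right_comm, h, one_mul]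

/-- The adjoint of an element of `SL(V)`. -/
def adjSL (A : Matrix.SpecialLinearGroup (Fin d) 𝕜) : Matrix.SpecialLinearGroup (Fin d) 𝕜 :=
  ⟨o.adj A, by rw [det_adj, A.2, star_one]⟩

/-- `σ(A) = (A*)⁻¹` on `SL(V)`. -/
def sigmaSL : Matrix.SpecialLinearGroup (Fin d) 𝕜 →* Matrix.SpecialLinearGroup (Fin d) 𝕜 where
  toFun A := (o.adjSL A)⁻¹
  map_one' := by
    rw [inv_eq_one]; apply Subtype.ext
    simpa [adjSL] using o.adj_one
  map_mul' A B := by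
    rw [← mul_inv_rev]; congr 1; apply Subtype.ext
    exact o.adj_mul A B

/-- The involution `σᵒ(g) = (g*)⁻¹` of `G`. -/
def sigma : G d 𝕜 →* G d 𝕜 :=
  QuotientGroup.map _ _ o.sigmaSL (by
    intro A hA
    rw [Subgroup.mem_comap]
    obtain ⟨r, hr1, hr⟩ := Matrix.SpecialLinearGroup.mem_center_iff.1 hA
    refine inv_mem (Matrix.SpecialLinearGroup.mem_center_iff.2 ⟨star r, ?_, ?_⟩)
    · rw [← star_pow, hr1, star_one]
    · change _ = o.adj A
      rw [← hr, adj]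
      have h1 : (Matrix.scalar (Fin d) r)ᴴ = Matrix.scalar (Fin d) (star r) := by
        simp [Matrix.scalar_apply, Matrix.diagonal_conjTranspose, Pi.star_def]
      have h2 : o.mat⁻¹ * Matrix.scalar (Fin d) (star r)
          = Matrix.scalar (Fin d) (star r) * o.mat⁻¹ :=
        (Matrix.scalar_commute (star r) (Commute.all _) _).symm
      rw [h1, h2, mul_assoc, Matrix.nonsing_inv_mul _ o.isUnit_det, mul_one])

/-- The derivative `dσ(X) = -X*` of `σ` at the identity.  If the form is an inner product this is
the associated Cartan involution of the Lie algebra. -/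
def dsigma (X : Mat d 𝕜) : Mat d 𝕜 := -o.adj X

/-- The stabilizer in `SL(V)` of the homothety class of the form. -/
def stabSL : Subgroup (Matrix.SpecialLinearGroup (Fin d) 𝕜) where
  carrier := {A | ∃ c : ℝ, 0 < c ∧
    (A : Mat d 𝕜)ᴴ * o.mat * (A : Mat d 𝕜) = (c : 𝕜) • o.mat}
  one_mem' := ⟨1, one_pos, by simp⟩
  mul_mem' := by
    rintro A B ⟨a, ha, hA⟩ ⟨b, hb, hB⟩
    refine ⟨a * b, mul_pos ha hb, ?_⟩
    rw [Matrix.SpecialLinearGroup.coe_mul, Matrix.conjTranspose_mul]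
    calc (B : Mat d 𝕜)ᴴ * (A : Mat d 𝕜)ᴴ * o.mat * ((A : Mat d 𝕜) * (B : Mat d 𝕜))
        = (B : Mat d 𝕜)ᴴ * ((A : Mat d 𝕜)ᴴ * o.mat * (A : Mat d 𝕜)) * (B : Mat d 𝕜) := by
          simp only [mul_assoc]
      _ = _ := by
          rw [hA, Matrix.mul_smul, Matrix.smul_mul, hB, smul_smul]; push_cast; rfl
  inv_mem' := by
    rintro A ⟨a, ha, hA⟩
    refine ⟨a⁻¹, inv_pos.2 ha, ?_⟩
    have hi : (A : Mat d 𝕜) * ((A⁻¹ : Matrix.SpecialLinearGroup (Fin d) 𝕜) : Mat d 𝕜) = 1 := by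
      rw [← Matrix.SpecialLinearGroup.coe_mul, mul_inv_cancel, Matrix.SpecialLinearGroup.coe_one]
    set B : Mat d 𝕜 := ((A⁻¹ : Matrix.SpecialLinearGroup (Fin d) 𝕜) : Mat d 𝕜)
    have hi' : Bᴴ * (A : Mat d 𝕜)ᴴ = 1 := by
      rw [← Matrix.conjTranspose_mul, hi, Matrix.conjTranspose_one]
    have h : o.mat = (a : 𝕜) • (Bᴴ * o.mat * B) := by
      calc o.mat = (Bᴴ * (A : Mat d 𝕜)ᴴ) * o.mat * ((A : Mat d 𝕜) * B) := by
            rw [hi, hi', one_mul, mul_one]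
        _ = Bᴴ * ((A : Mat d 𝕜)ᴴ * o.mat * (A : Mat d 𝕜)) * B := by simp only [mul_assoc]
        _ = _ := by rw [hA, Matrix.mul_smul, Matrix.smul_mul]
    have ha' : (a : 𝕜) ≠ 0 := by exact_mod_cast ha.ne'
    conv_rhs => rw [h]
    rw [smul_smul]
    push_cast
    rw [inv_mul_cancel₀ ha', one_smul]

/-- The stabilizer in `G` of the homothety class of the form: `Hᵒ` for the base point `o`, and
the maximal compact subgroup `K^τ` for an inner product `τ`. -/
def stab : Subgroup (G d 𝕜) := o.stabSL.map (QuotientGroup.mk' _)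

/-- The orthogonal complement of a subspace. -/
def perp (W : Sub d 𝕜) : Sub d 𝕜 where
  carrier := {v | ∀ u ∈ W, o.form u v = 0}
  zero_mem' := fun u _ => by simp [form]
  add_mem' := fun {a b} ha hb u hu => by
    have h1 := ha u hu
    have h2 := hb u hu
    simp only [form] at h1 h2 ⊢
    rw [Matrix.mulVec_add, dotProduct_add, h1, h2, add_zero]
  smul_mem' := fun c a ha u hu => by
    have h1 := ha u hu
    simp only [form] at h1 ⊢
    rw [Matrix.mulVec_smul, dotProduct_smul, h1, smul_zero]

/-- The flag `ξ^⊥`, with `(ξ^⊥)ʲ = (ξ^(d-j))^⊥`. -/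
def perpFlag (ξ : FullFlag d 𝕜) : Fin (d + 1) → Sub d 𝕜 := fun j => o.perp (ξ.sub j.rev)

/-- The set `F(V)ᵒ` of `o`-generic flags: those transverse to `ξ^⊥`. -/
def generic : Set (FullFlag d 𝕜) := {ξ | Transverse ξ.sub (o.perpFlag ξ)}

/-- The orbit `F(V)ᵒ_ξ = Hᵒ · ξ`. -/
def orbit (ξ : FullFlag d 𝕜) : Set (FullFlag d 𝕜) := {η | ∃ h ∈ o.stab, η = h • ξ}

/-- A basis of lines of `V`: a set of `d` lines that span `V`. -/
def _root_.PQCartan.IsLineBasis (C : Set (Sub d 𝕜)) : Prop :=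
  (∀ l ∈ C, Module.finrank 𝕜 l = 1) ∧ C.ncard = d ∧ sSup C = ⊤

/-- The `o`-orthogonal bases of lines of `V`. -/
def lineBases : Set (Set (Sub d 𝕜)) :=
  {C | IsLineBasis C ∧ ∀ l ∈ C, ∀ l' ∈ C, l ≠ l' → ∀ u ∈ l, ∀ v ∈ l', o.form u v = 0}

/-- The set `𝓑_{o,G}` of elements of `G` taking some `o`-orthogonal basis of lines to an
`o`-orthogonal basis of lines. -/
def basisTakers : Set (G d 𝕜) :=
  {g | ∃ C ∈ o.lineBases, (fun l : Sub d 𝕜 => g • l) '' C ∈ o.lineBases}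

/-- The `-1` eigenspace of `dσ` in the Lie algebra of `G`: it is `𝔮ᵒ` for the base point `o`, and
`𝔭^τ` for an inner product `τ`. -/
def minusSpace : Set (Mat d 𝕜) := {X | X.trace = 0 ∧ o.dsigma X = -X}

/-- `τ ∈ Sᵒ`: the Cartan involution `τ` is that of an inner product and commutes with `dσᵒ`. -/
def MemS (τ : HermForm d 𝕜) : Prop :=
  (∀ v, v ≠ 0 → 0 < RCLike.re (τ.form v v)) ∧
    ∀ X : Mat d 𝕜, X.trace = 0 → τ.dsigma (o.dsigma X) = o.dsigma (τ.dsigma X)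

end HermForm

/-! ### Cartan subspaces, roots and chambers -/

/-- `𝔟` is a maximal subalgebra in `𝔭^τ ∩ 𝔮ᵒ`. -/
def IsMaximalSubalgebra (o τ : HermForm d 𝕜) (𝔟 : LieSubalgebra ℝ (Mat d 𝕜)) : Prop :=
  Maximal (fun 𝔠 : LieSubalgebra ℝ (Mat d 𝕜) => (𝔠 : Set (Mat d 𝕜)) ⊆ τ.minusSpace ∩ o.minusSpace) 𝔟

/-- The Lie algebra `𝔤` of `G`, i.e. the traceless matrices. -/
def lieG (d : ℕ) (𝕜 : Type*) [RCLike 𝕜] : Set (Mat d 𝕜) := {X | X.trace = 0}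

/-- The Lie algebra `𝔤^{τo}` of fixed points of `τ ∘ dσᵒ`. -/
def lieGTauO (o τ : HermForm d 𝕜) : Set (Mat d 𝕜) := {X | X.trace = 0 ∧ τ.dsigma (o.dsigma X) = X}

section Chambers

variable (𝔟 : LieSubalgebra ℝ (Mat d 𝕜))

/-- The restricted roots of `𝔟` in `𝔰`. -/
def restrictedRoots (𝔰 : Set (Mat d 𝕜)) : Set (Module.Dual ℝ 𝔟) :=
  {α | α ≠ 0 ∧ ∃ Y ∈ 𝔰, Y ≠ 0 ∧ ∀ X : 𝔟, ⁅(X : Mat d 𝕜), Y⁆ = α X • Y}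

/-- Closed Weyl chambers of a set of roots: closures of connected components of the complement
of the root hyperplanes. -/
def IsWeylChamber {𝔟 : LieSubalgebra ℝ (Mat d 𝕜)} (R : Set (Module.Dual ℝ 𝔟)) (S : Set 𝔟) : Prop :=
  ∃ x ∈ {X : 𝔟 | ∀ α ∈ R, α X ≠ 0},
    S = closure (connectedComponentIn {X : 𝔟 | ∀ α ∈ R, α X ≠ 0} x)

/-- The positive system `Σ⁺(𝔤, 𝔞)` of the chamber `S`. -/
def posRoots (S : Set 𝔟) : Set (Module.Dual ℝ 𝔟) :=
  {α | α ∈ restrictedRoots 𝔟 (lieG d 𝕜) ∧ ∀ X ∈ S, 0 ≤ α X}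

/-- The basis of lines `𝒞` determined by `𝔟`: the common eigenlines of `𝔟`. -/
def eigenLines : Set (Sub d 𝕜) :=
  {l | Module.finrank 𝕜 l = 1 ∧ ∀ X ∈ 𝔟, ∀ v ∈ l, X *ᵥ v ∈ l}

/-- `ε_ℓ(X)`: the (real) eigenvalue of `X` on the line `ℓ`. -/
def eig (l : Sub d 𝕜) (X : Mat d 𝕜) : ℝ :=
  Classical.epsilon fun a : ℝ => ∀ v ∈ l, X *ᵥ v = (a : 𝕜) • v

/-- `S` is the chamber of `Σ(𝔤, 𝔞)` corresponding to a total order `ℓ₁, …, ℓ_d` on `𝒞`, and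
`ξ` is the flag `ξʲ = ℓ₁ ⊕ ⋯ ⊕ ℓ_j`. -/
def IsFlagOfChamber (S : Set 𝔟) (ξ : FullFlag d 𝕜) : Prop :=
  ∃ e : Fin d → Sub d 𝕜, Function.Injective e ∧ Set.range e = eigenLines 𝔟 ∧
    S = {X : 𝔟 | ∀ i j, i ≤ j → eig (e j) X ≤ eig (e i) X} ∧
    ∀ k, ξ.sub k = ⨆ i : Fin d, ⨆ _ : i.castSucc < k, e i

/-- The flag `ξ_{𝔞⁺}` of a chamber. -/
def chamberFlag (S : Set 𝔟) : FullFlag d 𝕜 := Classical.epsilon fun ξ => IsFlagOfChamber 𝔟 S ξ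

/-- The chamber `𝔞⁺_ξ` of a flag spanned by `𝒞`. -/
def flagChamber (ξ : FullFlag d 𝕜) : Set 𝔟 := Classical.epsilon fun S => IsFlagOfChamber 𝔟 S ξ

/-- `𝔟⁺`-compatible Weyl chambers. -/
def IsCompatibleChamber (bplus S : Set 𝔟) : Prop :=
  IsWeylChamber (restrictedRoots 𝔟 (lieG d 𝕜)) S ∧ S ⊆ bplus

/-- `𝔟⁺`-compatible flags. -/
def IsCompatibleFlag (bplus : Set 𝔟) (ξ : FullFlag d 𝕜) : Prop :=
  ∃ S, IsCompatibleChamber 𝔟 bplus S ∧ IsFlagOfChamber 𝔟 S ξ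

end Chambers

/-! ### Weyl group -/

section Weyl

variable (τ : HermForm d 𝕜) (𝔟 : LieSubalgebra ℝ (Mat d 𝕜))

/-- `Ŵ`, the normalizer of `𝔟` in `K^τ`. -/
def hatW : Subgroup (G d 𝕜) where
  carrier := {k | k ∈ τ.stab ∧ ∀ X, Ad k X ∈ 𝔟 ↔ X ∈ 𝔟}
  one_mem' := ⟨one_mem _, fun X => by simp⟩
  mul_mem' := fun {a b} ha hb => ⟨mul_mem ha.1 hb.1, fun X => by
    rw [map_mul, Module.End.mul_apply, ha.2, hb.2]⟩
  inv_mem' := fun {a} ha => ⟨inv_mem ha.1, fun X => by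
    rw [← ha.2, ← Module.End.mul_apply, ← map_mul, mul_inv_cancel, map_one, Module.End.one_apply]⟩

/-- `M`, the centralizer of `𝔟` in `K^τ`. -/
def centM : Subgroup (G d 𝕜) where
  carrier := {k | k ∈ τ.stab ∧ ∀ X ∈ 𝔟, Ad k X = X}
  one_mem' := ⟨one_mem _, fun X _ => by simp⟩
  mul_mem' := fun {a b} ha hb => ⟨mul_mem ha.1 hb.1, fun X hX => by
    rw [map_mul, Module.End.mul_apply, hb.2 X hX, ha.2 X hX]⟩
  inv_mem' := fun {a} ha => ⟨inv_mem ha.1, fun X hX => by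
    conv_lhs => rw [← ha.2 X hX]
    rw [← Module.End.mul_apply, ← map_mul, inv_mul_cancel, map_one, Module.End.one_apply]⟩

instance : ((centM τ 𝔟).subgroupOf (hatW τ 𝔟)).Normal where
  conj_mem := by
    intro m hm g
    rw [Subgroup.mem_subgroupOf] at hm ⊢
    refine ⟨mul_mem (mul_mem g.2.1 hm.1) (inv_mem g.2.1), fun X hX => ?_⟩
    have hX' : Ad ((g⁻¹ : hatW τ 𝔟) : G d 𝕜) X ∈ 𝔟 := ((g⁻¹).2.2 X).2 hX
    rw [Subgroup.coe_mul, Subgroup.coe_mul, map_mul, map_mul, Module.End.mul_apply,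
      Module.End.mul_apply, hm.2 _ hX', ← Module.End.mul_apply, ← map_mul, ← Subgroup.coe_mul,
      mul_inv_cancel, Subgroup.coe_one, map_one, Module.End.one_apply]

/-- The Weyl group `W = Ŵ / M`. -/
abbrev W := hatW τ 𝔟 ⧸ (centM τ 𝔟).subgroupOf (hatW τ 𝔟)

/-- The action of `Ŵ` on `𝔟`. -/
def hatWAct : hatW τ 𝔟 →* Module.End ℝ 𝔟 where
  toFun k :=
    { toFun := fun X => ⟨Ad (k : G d 𝕜) X, (k.2.2 X).2 X.2⟩
      map_add' := fun X Y => Subtype.ext (by simp)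
      map_smul' := fun c X => Subtype.ext (by simp) }
  map_one' := by ext1 X; apply Subtype.ext; simp
  map_mul' a b := by ext1 X; apply Subtype.ext; simp

/-- The action of the Weyl group on `𝔟`. -/
def weylAct : W τ 𝔟 →* Module.End ℝ 𝔟 :=
  QuotientGroup.lift _ (hatWAct τ 𝔟) (by
    intro k hk
    rw [Subgroup.mem_subgroupOf] at hk
    ext1 X
    apply Subtype.ext
    exact hk.2 X X.2)

/-- `w_{ξ ξ'}`: the unique element of `W` with `w · ξ' = ξ`, for flags spanned by `𝒞`. -/
def weylTo (ξ ξ' : FullFlag d 𝕜) : W τ 𝔟 :=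
  Classical.epsilon fun w => ∃ k : hatW τ 𝔟, QuotientGroup.mk k = w ∧ (k : G d 𝕜) • ξ' = ξ

variable (o : HermForm d 𝕜) (bplus : Set 𝔟)

/-- `𝒞⁺`: the lines of `𝒞` on which the form `o` is positive. -/
def posLines : Set (Sub d 𝕜) :=
  {l | l ∈ eigenLines 𝔟 ∧ ∀ v ∈ l, v ≠ 0 → 0 < RCLike.re (o.form v v)}

/-- `𝒞⁻`: the lines of `𝒞` on which the form `o` is negative. -/
def negLines : Set (Sub d 𝕜) :=
  {l | l ∈ eigenLines 𝔟 ∧ ∀ v ∈ l, v ≠ 0 → RCLike.re (o.form v v) < 0}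

/-- The order on lines induced by `𝔟⁺`: `l` comes before `l'` (total on `𝒞⁺` and on `𝒞⁻`). -/
def Precedes {𝔟 : LieSubalgebra ℝ (Mat d 𝕜)} (bplus : Set 𝔟) (l l' : Sub d 𝕜) : Prop :=
  ∀ X ∈ bplus, eig l' (X : Mat d 𝕜) ≤ eig l (X : Mat d 𝕜)

/-- `w` preserves `𝒞⁺` and `𝒞⁻` and reverses their total orders induced by `𝔟⁺`. -/
def IsOpposition (w : W τ 𝔟) : Prop :=
  ∃ k : hatW τ 𝔟, QuotientGroup.mk k = w ∧
    (∀ l ∈ posLines 𝔟 o, (k : G d 𝕜) • l ∈ posLines 𝔟 o) ∧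
    (∀ l ∈ negLines 𝔟 o, (k : G d 𝕜) • l ∈ negLines 𝔟 o) ∧
    (∀ l ∈ posLines 𝔟 o, ∀ l' ∈ posLines 𝔟 o,
      Precedes bplus l l' → Precedes bplus ((k : G d 𝕜) • l') ((k : G d 𝕜) • l)) ∧
    (∀ l ∈ negLines 𝔟 o, ∀ l' ∈ negLines 𝔟 o,
      Precedes bplus l l' → Precedes bplus ((k : G d 𝕜) • l') ((k : G d 𝕜) • l))

/-- The element `w_{𝔟⁺}` of `W`. -/
def wOpp : W τ 𝔟 := Classical.epsilon fun w => IsOpposition τ 𝔟 o bplus w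

/-- The opposition involution `ι_{𝔟⁺}(X) = -w_{𝔟⁺} · X`. -/
def iota (X : 𝔟) : 𝔟 := -weylAct τ 𝔟 (wOpp τ 𝔟 o bplus) X

/-- `ι_{𝔟⁺}(ξ)`: the flag of the chamber `ι_{𝔟⁺}(𝔞⁺_ξ)`. -/
def iotaFlag (ξ : FullFlag d 𝕜) : FullFlag d 𝕜 :=
  chamberFlag 𝔟 (iota τ 𝔟 o bplus '' flagChamber 𝔟 ξ)

end Weyl

/-! ### Cartan, Jordan and `(p,q)`-Cartan projections -/

open Classical in
/-- The exponential map of `G`, on traceless matrices (where `det (exp X) = 1`). -/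
def expG (X : Mat d 𝕜) : G d 𝕜 :=
  if h : (NormedSpace.exp X).det = 1 then QuotientGroup.mk ⟨NormedSpace.exp X, h⟩ else 1

section Projections

variable (τ : HermForm d 𝕜) (𝔟 : LieSubalgebra ℝ (Mat d 𝕜)) (aplus : Set 𝔟)

/-- `g = k exp(X) l` is a Cartan decomposition of `g`, for `t = (k, X, l)`. -/
def IsCartanDecomp (g : G d 𝕜) (t : G d 𝕜 × 𝔟 × G d 𝕜) : Prop :=
  t.1 ∈ τ.stab ∧ t.2.1 ∈ aplus ∧ t.2.2 ∈ τ.stab ∧ g = t.1 * expG (t.2.1 : Mat d 𝕜) * t.2.2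

/-- A Cartan decomposition of `g`. -/
def cartanDecomp (g : G d 𝕜) : G d 𝕜 × 𝔟 × G d 𝕜 :=
  Classical.epsilon fun t => IsCartanDecomp τ 𝔟 aplus g t

/-- The Cartan projection `a^τ(g)`. -/
def cartanProj (g : G d 𝕜) : 𝔟 := (cartanDecomp τ 𝔟 aplus g).2.1

/-- The Cartan attractor `U^τ(g) = k · ξ_{𝔞⁺}` of an element with gaps. -/
def attractor (g : G d 𝕜) : FullFlag d 𝕜 := (cartanDecomp τ 𝔟 aplus g).1 • chamberFlag 𝔟 aplus

/-- The Cartan repellor `S^τ(g) = U^τ(g⁻¹)`. -/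
def repellor (g : G d 𝕜) : FullFlag d 𝕜 := attractor τ 𝔟 aplus g⁻¹

/-- The Jordan projection `λ(g) = lim a^τ(gⁿ) / n`. -/
def jordanProj (g : G d 𝕜) : 𝔟 :=
  limUnder atTop fun n : ℕ => (n : ℝ)⁻¹ • cartanProj τ 𝔟 aplus (g ^ n)

variable (o : HermForm d 𝕜) (bplus : Set 𝔟)

/-- `X` is the `𝔟⁺`-part of some `(p,q)`-Cartan decomposition `g = h ŵ exp(X) h'`. -/
def IsPQCartanPart (g : G d 𝕜) (X : 𝔟) : Prop :=
  X ∈ bplus ∧ ∃ h ∈ o.stab, ∃ w ∈ hatW τ 𝔟, ∃ h' ∈ o.stab,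
    g = h * w * expG (X : Mat d 𝕜) * h'

/-- The `(p,q)`-Cartan projection `bᵒ(g)`, for `g ∈ 𝓑_{o,G}`. -/
def pqCartanProj (g : G d 𝕜) : 𝔟 := Classical.epsilon fun X => IsPQCartanPart τ 𝔟 o bplus g X

end Projections

/-- The restriction of `B` to `𝔭^τ` is a `K^τ`-invariant inner product.  Such inner products
correspond to the `G`-invariant Riemannian metrics of the Riemannian symmetric space
(identify its tangent space at `τ` with `𝔭^τ`).  Only the values of `B` on `𝔭^τ` matter. -/
structure IsInvariantMetric (τ : HermForm d 𝕜) (B : LinearMap.BilinForm ℝ (Mat d 𝕜)) : Prop where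
  symm : ∀ X ∈ τ.minusSpace, ∀ Y ∈ τ.minusSpace, B X Y = B Y X
  pos : ∀ X ∈ τ.minusSpace, X ≠ 0 → 0 < B X X
  invariant : ∀ k ∈ τ.stab, ∀ X ∈ τ.minusSpace, ∀ Y ∈ τ.minusSpace, B (Ad k X) (Ad k Y) = B X Y

/-- The norm `‖·‖_𝔟` on `𝔟` induced by the Riemannian metric. -/
def normB {𝔟 : LieSubalgebra ℝ (Mat d 𝕜)} (B : LinearMap.BilinForm ℝ (Mat d 𝕜)) (X : 𝔟) : ℝ :=
  Real.sqrt (B (X : Mat d 𝕜) (X : Mat d 𝕜))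

end PQCartan

end

noncomputable section

namespace PQCartan

variable {d : ℕ} {𝕜 : Type*} [RCLike 𝕜]

/-! ### Leading minors and the bounded Gram–Schmidt process -/

/-! There is a basis orthogonal for both forms in which 𝔟 is the space of real traceless diagonal
matrices, `aplus` is the set of decreasing ones and `bplus` the set of those decreasing along each
sign class (`exists_isAdaptedFrame_SL`). There o becomes a positive multiple of J = diag ε, K^τ
becomes the image of the special unitary group, and g becomes a matrix B = K exp(a) M with K, M
unitary.

Everything is read off the Hermitian pencil (J, Bᴴ J B). A basis Q orthogonal for both members is an
o-orthogonal basis that g takes to an o-orthogonal basis. Since σᵒ(g⁻¹)g has matrix J Bᴴ J B, the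
columns of Q are its eigenvectors and the ratios μ_i of the two forms are its eigenvalues. So it
suffices to find Q, with prescribed signs ε', and real μ_i of strictly decreasing moduli, with
log|μ_i| = 2 a_i + O(1) (`IsPencilDiag`, `IsAdaptedFrame.exists_pencilDiag`).

A pencil without definite member need not be diagonalizable; large gaps and generic flags make it
so. Let K' be the left unitary factor of B⁻¹. Compactness of the two sets of flags bounds below the
leading minors of Kᴴ J K and K'ᴴ J K' (`exists_minor_bound`), so Gram–Schmidt runs with bounded
coefficients (`exists_lower_diagonalize`). Because M K' is the order-reversing permutation up to
phases (`exists_phase_of_cartan_inv`), all the matrices produced are triangular in the direction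
that conjugation by exp(a) contracts. The pencil turns into (F, diag x) with F close to diag ε' and
|x_i| comparable to exp(2 a_i), hence widely separated (`exists_pencil_diag`,
`exists_orthogonal_diag`). Each eigenvalue is then caught by a sign change of the determinant, and
its eigenvector concentrates on one coordinate, which fixes its sign (`exists_pencil_eigenvector`).

Signs and order: if ξ_s lists the lines of the frame in the order σ, a repellor in Hᵒ·ξ_s forces ε'
= ε ∘ σ ∘ rev. The flag ι(ξ_s) lists the lines in the order θ = ω σ rev, with ω the opposition; thus
ε ∘ θ = ε' and θ is increasing on sign classes. Hence (1/2) log|μ| ∘ θ⁻¹ lies in `bplus` and is a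
(p,q)-Cartan part of g, while w acts on coordinates by ∘ θ⁻¹. This gives the formula and the
estimate.

Uniqueness holds because any other decomposition of g diagonalizes the same pencil, whose spectrum
has distinct moduli (`IsPencilDiag.eq_of_isPQCartanPart`). The Jordan projection is computed from J
Bᴴ J B = Q diag(μ) Q⁻¹: the Cartan projection of its n-th power stays at bounded distance from n
log|μ| (`exists_cartan_bound`). -/

/-- The leading principal minor of size `j`. -/
def leadMinor (N : Mat d 𝕜) (j : ℕ) (h : j ≤ d) : 𝕜 :=
  (N.submatrix (Fin.castLE h) (Fin.castLE h)).det

/-- The Schur complement of the upper left entry. -/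
def schur (N : Mat (d + 1) 𝕜) : Mat d 𝕜 :=
  Matrix.of fun i k => N i.succ k.succ - N i.succ 0 / N 0 0 * N 0 k.succ

theorem schur_isHermitian {N : Mat (d + 1) 𝕜} (hN : N.IsHermitian) : (schur N).IsHermitian := by
  ext i k
  have h := fun i j => hN.apply i j
  simp only [schur, Matrix.conjTranspose_apply, Matrix.of_apply, star_sub, star_mul', star_div₀, h]
  ring

/-- Subtracting multiples of the first row clears the first column without changing the determinant,
and what remains below is a block of the Schur complement. -/
theorem leadMinor_succ (N : Mat (d + 1) 𝕜) (h0 : N 0 0 ≠ 0) (j : ℕ) (h : j + 1 ≤ d + 1) :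
    leadMinor N (j + 1) h = N 0 0 * leadMinor (schur N) j (Nat.le_of_succ_le_succ h) := by
  unfold leadMinor
  set A := N.submatrix (Fin.castLE h) (Fin.castLE h) with hA
  set B : Matrix (Fin (j + 1)) (Fin (j + 1)) 𝕜 := Matrix.of fun i k =>
    A i k - (if i = 0 then 0 else A i 0 / A 0 0) * A 0 k with hB
  have hA0 : A 0 0 = N 0 0 := rfl
  have hdet : A.det = B.det := by
    refine Matrix.det_eq_of_forall_row_eq_smul_add_const
      (fun i => if i = 0 then 0 else A i 0 / A 0 0) 0 (by simp) ?_
    intro i k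
    simp [hB]
  rw [hdet, Matrix.det_succ_column_zero, Fin.sum_univ_succ, Finset.sum_eq_zero]
  · have : B.submatrix (Fin.succAbove 0) Fin.succ
        = (schur N).submatrix (Fin.castLE (Nat.le_of_succ_le_succ h))
          (Fin.castLE (Nat.le_of_succ_le_succ h)) := by
      ext i k
      simp [hB, hA, schur, Fin.succ_ne_zero]
    rw [this]
    simp [hB, hA0]
  · intro i _
    have : B i.succ 0 = 0 := by
      simp [hB, Fin.succ_ne_zero, hA0, h0]
    rw [this]; ring

/-- Gram–Schmidt for an indefinite form, with uniform bounds. It only ever divides by pivots, which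
are quotients of consecutive leading minors, so lower bounds on the minors control everything. The
induction eliminates the first row and column and passes to the Schur complement; the last clause
lets the signs of the pivots be read off the minors. -/
theorem exists_lower_diagonalize (d : ℕ) : ∀ (δ R : ℝ), 0 < δ → ∃ C : ℝ, 0 < C ∧
    ∀ N : Mat d 𝕜, N.IsHermitian → (∀ i j, ‖N i j‖ ≤ R) →
      (∀ j (h : j ≤ d), δ ≤ ‖leadMinor N j h‖) →
      ∃ (u : Mat d 𝕜) (D : Fin d → ℝ), (∀ i j, i < j → u i j = 0) ∧ (∀ i, u i i = 1) ∧
        (∀ i j, ‖u i j‖ ≤ C) ∧ (∀ i, C⁻¹ ≤ |D i| ∧ |D i| ≤ C) ∧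
        u * N * uᴴ = Matrix.diagonal (fun i => (D i : 𝕜)) ∧
        ∀ j (h : j ≤ d), leadMinor N j h = ∏ i : Fin j, (D (Fin.castLE h i) : 𝕜) := by
  induction d with
  | zero =>
    intro δ R hδ
    refine ⟨1, one_pos, fun N _ _ _ => ⟨N, Fin.elim0, fun i => i.elim0, fun i => i.elim0,
      fun i => i.elim0, fun i => i.elim0, Subsingleton.elim _ _, fun j h => ?_⟩⟩
    obtain rfl : j = 0 := by omega
    simp [leadMinor]
  | succ n ih =>
    intro δ R hδ
    by_cases hR : 0 < R
    swap
    · refine ⟨1, one_pos, fun N _ hb hm => ?_⟩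
      have h0 : N = 0 := by
        ext i j
        exact norm_le_zero_iff.1 ((hb i j).trans (not_lt.1 hR))
      have := hm 1 (by omega)
      simp [h0, leadMinor] at this
      linarith
    -- The minors of the Schur complement are those of `N` divided by the entry `N 0 0`, of norm at
    -- most `R`; its entries gain at most `(R / δ) * R`.
    obtain ⟨C, hC, ih⟩ := ih (δ / R) (R + R / δ * R) (by positivity)
    -- One summand per bound needed: the entry 1, the inductive block, the first pivot from above,
    -- the first pivot from below, and the new first column.
    refine ⟨1 + C + R + δ⁻¹ + n * (C * (R / δ)), by positivity, fun N hN hb hm => ?_⟩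
    set C' := 1 + C + R + δ⁻¹ + n * (C * (R / δ)) with hC'
    have hnn : 0 ≤ n * (C * (R / δ)) := by positivity
    have hδi : 0 < δ⁻¹ := by positivity
    have h1 : leadMinor N 1 (by omega) = N 0 0 := by simp [leadMinor]
    have hn : δ ≤ ‖N 0 0‖ := by rw [← h1]; exact hm 1 _
    have hn0 : N 0 0 ≠ 0 := norm_pos_iff.1 (hδ.trans_le hn)
    have hquot : ∀ i, ‖N i 0 / N 0 0‖ ≤ R / δ := by
      intro i
      rw [norm_div]
      exact div_le_div₀ hR.le (hb _ _) hδ hn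
    obtain ⟨u, D, hu0, hu1, hub, hD, hdiag, hprod⟩ := ih (schur N) (schur_isHermitian hN)
      (by
        intro i j
        refine (norm_sub_le _ _).trans (add_le_add (hb _ _) ?_)
        rw [norm_mul]
        exact mul_le_mul (hquot _) (hb _ _) (norm_nonneg _) (by positivity))
      (by
        intro j h
        have := hm (j + 1) (Nat.succ_le_succ h)
        rw [leadMinor_succ N hn0, norm_mul] at this
        rw [div_le_iff₀ hR]
        refine this.trans ?_
        rw [mul_comm]
        exact mul_le_mul_of_nonneg_left (hb _ _) (norm_nonneg _))
    -- The matrix `U` is `diag(1, u)` times the elementary matrix clearing the first column; `c` is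
    -- the resulting first column below the diagonal.
    set c : Fin n → 𝕜 := fun i => -∑ k, u i k * (N k.succ 0 / N 0 0) with hc
    set U : Mat (n + 1) 𝕜 := Matrix.of fun i k =>
      Fin.cases (Fin.cases 1 (fun _ => 0) k) (fun i' => Fin.cases (c i') (fun k' => u i' k') k) i
      with hU
    have U00 : U 0 0 = 1 := rfl
    have U0s : ∀ k, U 0 (Fin.succ k) = 0 := fun _ => rfl
    have Us0 : ∀ i, U (Fin.succ i) 0 = c i := fun _ => rfl
    have Uss : ∀ i k, U (Fin.succ i) (Fin.succ k) = u i k := fun _ _ => rfl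
    have hre : (((RCLike.re (N 0 0) : ℝ)) : 𝕜) = N 0 0 := hN.coe_re_apply_self 0
    have hreabs : |RCLike.re (N 0 0)| = ‖N 0 0‖ := by
      rw [← hre, RCLike.norm_ofReal, RCLike.ofReal_re]
    refine ⟨U, Fin.cons (RCLike.re (N 0 0)) D, ?_, ?_, ?_, ?_, ?_, ?_⟩
    · intro i j hij
      refine Fin.cases ?_ (fun j' hij => ?_) j hij
      · intro h; exact absurd h (Fin.not_lt_zero _)
      · refine Fin.cases ?_ (fun i' hij => ?_) i hij
        · intro _; exact U0s _
        · rw [Uss]; exact hu0 _ _ (Fin.succ_lt_succ_iff.1 hij)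
    · intro i
      refine Fin.cases U00 (fun i' => ?_) i
      rw [Uss, hu1]
    · intro i j
      refine Fin.cases (Fin.cases ?_ (fun j' => ?_) j) (fun i' => Fin.cases ?_ (fun j' => ?_) j) i
      · rw [U00, norm_one]; linarith
      · rw [U0s, norm_zero]; positivity
      · rw [Us0, hc, norm_neg]
        refine (norm_sum_le _ _).trans ?_
        have : ∑ k : Fin n, ‖u i' k * (N k.succ 0 / N 0 0)‖ ≤ ∑ _k : Fin n, C * (R / δ) := by
          refine Finset.sum_le_sum fun k _ => ?_
          rw [norm_mul]
          exact mul_le_mul (hub _ _) (hquot _) (norm_nonneg _) hC.le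
        refine this.trans ?_
        rw [Finset.sum_const, Finset.card_univ, Fintype.card_fin, nsmul_eq_mul]
        linarith
      · rw [Uss]; exact (hub _ _).trans (by linarith)
    · intro i
      refine Fin.cases ?_ (fun i' => ?_) i
      · simp only [Fin.cons_zero, hreabs]
        refine ⟨le_trans ?_ hn, (hb 0 0).trans (by linarith)⟩
        rw [inv_le_comm₀ (by positivity) hδ]; linarith
      · simp only [Fin.cons_succ]
        refine ⟨le_trans ?_ (hD i').1, (hD i').2.trans (by linarith)⟩
        rw [inv_le_inv₀ (by positivity) hC]; linarith
    · have hUN0 : ∀ k, (U * N) 0 k = N 0 k := by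
        intro k
        rw [Matrix.mul_apply, Fin.sum_univ_succ]; simp [U00, U0s]
      have hUNs0 : ∀ i, (U * N) (Fin.succ i) 0 = 0 := by
        intro i
        rw [Matrix.mul_apply, Fin.sum_univ_succ, Us0, hc]
        simp only [Uss, neg_mul, Finset.sum_mul]
        rw [neg_add_eq_zero]
        refine Finset.sum_congr rfl fun k _ => ?_
        field_simp
      have hUNss : ∀ i k, (U * N) (Fin.succ i) (Fin.succ k) = (u * schur N) i k := by
        intro i k
        rw [Matrix.mul_apply, Fin.sum_univ_succ, Us0, hc, Matrix.mul_apply]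
        simp only [Uss, schur, Matrix.of_apply, neg_mul, Finset.sum_mul, mul_sub,
          Finset.sum_sub_distrib]
        rw [neg_add_eq_sub]
        congr 1
        exact Finset.sum_congr rfl fun k _ => by ring
      have hs0 : ∀ i, (U * N * Uᴴ) (Fin.succ i) 0 = 0 := by
        intro i
        rw [Matrix.mul_apply, Fin.sum_univ_succ, hUNs0]
        simp [U0s]
      have hherm : (U * N * Uᴴ).IsHermitian := Matrix.isHermitian_mul_mul_conjTranspose U hN
      ext i j
      refine Fin.cases (Fin.cases ?_ (fun j' => ?_) j) (fun i' => Fin.cases ?_ (fun j' => ?_) j) i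
      · rw [Matrix.mul_apply, Fin.sum_univ_succ]
        simp [U00, U0s, hUN0, hre]
      · rw [← hherm.apply, hs0]; simp [(Fin.succ_ne_zero _).symm]
      · rw [hs0]; simp [Fin.succ_ne_zero]
      · rw [Matrix.mul_apply, Fin.sum_univ_succ, hUNs0, zero_mul, zero_add]
        have := congrFun (congrFun hdiag i') j'
        rw [Matrix.mul_apply] at this
        simp only [hUNss, Matrix.conjTranspose_apply, Uss] at this ⊢
        rw [this]
        simp [Matrix.diagonal_apply, Fin.succ_inj]
    · intro j h
      rcases j with _ | j
      · simp [leadMinor]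
      · rw [leadMinor_succ N hn0, Fin.prod_univ_succ, hprod]
        have e0 : Fin.castLE h 0 = 0 := rfl
        have es : ∀ i : Fin j, Fin.castLE h i.succ
          = (Fin.castLE (Nat.le_of_succ_le_succ h) i).succ := fun _ => rfl
        simp [e0, es, hre]

/-! ### Eigenvalues of a pencil close to a diagonal one -/

/-- A real diagonal matrix, with entries in `𝕜`. -/
def diagR (𝕜 : Type*) [RCLike 𝕜] (x : Fin d → ℝ) : Mat d 𝕜 :=
  Matrix.diagonal fun i => (x i : 𝕜)

theorem diagR_apply (x : Fin d → ℝ) (i j : Fin d) :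
    diagR 𝕜 x i j = if i = j then (x i : 𝕜) else 0 := by
  simp [diagR, Matrix.diagonal_apply]

theorem diagR_mul (x y : Fin d → ℝ) : diagR 𝕜 x * diagR 𝕜 y = diagR 𝕜 (x * y) := by
  simp [diagR, Matrix.diagonal_mul_diagonal]

@[simp] theorem diagR_conjTranspose (x : Fin d → ℝ) : (diagR 𝕜 x)ᴴ = diagR 𝕜 x := by
  rw [diagR, Matrix.diagonal_conjTranspose]
  congr 1; funext i; simp

theorem diagR_one : diagR 𝕜 (1 : Fin d → ℝ) = 1 := by
  simp [diagR]

theorem diagR_isHermitian (x : Fin d → ℝ) : (diagR 𝕜 x).IsHermitian := diagR_conjTranspose x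

/-- A vector of signs. -/
def IsSigns (ε : Fin d → ℝ) : Prop := ∀ i, ε i = 1 ∨ ε i = -1

theorem IsSigns.abs {ε : Fin d → ℝ} (h : IsSigns ε) (i) : |ε i| = 1 := by
  rcases h i with h | h <;> simp [h]

theorem IsSigns.mul_self {ε : Fin d → ℝ} (h : IsSigns ε) (i) : ε i * ε i = 1 := by
  rcases h i with h | h <;> simp [h]

theorem IsSigns.ne_zero {ε : Fin d → ℝ} (h : IsSigns ε) (i) : ε i ≠ 0 := by
  rcases h i with h | h <;> simp [h]

theorem IsSigns.diagR_mul_self {ε : Fin d → ℝ} (h : IsSigns ε) :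
    diagR 𝕜 ε * diagR 𝕜 ε = 1 := by
  rw [diagR_mul, ← diagR_one]; congr 1; funext i; exact h.mul_self i

/-- Strict diagonal dominance: each diagonal entry is at least `|t| / 2 - |t| η`, while the rest of
its row sums to at most `(d - 1) |t| η`. -/
theorem det_pencil_ne_zero {x : Fin d → ℝ} {t η : ℝ} {Z : Mat d 𝕜} {ε : Fin d → ℝ}
    (hηd : 4 * (d * η) < 1) (hZ : ∀ i j, ‖Z i j‖ ≤ η) (ht : t ≠ 0)
    (hx : ∀ i, |t| / 2 ≤ |x i - t * ε i|) :
    (diagR 𝕜 x - (t : 𝕜) • (diagR 𝕜 ε + Z)).det ≠ 0 := by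
  have htp : 0 < |t| := abs_pos.2 ht
  refine det_ne_zero_of_sum_row_lt_diag fun k => ?_
  have h1 : ∀ j ∈ Finset.univ.erase k,
      ‖(diagR 𝕜 x - (t : 𝕜) • (diagR 𝕜 ε + Z)) k j‖ ≤ |t| * η := by
    intro j hj
    have hjk : ¬ (k = j) := fun h => (Finset.mem_erase.1 hj).1 h.symm
    simp only [Matrix.sub_apply, Matrix.smul_apply, Matrix.add_apply, diagR_apply, hjk, if_false,
      zero_add, zero_sub, norm_neg, smul_eq_mul, norm_mul, RCLike.norm_ofReal]
    exact mul_le_mul_of_nonneg_left (hZ _ _) (abs_nonneg _)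
  have h2 : |t| / 2 - |t| * η ≤ ‖(diagR 𝕜 x - (t : 𝕜) • (diagR 𝕜 ε + Z)) k k‖ := by
    have e : (diagR 𝕜 x - (t : 𝕜) • (diagR 𝕜 ε + Z)) k k
        = ((x k - t * ε k : ℝ) : 𝕜) - (t : 𝕜) * Z k k := by
      simp only [Matrix.sub_apply, Matrix.smul_apply, Matrix.add_apply, diagR_apply, if_true,
        smul_eq_mul]
      push_cast; ring
    rw [e]
    refine le_trans ?_ (norm_sub_norm_le _ _)
    rw [norm_mul, RCLike.norm_ofReal, RCLike.norm_ofReal]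
    exact sub_le_sub (hx k) (mul_le_mul_of_nonneg_left (hZ _ _) (abs_nonneg _))
  have hd : (1 : ℝ) ≤ d := by exact_mod_cast Fin.pos k
  refine lt_of_le_of_lt (Finset.sum_le_sum h1) (lt_of_lt_of_le ?_ h2)
  rw [Finset.sum_const, Finset.card_erase_of_mem (Finset.mem_univ _), Finset.card_univ,
    Fintype.card_fin, nsmul_eq_mul, Nat.cast_sub (Fin.pos k)]
  have : d * (|t| * η) < |t| / 2 := by nlinarith
  push_cast
  linarith

/-- The unperturbed pencil has the eigenvalue `x j * ε j`. A homotopy from the diagonal pencil keeps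
the signs of the real determinant at half and at twice this value, so the perturbed pencil still has
an eigenvalue in between. The separation of the `x i` makes all other rows dominant, so the
eigenvector is almost supported on the coordinate `j` and its `F`-norm has the sign `ε j`. -/
theorem exists_pencil_eigenvector {x : Fin d → ℝ} {η : ℝ} {F : Mat d 𝕜} {ε : Fin d → ℝ}
    (hε : IsSigns ε) (hη : 0 ≤ η) (hηd : 16 * (d * d * η) ≤ 1)
    (hF : F.IsHermitian) (hFε : ∀ i j, ‖(F - diagR 𝕜 ε) i j‖ ≤ η)
    (hx : ∀ i, x i ≠ 0) (hgap : ∀ i j, i < j → 16 * |x j| ≤ |x i|) (j : Fin d) :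
    ∃ μ : ℝ, |x j| / 2 ≤ |μ| ∧ |μ| ≤ 2 * |x j| ∧ ∃ w : Fin d → 𝕜, w ≠ 0 ∧
      (diagR 𝕜 x - (μ : 𝕜) • F) *ᵥ w = 0 ∧ 0 < ε j * RCLike.re (star w ⬝ᵥ (F *ᵥ w)) := by
  classical
  set Z := F - diagR 𝕜 ε with hZ
  have hFZ : F = diagR 𝕜 ε + Z := by rw [hZ]; abel
  have hd : (1 : ℝ) ≤ d := by exact_mod_cast Fin.pos j
  have hdη : 16 * (d * η) ≤ 1 := by
    have : d * η ≤ d * d * η := by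
      rw [mul_assoc]; exact le_mul_of_one_le_left (by positivity) hd
    linarith
  have hxj : 0 < |x j| := abs_pos.2 (hx j)
  have hfar : ∀ t : ℝ, |x j| / 2 ≤ |t| → |t| ≤ 2 * |x j| → ∀ i, i ≠ j →
      |t| / 2 ≤ |x i - t * ε i| := by
    intro t ht1 ht2 i hij
    have hte : |t * ε i| = |t| := by rw [abs_mul, hε.abs, mul_one]
    rcases lt_or_gt_of_ne hij with h | h
    · have := hgap i j h
      have := abs_sub_abs_le_abs_sub (x i) (t * ε i)
      linarith
    · have := hgap j i h
      have h2 := abs_sub_abs_le_abs_sub (t * ε i) (x i)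
      rw [abs_sub_comm] at h2
      linarith
  -- Zero of the `j`-th diagonal factor `x j - t * ε j`; the eigenvalue is sought in the form `r *
  -- c` with `r` between 1/2 and 2.
  set c : ℝ := x j * ε j with hc
  have hcabs : |c| = |x j| := by rw [hc, abs_mul, hε.abs, mul_one]
  have hnear : ∀ r : ℝ, r = 1 / 2 ∨ r = 2 → ∀ i, |r * c| / 2 ≤ |x i - r * c * ε i| := by
    intro r hr i
    by_cases hij : i = j
    · subst hij
      have : x i - r * c * ε i = x i * (1 - r) := by
        rw [hc]; linear_combination (-r * x i) * hε.mul_self i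
      rw [this, abs_mul r c, hcabs, abs_mul]
      rcases hr with rfl | rfl <;> norm_num [abs_of_pos] <;> linarith
    · refine hfar _ ?_ ?_ i hij <;> rw [abs_mul, hcabs] <;>
      rcases hr with rfl | rfl <;> norm_num [abs_of_pos] <;> linarith
  -- the determinant, with a parameter for the homotopy to the diagonal pencil
  set f : ℝ → ℝ → ℝ := fun s t =>
    RCLike.re (diagR 𝕜 x - (t : 𝕜) • (diagR 𝕜 ε + (s : 𝕜) • Z)).det with hf
  have hZherm : Z.IsHermitian := hF.sub (diagR_isHermitian ε)
  have hdet : ∀ s t, ((f s t : ℝ) : 𝕜)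
      = (diagR 𝕜 x - (t : 𝕜) • (diagR 𝕜 ε + (s : 𝕜) • Z)).det := by
    intro s t
    have hH : (diagR 𝕜 x - (t : 𝕜) • (diagR 𝕜 ε + (s : 𝕜) • Z)).IsHermitian := by
      rw [Matrix.IsHermitian, Matrix.conjTranspose_sub, Matrix.conjTranspose_smul,
        Matrix.conjTranspose_add, Matrix.conjTranspose_smul, hZherm.eq]
      simp
    rw [← RCLike.conj_eq_iff_re]
    have := Matrix.det_conjTranspose (diagR 𝕜 x - (t : 𝕜) • (diagR 𝕜 ε + (s : 𝕜) • Z))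
    rw [hH.eq] at this
    exact this.symm
  have hcont : Continuous fun p : ℝ × ℝ => f p.1 p.2 := by
    refine RCLike.continuous_re.comp (Continuous.matrix_det ?_)
    have h1 : Continuous fun p : ℝ × ℝ => (p.1 : 𝕜) := RCLike.continuous_ofReal.comp continuous_fst
    have h2 : Continuous fun p : ℝ × ℝ => (p.2 : 𝕜) := RCLike.continuous_ofReal.comp continuous_snd
    exact continuous_const.sub (h2.smul (continuous_const.add (h1.smul continuous_const)))
  -- At the two ends of the window the determinant never vanishes along the homotopy, hence it keeps
  -- its sign there.
  have hne : ∀ r : ℝ, r = 1 / 2 ∨ r = 2 → ∀ s ∈ Set.Icc (0 : ℝ) 1, f s (r * c) ≠ 0 := by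
    intro r hr s hs h0
    have h1 := hdet s (r * c)
    rw [h0] at h1
    refine det_pencil_ne_zero (x := x) (t := r * c) (η := η) (Z := (s : 𝕜) • Z) (ε := ε)
      (by linarith) ?_ ?_ (hnear r hr) (by rw [← h1]; simp)
    · intro i k
      rw [Matrix.smul_apply, norm_smul, RCLike.norm_ofReal, abs_of_nonneg hs.1]
      exact (mul_le_of_le_one_left (norm_nonneg _) hs.2).trans (hFε i k)
    · have : c ≠ 0 := mul_ne_zero (hx j) (hε.ne_zero j)
      rcases hr with rfl | rfl <;> simpa using this
  have hsame : ∀ r : ℝ, r = 1 / 2 ∨ r = 2 → 0 < f 0 (r * c) * f 1 (r * c) := by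
    intro r hr
    by_contra hcon
    have hc1 : ContinuousOn (fun s => f 0 (r * c) * f s (r * c)) (Set.Icc 0 1) :=
      (continuous_const.mul (hcont.comp (continuous_id.prodMk continuous_const))).continuousOn
    obtain ⟨s, hs, hs0⟩ := intermediate_value_Icc' (zero_le_one) hc1
      ⟨not_lt.1 hcon, mul_self_nonneg _⟩
    rcases mul_eq_zero.1 hs0 with h | h
    · exact hne r hr 0 (by simp) h
    · exact hne r hr s hs h
  have hprod : ∀ t, f 0 t = ∏ i, (x i - t * ε i) := by
    intro t
    have := hdet 0 t
    have e : diagR 𝕜 x - (t : 𝕜) • (diagR 𝕜 ε + ((0 : ℝ) : 𝕜) • Z)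
        = Matrix.diagonal fun i => ((x i - t * ε i : ℝ) : 𝕜) := by
      ext i k
      by_cases hik : i = k <;> simp [diagR_apply, hik]
    rw [e, Matrix.det_diagonal] at this
    exact_mod_cast this
  -- For the diagonal pencil only the `j`-th factor changes sign across the window: for `i < j` the
  -- term `x i` dominates, for `i > j` the term in `t` does.
  have hopp : f 0 (1 / 2 * c) * f 0 (2 * c) < 0 := by
    rw [hprod, hprod, ← Finset.prod_mul_distrib, ← Finset.mul_prod_erase _ _ (Finset.mem_univ j)]
    refine mul_neg_of_neg_of_pos ?_ (Finset.prod_pos fun i hi => ?_)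
    · have h1 : x j - 1 / 2 * c * ε j = x j / 2 := by
        rw [hc]; linear_combination (-(1 / 2) * x j) * hε.mul_self j
      have h2 : x j - 2 * c * ε j = - x j := by
        rw [hc]; linear_combination (-2 * x j) * hε.mul_self j
      rw [h1, h2]
      have := mul_self_pos.2 (hx j)
      nlinarith
    · have hij := (Finset.mem_erase.1 hi).1
      have hxi := hx i
      have key : ∀ r : ℝ, r = 1 / 2 ∨ r = 2 → |r * c * ε i| ≤ 2 * |x j| ∧ |x j| / 2 ≤ |r * c * ε i| := by
        intro r hr
        rw [abs_mul, hε.abs, mul_one, abs_mul, hcabs]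
        rcases hr with rfl | rfl <;> norm_num [abs_of_pos] <;> first | linarith | (constructor <;> linarith)
      obtain ⟨k1, k2⟩ := key _ (Or.inl rfl)
      obtain ⟨k3, k4⟩ := key _ (Or.inr rfl)
      rcases lt_or_gt_of_ne hij with h | h
      · have hg := hgap i j h
        rcases lt_or_gt_of_ne hxi with hs | hs
        · rw [abs_of_neg hs] at hg
          rw [abs_le] at k1 k3
          exact mul_pos_of_neg_of_neg (by linarith) (by linarith)
        · rw [abs_of_pos hs] at hg
          rw [abs_le] at k1 k3
          exact mul_pos (by linarith) (by linarith)
      · have hg := hgap j i h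
        have hi1 := (abs_le.1 (le_refl |x i|))
        have hsgn : 2 * c * ε i = 4 * (1 / 2 * c * ε i) := by ring
        rcases le_or_gt 0 (1 / 2 * c * ε i) with hs | hs
        · rw [abs_of_nonneg hs] at k2
          exact mul_pos_of_neg_of_neg (by linarith) (by linarith)
        · rw [abs_of_neg hs] at k2
          exact mul_pos (by linarith) (by linarith)
  have hsign : f 1 (1 / 2 * c) * f 1 (2 * c) < 0 := by
    have h1 := hsame _ (Or.inl rfl)
    have h2 := hsame _ (Or.inr rfl)
    by_contra hcon
    have h3 := mul_pos h1 h2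
    nlinarith [mul_nonneg (not_lt.1 hcon) (neg_nonneg.2 hopp.le)]
  obtain ⟨r, hr, hr0⟩ : ∃ r ∈ Set.Icc (1 / 2 : ℝ) 2, f 1 (r * c) = 0 := by
    have hc1 : ContinuousOn (fun r => f 1 (1 / 2 * c) * f 1 (r * c)) (Set.Icc (1 / 2 : ℝ) 2) :=
      (continuous_const.mul (hcont.comp (continuous_const.prodMk
        (continuous_id.mul continuous_const)))).continuousOn
    obtain ⟨r, hr, hr0⟩ := intermediate_value_Icc' (by norm_num) hc1
      ⟨hsign.le, mul_self_nonneg _⟩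
    refine ⟨r, hr, (mul_eq_zero.1 hr0).resolve_left fun h => ?_⟩
    rw [h] at hsign; simp at hsign
  have hr0' : 0 < r := lt_of_lt_of_le (by norm_num) hr.1
  have hμabs : |r * c| = r * |x j| := by rw [abs_mul, hcabs, abs_of_pos hr0']
  have hμ1 : |x j| / 2 ≤ |r * c| := by rw [hμabs]; nlinarith [hr.1]
  have hμ2 : |r * c| ≤ 2 * |x j| := by rw [hμabs]; nlinarith [hr.2]
  refine ⟨r * c, hμ1, hμ2, ?_⟩
  set μ := r * c with hμ
  have hμp : 0 < |μ| := by linarith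
  have hd0 : (diagR 𝕜 x - (μ : 𝕜) • F).det = 0 := by
    have := hdet 1 μ
    rw [hr0] at this
    rw [hFZ]
    simpa using this.symm
  obtain ⟨w, hw, hw0⟩ := Matrix.exists_mulVec_eq_zero_iff.2 hd0
  refine ⟨w, hw, hw0, ?_⟩
  -- Localization: the coordinate of largest modulus must be `j`, since the eigenvalue equation
  -- makes every other coordinate a small multiple of the largest one.
  have : Nonempty (Fin d) := ⟨j⟩
  obtain ⟨k, hk⟩ := Finite.exists_max fun i => ‖w i‖
  have hm : 0 < ‖w k‖ := by
    rw [norm_pos_iff]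
    intro h
    apply hw; funext i
    have := hk i
    rw [h, norm_zero] at this
    exact norm_le_zero_iff.1 this
  have hZw : ∀ i, ‖(Z *ᵥ w) i‖ ≤ d * η * ‖w k‖ := by
    intro i
    rw [Matrix.mulVec, dotProduct]
    refine (norm_sum_le _ _).trans ?_
    have : ∑ m : Fin d, ‖Z i m * w m‖ ≤ ∑ _m : Fin d, η * ‖w k‖ := by
      refine Finset.sum_le_sum fun m _ => ?_
      rw [norm_mul]
      exact mul_le_mul (hFε i m) (hk m) (norm_nonneg _) hη
    refine this.trans (le_of_eq ?_)
    rw [Finset.sum_const, Finset.card_univ, Fintype.card_fin, nsmul_eq_mul, mul_assoc]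
  have hrow : ∀ i, ((x i - μ * ε i : ℝ) : 𝕜) * w i = (μ : 𝕜) * (Z *ᵥ w) i := by
    intro i
    have h1 := congrFun hw0 i
    rw [hFZ, Matrix.sub_mulVec, Matrix.smul_mulVec, Matrix.add_mulVec] at h1
    simp only [Pi.sub_apply, Pi.smul_apply, Pi.add_apply, diagR, Matrix.mulVec_diagonal,
      smul_eq_mul, Pi.zero_apply] at h1
    push_cast
    linear_combination h1
  have hsmall : ∀ i, i ≠ j → ‖w i‖ ≤ 2 * (d * η) * ‖w k‖ := by
    intro i hij
    have h1 := congrArg norm (hrow i)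
    rw [norm_mul, norm_mul, RCLike.norm_ofReal, RCLike.norm_ofReal] at h1
    have h2 : |μ| / 2 * ‖w i‖ ≤ |μ| * (d * η * ‖w k‖) := by
      calc |μ| / 2 * ‖w i‖ ≤ |x i - μ * ε i| * ‖w i‖ :=
            mul_le_mul_of_nonneg_right (hfar μ hμ1 hμ2 i hij) (norm_nonneg _)
        _ = |μ| * ‖(Z *ᵥ w) i‖ := h1
        _ ≤ _ := mul_le_mul_of_nonneg_left (hZw i) (abs_nonneg _)
    have h3 : |μ| * ‖w i‖ ≤ |μ| * (2 * (d * η) * ‖w k‖) := by linarith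
    exact le_of_mul_le_mul_left h3 hμp
  have hkj : k = j := by
    by_contra hkj
    have := hsmall k hkj
    nlinarith
  subst hkj
  have hre : RCLike.re (star w ⬝ᵥ (F *ᵥ w))
      = ∑ i, ε i * ‖w i‖ ^ 2 + RCLike.re (star w ⬝ᵥ (Z *ᵥ w)) := by
    rw [hFZ, Matrix.add_mulVec, dotProduct_add, map_add]
    congr 1
    rw [dotProduct, map_sum]
    refine Finset.sum_congr rfl fun i _ => ?_
    rw [diagR, Matrix.mulVec_diagonal, Pi.star_apply, mul_left_comm, RCLike.star_def,
      RCLike.conj_mul]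
    rw [← RCLike.ofReal_pow, ← RCLike.ofReal_mul, RCLike.ofReal_re]
  have hZre : |RCLike.re (star w ⬝ᵥ (Z *ᵥ w))| ≤ d * (d * η) * ‖w k‖ ^ 2 := by
    refine (RCLike.abs_re_le_norm _).trans ?_
    rw [dotProduct]
    refine (norm_sum_le _ _).trans ?_
    have : ∑ m : Fin d, ‖star w m * (Z *ᵥ w) m‖ ≤ ∑ _m : Fin d, ‖w k‖ * (d * η * ‖w k‖) := by
      refine Finset.sum_le_sum fun m _ => ?_
      rw [norm_mul, Pi.star_apply, norm_star]
      exact mul_le_mul (hk m) (hZw m) (norm_nonneg _) (norm_nonneg _)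
    refine this.trans (le_of_eq ?_)
    rw [Finset.sum_const, Finset.card_univ, Fintype.card_fin, nsmul_eq_mul]; ring
  have hoff : |∑ i ∈ Finset.univ.erase k, ε i * ‖w i‖ ^ 2| ≤ d * (2 * (d * η) * ‖w k‖) ^ 2 := by
    refine (Finset.abs_sum_le_sum_abs _ _).trans ?_
    have : ∑ i ∈ Finset.univ.erase k, |ε i * ‖w i‖ ^ 2|
        ≤ ∑ _i ∈ Finset.univ.erase k, (2 * (d * η) * ‖w k‖) ^ 2 := by
      refine Finset.sum_le_sum fun i hi => ?_
      rw [abs_mul, hε.abs, one_mul, abs_of_nonneg (by positivity)]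
      exact pow_le_pow_left₀ (norm_nonneg _) (hsmall i (Finset.mem_erase.1 hi).1) 2
    refine this.trans ?_
    rw [Finset.sum_const, nsmul_eq_mul]
    refine mul_le_mul_of_nonneg_right ?_ (by positivity)
    have := Finset.card_le_univ (Finset.univ.erase k)
    rw [Fintype.card_fin] at this
    exact_mod_cast this
  rw [hre, ← Finset.add_sum_erase _ _ (Finset.mem_univ k)]
  set S := ∑ i ∈ Finset.univ.erase k, ε i * ‖w i‖ ^ 2
  set T := RCLike.re (star w ⬝ᵥ (Z *ᵥ w))
  have hST : |ε k * (S + T)| ≤ (1 / 2) * ‖w k‖ ^ 2 := by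
    rw [abs_mul, hε.abs, one_mul]
    refine (abs_add_le _ _).trans ((add_le_add hoff hZre).trans ?_)
    have e1 : d * (2 * (d * η) * ‖w k‖) ^ 2 = (4 * (d * d * η) * (d * η)) * ‖w k‖ ^ 2 := by ring
    have e2 : d * (d * η) * ‖w k‖ ^ 2 = (d * d * η) * ‖w k‖ ^ 2 := by ring
    rw [e1, e2, ← add_mul]
    refine mul_le_mul_of_nonneg_right ?_ (by positivity)
    have p1 : 0 ≤ d * η := by positivity
    have p2 : 0 ≤ d * d * η := by positivity
    nlinarith
  have := (abs_le.1 hST).1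
  have h4 : ε k * (ε k * ‖w k‖ ^ 2 + S + T) = ‖w k‖ ^ 2 + ε k * (S + T) := by
    linear_combination (‖w k‖ ^ 2) * hε.mul_self k
  rw [h4]
  have := pow_pos hm 2
  linarith

/-- The windows containing the moduli of the eigenvalues are disjoint, so the eigenvalues are
distinct reals and their eigenvectors are orthogonal for both Hermitian forms. None is isotropic, so
they can be rescaled to have `F`-norm equal to the prescribed signs. -/
theorem exists_pencil_diag_of_near {x : Fin d → ℝ} {η : ℝ} {F : Mat d 𝕜} {ε : Fin d → ℝ}
    (hε : IsSigns ε) (hη : 0 ≤ η) (hηd : 16 * (d * d * η) ≤ 1)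
    (hF : F.IsHermitian) (hFε : ∀ i j, ‖(F - diagR 𝕜 ε) i j‖ ≤ η)
    (hx : ∀ i, x i ≠ 0) (hgap : ∀ i j, i < j → 16 * |x j| ≤ |x i|) :
    ∃ (μ : Fin d → ℝ) (W : Mat d 𝕜), (∀ j, |x j| / 2 ≤ |μ j| ∧ |μ j| ≤ 2 * |x j|) ∧
      Wᴴ * F * W = diagR 𝕜 ε ∧ Wᴴ * diagR 𝕜 x * W = diagR 𝕜 (μ * ε) := by
  choose μ hμ1 hμ2 w hw0 hw hν using
    exists_pencil_eigenvector (𝕜 := 𝕜) hε hη hηd hF hFε hx hgap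
  set ν : Fin d → ℝ := fun j => RCLike.re (star (w j) ⬝ᵥ (F *ᵥ w j)) with hνdef
  have hdist : ∀ i j, i ≠ j → μ i ≠ μ j := by
    have key : ∀ i j, i < j → |μ j| < |μ i| := by
      intro i j hij
      have := hgap i j hij
      have := hμ2 j
      have := hμ1 i
      have := abs_pos.2 (hx j)
      linarith
    intro i j hij h
    rcases lt_or_gt_of_ne hij with h' | h'
    · have := key i j h'; rw [h] at this; exact lt_irrefl _ this
    · have := key j i h'; rw [h] at this; exact lt_irrefl _ this
  have hherm : ∀ (A : Mat d 𝕜), A.IsHermitian → ∀ u v : Fin d → 𝕜,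
      star (star u ⬝ᵥ (A *ᵥ v)) = star v ⬝ᵥ (A *ᵥ u) := by
    intro A hA u v
    rw [Matrix.star_dotProduct, star_star, Matrix.star_mulVec, hA.eq, ← Matrix.dotProduct_mulVec]
  have hEF : ∀ i j, star (w i) ⬝ᵥ (diagR 𝕜 x *ᵥ w j) = (μ j : 𝕜) * (star (w i) ⬝ᵥ (F *ᵥ w j)) := by
    intro i j
    have := hw j
    rw [Matrix.sub_mulVec, sub_eq_zero, Matrix.smul_mulVec] at this
    rw [this, dotProduct_smul, smul_eq_mul]
  have horth : ∀ i j, i ≠ j → star (w i) ⬝ᵥ (F *ᵥ w j) = 0 := by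
    intro i j hij
    have h1 := congrArg star (hEF i j)
    rw [star_mul', hherm _ (diagR_isHermitian x), hherm _ hF, hEF j i] at h1
    have h2 : ((μ i : 𝕜) - μ j) * (star (w j) ⬝ᵥ (F *ᵥ w i)) = 0 := by
      rw [sub_mul, sub_eq_zero, h1]; simp
    have h3 : ((μ i : 𝕜) - μ j) ≠ 0 := by
      rw [sub_ne_zero]; exact_mod_cast hdist i j hij
    have h4 := (mul_eq_zero.1 h2).resolve_left h3
    rw [← hherm _ hF, h4, star_zero]
  have hdiag : ∀ j, star (w j) ⬝ᵥ (F *ᵥ w j) = (ν j : 𝕜) := by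
    intro j
    have := hherm _ hF (w j) (w j)
    rw [hνdef]
    exact (RCLike.conj_eq_iff_re.1 this).symm
  have hνne : ∀ j, ν j ≠ 0 := fun j h => by
    have := hν j
    change 0 < ε j * ν j at this
    rw [h, mul_zero] at this
    exact lt_irrefl _ this
  set s : Fin d → ℝ := fun j => (Real.sqrt |ν j|)⁻¹ with hs
  have hsν : ∀ j, s j * ν j * s j = ε j := by
    intro j
    have h1 : 0 < |ν j| := abs_pos.2 (hνne j)
    have h2 : Real.sqrt |ν j| * Real.sqrt |ν j| = |ν j| := Real.mul_self_sqrt h1.le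
    have h3 : 0 < Real.sqrt |ν j| := Real.sqrt_pos.2 h1
    have h4 : ν j = ε j * |ν j| := by
      have := hν j
      change 0 < ε j * ν j at this
      rcases hε j with h | h <;> rw [h] at this ⊢
      · rw [abs_of_pos (by linarith)]; ring
      · rw [abs_of_neg (by linarith)]; ring
    have : s j * ν j * s j = ν j / (Real.sqrt |ν j| * Real.sqrt |ν j|) := by
      rw [hs]; field_simp
    rw [this, h2, h4, abs_mul, hε.abs, one_mul, abs_abs]
    field_simp
  set W0 : Mat d 𝕜 := Matrix.of fun i j => w j i with hW0
  have hent : ∀ (A : Mat d 𝕜) i j, (W0ᴴ * A * W0) i j = star (w i) ⬝ᵥ (A *ᵥ w j) := by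
    intro A i j
    rw [mul_assoc, Matrix.mul_apply_eq_vecMul]
    rfl
  refine ⟨μ, W0 * diagR 𝕜 s, fun j => ⟨hμ1 j, hμ2 j⟩, ?_, ?_⟩
  · have h1 : W0ᴴ * F * W0 = diagR 𝕜 ν := by
      ext i j
      rw [hent, diagR_apply]
      split_ifs with h
      · rw [h, hdiag]
      · exact horth i j h
    have : (W0 * diagR 𝕜 s)ᴴ * F * (W0 * diagR 𝕜 s) = diagR 𝕜 s * (W0ᴴ * F * W0) * diagR 𝕜 s := by
      rw [Matrix.conjTranspose_mul, diagR_conjTranspose]; simp only [mul_assoc]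
    rw [this, h1, diagR_mul, diagR_mul]
    congr 1; funext j; exact hsν j
  · have h1 : W0ᴴ * diagR 𝕜 x * W0 = diagR 𝕜 (μ * ν) := by
      ext i j
      rw [hent, hEF, diagR_apply]
      split_ifs with h
      · rw [h, hdiag]; simp
      · rw [horth i j h, mul_zero]
    have : (W0 * diagR 𝕜 s)ᴴ * diagR 𝕜 x * (W0 * diagR 𝕜 s)
        = diagR 𝕜 s * (W0ᴴ * diagR 𝕜 x * W0) * diagR 𝕜 s := by
      rw [Matrix.conjTranspose_mul, diagR_conjTranspose]; simp only [mul_assoc]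
    rw [this, h1, diagR_mul, diagR_mul]
    congr 1; funext j
    have := hsν j
    simp only [Pi.mul_apply]
    linear_combination (μ j) * this

/-! ### Reduction of a pencil with large gaps to a nearly diagonal one -/

/-- Leading minors of `bᴴ N b` are uniformly continuous in `b`, for bounded data. -/
theorem exists_leadMinor_close (d : ℕ) (R δ : ℝ) (hδ : 0 < δ) : ∃ ρ : ℝ, 0 < ρ ∧
    ∀ N b b' : Mat d 𝕜, (∀ i j, ‖N i j‖ ≤ R) → (∀ i j, ‖b i j‖ ≤ R) → (∀ i j, ‖b' i j‖ ≤ R) →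
      (∀ i j, ‖b i j - b' i j‖ < ρ) → ∀ j h,
        ‖leadMinor (bᴴ * N * b) j h - leadMinor (b'ᴴ * N * b') j h‖ < δ := by
  set E := Fin d → Fin d → 𝕜
  set f : E × E → (Fin (d + 1) → 𝕜) := fun p j =>
    leadMinor ((Matrix.of p.2)ᴴ * Matrix.of p.1 * Matrix.of p.2) j (Nat.lt_succ_iff.1 j.2) with hf
  have hcont : Continuous f := by
    refine continuous_pi fun j => ?_
    have h1 : Continuous fun p : E × E => (Matrix.of p.1 : Mat d 𝕜) := continuous_fst
    have h2 : Continuous fun p : E × E => (Matrix.of p.2 : Mat d 𝕜) := continuous_snd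
    exact (((h2.matrix_conjTranspose.matrix_mul h1).matrix_mul h2).matrix_submatrix _ _).matrix_det
  set K0 : Set E := Set.pi Set.univ fun _ => Set.pi Set.univ fun _ => Metric.closedBall 0 R with hK0
  have hK0c : IsCompact K0 :=
    isCompact_univ_pi fun _ => isCompact_univ_pi fun _ => isCompact_closedBall _ _
  have hmem : ∀ N : Mat d 𝕜, (∀ i j, ‖N i j‖ ≤ R) → (fun i j => N i j) ∈ K0 := by
    intro N hN i _ j _
    simpa using hN i j
  obtain ⟨ρ, hρ, hρ'⟩ := Metric.uniformContinuousOn_iff.1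
    ((hK0c.prod hK0c).uniformContinuousOn_of_continuous hcont.continuousOn) δ hδ
  refine ⟨ρ, hρ, fun N b b' hN hb hb' hbb j h => ?_⟩
  have h1 := hρ' (fun i j => N i j, fun i j => b i j) ⟨hmem N hN, hmem b hb⟩
    (fun i j => N i j, fun i j => b' i j) ⟨hmem N hN, hmem b' hb'⟩ (by
      rw [Prod.dist_eq, dist_self]
      refine max_lt hρ ?_
      rw [dist_pi_lt_iff hρ]; intro i
      rw [dist_pi_lt_iff hρ]; intro j
      rw [dist_eq_norm]; exact hbb i j)
  have h2 := (dist_le_pi_dist _ _ (⟨j, Nat.lt_succ_iff.2 h⟩ : Fin (d + 1))).trans_lt h1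
  rw [dist_eq_norm] at h2
  exact h2

theorem leadMinor_diagonal_conj (N : Mat d 𝕜) (β : Fin d → 𝕜) (j : ℕ) (h : j ≤ d) :
    leadMinor ((Matrix.diagonal β)ᴴ * N * Matrix.diagonal β) j h
      = (∏ i : Fin j, star (β (Fin.castLE h i)) * β (Fin.castLE h i)) * leadMinor N j h := by
  have : ((Matrix.diagonal β)ᴴ * N * Matrix.diagonal β).submatrix (Fin.castLE h) (Fin.castLE h)
      = Matrix.diagonal (fun i => star (β (Fin.castLE h i)))
        * N.submatrix (Fin.castLE h) (Fin.castLE h) * Matrix.diagonal (fun i => β (Fin.castLE h i)) := by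
    ext i k
    simp [Matrix.diagonal_conjTranspose, Matrix.mul_diagonal, Matrix.diagonal_mul]
  rw [leadMinor, this, Matrix.det_mul, Matrix.det_mul, Matrix.det_diagonal, Matrix.det_diagonal,
    leadMinor, Finset.prod_mul_distrib]
  ring

/-- The diagonal matrix `exp(a)`. -/
def expD (𝕜 : Type*) [RCLike 𝕜] (a : Fin d → ℝ) : Mat d 𝕜 := diagR 𝕜 fun i => Real.exp (a i)

theorem expD_mul (a b : Fin d → ℝ) : expD 𝕜 a * expD 𝕜 b = expD 𝕜 (a + b) := by
  rw [expD, expD, diagR_mul]; congr 1; funext i; simp [Real.exp_add]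

theorem expD_zero : expD 𝕜 (0 : Fin d → ℝ) = 1 := by
  rw [expD, ← diagR_one]; congr 1; funext i; simp

theorem expD_mul_neg (a : Fin d → ℝ) : expD 𝕜 a * expD 𝕜 (-a) = 1 := by
  rw [expD_mul, add_neg_cancel, expD_zero]

theorem expD_neg_mul (a : Fin d → ℝ) : expD 𝕜 (-a) * expD 𝕜 a = 1 := by
  rw [expD_mul, neg_add_cancel, expD_zero]

@[simp] theorem expD_conjTranspose (a : Fin d → ℝ) : (expD 𝕜 a)ᴴ = expD 𝕜 a :=
  diagR_conjTranspose _

theorem expD_conj_apply (a : Fin d → ℝ) (b : Mat d 𝕜) (i j : Fin d) :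
    (expD 𝕜 a * b * expD 𝕜 (-a)) i j = (Real.exp (a i - a j) : 𝕜) * b i j := by
  rw [expD, expD, diagR, diagR, Matrix.mul_diagonal, Matrix.diagonal_mul, sub_eq_add_neg,
    Real.exp_add]
  push_cast
  rw [Pi.neg_apply]
  ring

/-- Conjugation by `exp(a)` contracts the strictly lower triangular part. -/
theorem norm_expD_conj_apply_le {a : Fin d → ℝ} {l C : ℝ} (ha : ∀ i j, i < j → l < a i - a j)
    {b : Mat d 𝕜} (hb0 : ∀ i j, i < j → b i j = 0) (hb : ∀ i j, ‖b i j‖ ≤ C) (i j : Fin d)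
    (hij : i ≠ j) : ‖(expD 𝕜 a * b * expD 𝕜 (-a)) i j‖ ≤ Real.exp (-l) * C := by
  have hC : 0 ≤ C := (norm_nonneg _).trans (hb i j)
  rw [expD_conj_apply, norm_mul, RCLike.norm_ofReal, Real.abs_exp]
  rcases lt_or_gt_of_ne hij with h | h
  · rw [hb0 i j h, norm_zero, mul_zero]; positivity
  · refine mul_le_mul (Real.exp_le_exp.2 ?_) (hb i j) (norm_nonneg _) (Real.exp_pos _).le
    have := ha j i h
    linarith

theorem expD_conj_apply_self (a : Fin d → ℝ) (b : Mat d 𝕜) (i : Fin d) :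
    (expD 𝕜 a * b * expD 𝕜 (-a)) i i = b i i := by
  rw [expD_conj_apply]; simp

theorem norm_mul_apply_le {A B : Mat d 𝕜} {a b : ℝ} (hA : ∀ i j, ‖A i j‖ ≤ a)
    (hB : ∀ i j, ‖B i j‖ ≤ b) (i j : Fin d) : ‖(A * B) i j‖ ≤ d * (a * b) := by
  rw [Matrix.mul_apply]
  refine (norm_sum_le _ _).trans ?_
  have : ∑ k, ‖A i k * B k j‖ ≤ ∑ _k : Fin d, a * b := by
    refine Finset.sum_le_sum fun k _ => ?_
    rw [norm_mul]
    exact mul_le_mul (hA i k) (hB k j) (norm_nonneg _) ((norm_nonneg _).trans (hA i k))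
  refine this.trans (le_of_eq ?_)
  rw [Finset.sum_const, Finset.card_univ, Fintype.card_fin, nsmul_eq_mul]

theorem norm_conjTranspose_apply_le {A : Mat d 𝕜} {a : ℝ} (hA : ∀ i j, ‖A i j‖ ≤ a) (i j : Fin d) :
    ‖Aᴴ i j‖ ≤ a := by
  rw [Matrix.conjTranspose_apply, norm_star]; exact hA j i

theorem norm_conj_sub_le {u : Mat d 𝕜} {ε : Fin d → ℝ} (hε : IsSigns ε) {ζ : ℝ} (hζ : ζ ≤ 1)
    (hu : ∀ i j, ‖(u - 1) i j‖ ≤ ζ) (i j : Fin d) :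
    ‖(u * diagR 𝕜 ε * uᴴ - diagR 𝕜 ε) i j‖ ≤ (2 + d) * ζ := by
  set z := u - 1 with hz
  have hu1 : u = 1 + z := by rw [hz]; abel
  have hζ0 : 0 ≤ ζ := (norm_nonneg _).trans (hu i j)
  have h1 : ∀ i j, ‖(z * diagR 𝕜 ε) i j‖ ≤ ζ := by
    intro i j
    rw [diagR, Matrix.mul_diagonal, norm_mul, RCLike.norm_ofReal, hε.abs, mul_one]
    exact hu i j
  have h2 : ∀ i j, ‖(diagR 𝕜 ε * zᴴ) i j‖ ≤ ζ := by
    intro i j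
    rw [diagR, Matrix.diagonal_mul, norm_mul, RCLike.norm_ofReal, hε.abs, one_mul]
    exact norm_conjTranspose_apply_le hu i j
  have h3 := norm_mul_apply_le h1 (norm_conjTranspose_apply_le hu) i j
  have e : u * diagR 𝕜 ε * uᴴ - diagR 𝕜 ε
      = z * diagR 𝕜 ε + diagR 𝕜 ε * zᴴ + z * diagR 𝕜 ε * zᴴ := by
    rw [hu1, Matrix.conjTranspose_add, Matrix.conjTranspose_one]
    noncomm_ring
  rw [e, Matrix.add_apply, Matrix.add_apply]
  refine (norm_add_le _ _).trans ((add_le_add (norm_add_le _ _) h3).trans ?_)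
  have h4 : (d : ℝ) * (ζ * ζ) ≤ d * ζ := by
    refine mul_le_mul_of_nonneg_left ?_ (Nat.cast_nonneg _)
    exact mul_le_of_le_one_left hζ0 hζ
  have := h1 i j
  have := h2 i j
  linarith

/-- Moving `exp(a)` past a lower triangular matrix replaces it by its conjugate, which is almost
diagonal when the gaps of `a` are large. This is done twice: for `b`, so that the second form
becomes `exp(a) N1 exp(a)` with minors of `N1` still bounded below; then for the Gram–Schmidt matrix
`u` of `N1`, which makes that form exactly diagonal while moving the sign form only slightly. -/
theorem exists_pencil_diag (d : ℕ) (R δ : ℝ) (hδ : 0 < δ) : ∃ l : ℝ, 0 < l ∧ ∃ D : ℝ, 0 < D ∧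
    ∀ (N b : Mat d 𝕜) (ε a : Fin d → ℝ), N.IsHermitian → (∀ i j, ‖N i j‖ ≤ R) →
      (∀ j h, δ ≤ ‖leadMinor N j h‖) → (∀ i j, i < j → b i j = 0) → (∀ i j, ‖b i j‖ ≤ R) →
      (∀ i, δ ≤ ‖b i i‖) → IsSigns ε → (∀ i j, i < j → l < a i - a j) →
      ∃ (V : Mat d 𝕜) (μ : Fin d → ℝ), Vᴴ * diagR 𝕜 ε * V = diagR 𝕜 ε ∧
        Vᴴ * (bᴴ * expD 𝕜 a * N * expD 𝕜 a * b) * V = diagR 𝕜 (μ * ε) ∧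
        (∀ i, |Real.log |μ i| - 2 * a i| ≤ D) ∧ (∀ i, μ i ≠ 0) ∧ ∀ i j, i < j → |μ j| < |μ i| := by
  set δ0 := min δ 1 with hδ0
  have hδ0p : 0 < δ0 := lt_min hδ one_pos
  have hδ01 : δ0 ≤ 1 := min_le_right _ _
  have hδ0δ : δ0 ≤ δ := min_le_left _ _
  -- Half of the lower bound for the minors of `N` conjugated by the diagonal part of `b`, whose
  -- entries are at least `δ0`; the other half absorbs the off-diagonal part of the conjugated `b`.
  set δ1 := (δ0 ^ 2) ^ d * δ0 / 2 with hδ1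
  have hδ1p : 0 < δ1 := by positivity
  obtain ⟨ρ, hρ, hclose⟩ := exists_leadMinor_close (𝕜 := 𝕜) d R δ1 hδ1p
  obtain ⟨C, hC, hlow⟩ := exists_lower_diagonalize (𝕜 := 𝕜) d δ1 (d * (d * (R * R) * R)) hδ1p
  set η : ℝ := 1 / (16 * ((d + 1) * (d + 1))) with hη
  have hηp : 0 < η := by positivity
  have hηd : 16 * (d * d * η) ≤ 1 := by
    rw [hη]
    have : 16 * (d * d * (1 / (16 * (((d : ℝ) + 1) * (d + 1))))) = (d * d) / ((d + 1) * (d + 1)) := by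
      field_simp
    rw [this, div_le_one (by positivity)]
    nlinarith [(Nat.cast_nonneg d : (0 : ℝ) ≤ d)]
  set ζ : ℝ := min 1 (η / (2 + d)) with hζ
  have hζp : 0 < ζ := lt_min one_pos (by positivity)
  have hζ1 : ζ ≤ 1 := min_le_left _ _
  have hζη : (2 + d) * ζ ≤ η := by
    have : ζ ≤ η / (2 + d) := min_le_right _ _
    rwa [le_div_iff₀ (by positivity), mul_comm] at this
  -- the size of the gaps
  set K : ℝ := 2 + |R| / ρ + C / ζ + 16 * C ^ 2 with hK
  have hK2 : 2 ≤ K := by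
    have h1 : 0 ≤ |R| / ρ := by positivity
    have h2 : 0 ≤ C / ζ := by positivity
    have h3 : 0 ≤ 16 * C ^ 2 := by positivity
    linarith
  have hKp : 0 < K := by linarith
  -- The summands of `K` serve in turn: contraction does not enlarge the entries of `b`; `b` comes
  -- within `ρ` of its diagonal; `u` comes within `ζ` of the identity; the gaps beat the variation
  -- `C ^ 2` of the pivots by the factor 16. The bound `D` accounts for a pivot in `[C⁻¹, C]` and
  -- for a window of ratio 2 around each `x i`.
  refine ⟨Real.log K, Real.log_pos (by linarith), |Real.log (2 * C)| + 1, by positivity, ?_⟩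
  intro N b ε a hN hNR hNδ hb0 hbR hbδ hε ha
  have hexpl : Real.exp (-Real.log K) = K⁻¹ := by rw [Real.exp_neg, Real.exp_log hKp]
  set ba := expD 𝕜 a * b * expD 𝕜 (-a) with hba
  set N1 := baᴴ * N * ba with hN1
  have hRd : ∀ i j : Fin d, 0 ≤ R := fun i j => (norm_nonneg _).trans (hNR i j)
  have hbaR : ∀ i j, ‖ba i j‖ ≤ R := by
    intro i j
    by_cases hij : i = j
    · subst hij
      rw [hba, expD_conj_apply_self]; exact hbR _ _
    · refine (norm_expD_conj_apply_le ha hb0 hbR i j hij).trans ?_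
      rw [hexpl]
      refine mul_le_of_le_one_left (hRd i j) ?_
      exact inv_le_one_of_one_le₀ (by linarith)
  have hN1R : ∀ i j, ‖N1 i j‖ ≤ d * (d * (R * R) * R) :=
    norm_mul_apply_le (norm_mul_apply_le (norm_conjTranspose_apply_le hbaR) hNR) hbaR
  have hN1h : N1.IsHermitian := Matrix.isHermitian_conjTranspose_mul_mul ba hN
  set β : Fin d → 𝕜 := fun i => b i i with hβ
  have hbaβ : ∀ i j, ‖ba i j - Matrix.diagonal β i j‖ < ρ := by
    intro i j
    by_cases hij : i = j
    · subst hij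
      rw [hba, expD_conj_apply_self]; simpa [hβ] using hρ
    · rw [Matrix.diagonal_apply_ne _ hij, sub_zero]
      refine (norm_expD_conj_apply_le ha hb0 hbR i j hij).trans_lt ?_
      rw [hexpl, inv_mul_lt_iff₀ hKp]
      have h1 : |R| / ρ < K := by
        have h2 : 0 ≤ C / ζ := by positivity
        have h3 : 0 ≤ 16 * C ^ 2 := by positivity
        linarith
      rw [div_lt_iff₀ hρ] at h1
      exact (le_abs_self R).trans_lt h1
  have hβR : ∀ i j, ‖Matrix.diagonal β i j‖ ≤ R := by
    intro i j
    by_cases hij : i = j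
    · subst hij; simpa [hβ] using hbR i i
    · rw [Matrix.diagonal_apply_ne _ hij, norm_zero]; exact hRd i j
  have hN1δ : ∀ j (h : j ≤ d), δ1 ≤ ‖leadMinor N1 j h‖ := by
    intro j h
    have h1 := hclose N ba (Matrix.diagonal β) hNR hbaR hβR hbaβ j h
    have h2 : 2 * δ1 ≤ ‖leadMinor ((Matrix.diagonal β)ᴴ * N * Matrix.diagonal β) j h‖ := by
      rw [leadMinor_diagonal_conj, norm_mul, norm_prod]
      have h3 : (δ0 ^ 2) ^ d ≤ ∏ i : Fin j, ‖star (β (Fin.castLE h i)) * β (Fin.castLE h i)‖ := by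
        calc (δ0 ^ 2) ^ d ≤ (δ0 ^ 2) ^ j :=
              pow_le_pow_of_le_one (by positivity) (pow_le_one₀ hδ0p.le hδ01) h
          _ = ∏ _i : Fin j, δ0 ^ 2 := by simp
          _ ≤ _ := by
              refine Finset.prod_le_prod (fun _ _ => by positivity) fun i _ => ?_
              rw [norm_mul, norm_star, ← sq]
              exact pow_le_pow_left₀ hδ0p.le (hδ0δ.trans (hbδ _)) 2
      calc 2 * δ1 = (δ0 ^ 2) ^ d * δ0 := by rw [hδ1]; ring
        _ ≤ _ := mul_le_mul h3 (hδ0δ.trans (hNδ j h)) hδ0p.le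
              (Finset.prod_nonneg fun _ _ => norm_nonneg _)
    rw [norm_sub_rev] at h1
    have h3 := norm_sub_norm_le (leadMinor ((Matrix.diagonal β)ᴴ * N * Matrix.diagonal β) j h)
      (leadMinor N1 j h)
    linarith
  obtain ⟨u, D, hu0, hu1, huC, hD, huN, -⟩ := hlow N1 hN1h hN1R hN1δ
  set ua := expD 𝕜 a * u * expD 𝕜 (-a) with hua
  set F := ua * diagR 𝕜 ε * uaᴴ with hF
  have hua1 : ∀ i j, ‖(ua - 1) i j‖ ≤ ζ := by
    intro i j
    by_cases hij : i = j
    · subst hij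
      rw [Matrix.sub_apply, hua, expD_conj_apply_self, hu1]; simpa using hζp.le
    · rw [Matrix.sub_apply, Matrix.one_apply_ne hij, sub_zero]
      refine (norm_expD_conj_apply_le ha hu0 huC i j hij).trans ?_
      rw [hexpl, inv_mul_le_iff₀ hKp]
      have h1 : C / ζ ≤ K := by
        have h2 : 0 ≤ |R| / ρ := by positivity
        have h3 : 0 ≤ 16 * C ^ 2 := by positivity
        linarith
      rwa [div_le_iff₀ hζp] at h1
  have hFε : ∀ i j, ‖(F - diagR 𝕜 ε) i j‖ ≤ η := fun i j =>
    (norm_conj_sub_le hε hζ1 hua1 i j).trans hζη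
  have hFh : F.IsHermitian := Matrix.isHermitian_mul_mul_conjTranspose ua (diagR_isHermitian ε)
  set x : Fin d → ℝ := fun i => Real.exp (2 * a i) * D i with hx
  have hxabs : ∀ i, |x i| = Real.exp (2 * a i) * |D i| := fun i => by
    rw [hx]; simp only [abs_mul, Real.abs_exp]
  have hDp : ∀ i, 0 < |D i| := fun i => (inv_pos.2 hC).trans_le (hD i).1
  have hx0 : ∀ i, x i ≠ 0 := fun i => by
    rw [← abs_pos, hxabs]; exact mul_pos (Real.exp_pos _) (hDp i)
  -- The gap of `exp(2a)` must survive the pivots, which can cost up to `C` on each side.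
  have hgap : ∀ i j, i < j → 16 * |x j| ≤ |x i| := by
    intro i j hij
    rw [hxabs, hxabs]
    have h1 : K * Real.exp (2 * a j) ≤ Real.exp (2 * a i) := by
      have h2 : K ≤ Real.exp (2 * (a i - a j)) := by
        rw [← Real.log_le_iff_le_exp hKp]
        have := ha i j hij
        have := Real.log_pos (by linarith : 1 < K)
        linarith
      calc K * Real.exp (2 * a j) ≤ Real.exp (2 * (a i - a j)) * Real.exp (2 * a j) :=
            mul_le_mul_of_nonneg_right h2 (Real.exp_pos _).le
        _ = _ := by rw [← Real.exp_add]; congr 1; ring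
    have h3 : 16 * C ^ 2 ≤ K := by
      have h1 : 0 ≤ |R| / ρ := by positivity
      have h2 : 0 ≤ C / ζ := by positivity
      linarith
    have h4 : 16 * (C * C) * Real.exp (2 * a j) ≤ Real.exp (2 * a i) := by
      refine le_trans (mul_le_mul_of_nonneg_right ?_ (Real.exp_pos _).le) h1
      linarith
    calc 16 * (Real.exp (2 * a j) * |D j|) ≤ 16 * (Real.exp (2 * a j) * C) := by
          gcongr; exact (hD j).2
      _ = (16 * (C * C) * Real.exp (2 * a j)) * C⁻¹ := by field_simp
      _ ≤ Real.exp (2 * a i) * |D i| :=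
          mul_le_mul h4 (hD i).1 (inv_pos.2 hC).le (Real.exp_pos _).le
  obtain ⟨μ, W, hμ, hWF, hWx⟩ := exists_pencil_diag_of_near hε hηp.le hηd hFh hFε hx0 hgap
  have hμ0 : ∀ i, 0 < |μ i| := fun i => by
    have := (hμ i).1
    have := abs_pos.2 (hx0 i)
    linarith
  refine ⟨uaᴴ * W, μ, ?_, ?_, ?_, fun i => abs_pos.1 (hμ0 i), ?_⟩
  · refine Eq.trans ?_ hWF
    rw [hF, Matrix.conjTranspose_mul, Matrix.conjTranspose_conjTranspose]
    simp only [mul_assoc]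
  · have e1 : expD 𝕜 a * b = ba * expD 𝕜 a := by
      rw [hba, mul_assoc, expD_neg_mul, mul_one]
    have e2 : ua * expD 𝕜 a = expD 𝕜 a * u := by
      rw [hua, mul_assoc, expD_neg_mul, mul_one]
    have e1' : bᴴ * expD 𝕜 a = expD 𝕜 a * baᴴ := by
      have := congrArg Matrix.conjTranspose e1
      simpa [Matrix.conjTranspose_mul] using this
    have e2' : expD 𝕜 a * uaᴴ = uᴴ * expD 𝕜 a := by
      have := congrArg Matrix.conjTranspose e2
      simpa [Matrix.conjTranspose_mul] using this
    have e3 : bᴴ * expD 𝕜 a * N * expD 𝕜 a * b = expD 𝕜 a * N1 * expD 𝕜 a := by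
      rw [mul_assoc _ (expD 𝕜 a) b, e1, e1', hN1]; simp only [mul_assoc]
    have e4 : ua * (expD 𝕜 a * N1 * expD 𝕜 a) * uaᴴ = diagR 𝕜 x := by
      calc ua * (expD 𝕜 a * N1 * expD 𝕜 a) * uaᴴ
          = (ua * expD 𝕜 a) * N1 * (expD 𝕜 a * uaᴴ) := by simp only [mul_assoc]
        _ = expD 𝕜 a * (u * N1 * uᴴ) * expD 𝕜 a := by rw [e2, e2']; simp only [mul_assoc]
        _ = diagR 𝕜 x := by
          rw [huN]
          change diagR 𝕜 _ * diagR 𝕜 D * diagR 𝕜 _ = _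
          rw [diagR_mul, diagR_mul]
          congr 1; funext i
          simp only [Pi.mul_apply, hx, two_mul, Real.exp_add]
          ring
    rw [e3, ← hWx, ← e4, Matrix.conjTranspose_mul, Matrix.conjTranspose_conjTranspose]
    simp only [mul_assoc]
  · intro i
    have h1 : Real.exp (2 * a i) / (2 * C) ≤ |μ i| := by
      refine le_trans ?_ (hμ i).1
      rw [hxabs, div_eq_mul_inv, mul_inv, div_eq_mul_inv]
      have := (hD i).1
      have h2 : Real.exp (2 * a i) * C⁻¹ ≤ Real.exp (2 * a i) * |D i| :=
        mul_le_mul_of_nonneg_left this (Real.exp_pos _).le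
      linarith
    have h2 : |μ i| ≤ Real.exp (2 * a i) * (2 * C) := by
      refine (hμ i).2.trans ?_
      rw [hxabs]
      have h2 : Real.exp (2 * a i) * |D i| ≤ Real.exp (2 * a i) * C :=
        mul_le_mul_of_nonneg_left (hD i).2 (Real.exp_pos _).le
      linarith
    have h3 := Real.log_le_log (by positivity) h1
    have h4 := Real.log_le_log (hμ0 i) h2
    rw [Real.log_div (Real.exp_pos _).ne' (by positivity), Real.log_exp] at h3
    rw [Real.log_mul (Real.exp_pos _).ne' (by positivity), Real.log_exp] at h4
    have := le_abs_self (Real.log (2 * C))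
    rw [abs_le]
    constructor <;> linarith
  · intro i j hij
    have := hgap i j hij
    have := (hμ j).2
    have := (hμ i).1
    have := abs_pos.2 (hx0 j)
    linarith

/-! ### Singular values -/

theorem exists_ne_zero_mulVec_eq_zero {m n : Type*} [Fintype m] [Fintype n]
    (h : Fintype.card m < Fintype.card n) (A : Matrix m n 𝕜) : ∃ v, v ≠ 0 ∧ A *ᵥ v = 0 := by
  classical
  have h1 : LinearMap.ker A.mulVecLin ≠ ⊥ := LinearMap.ker_ne_bot_of_finrank_lt (by simpa using h)
  obtain ⟨v, hv, hv0⟩ := Submodule.exists_mem_ne_zero_of_ne_bot h1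
  exact ⟨v, hv0, by simpa using hv⟩

/-- Two comparable sorted diagonal matrices have comparable entries. -/
theorem exp_le_of_expD_eq {a b : Fin d → ℝ} (ha : Antitone a) (hb : Antitone b) {X Y : Mat d 𝕜}
    {R S : ℝ} (hX : ∀ i j, ‖X i j‖ ≤ R) (hY : ∀ i j, ‖Y i j‖ ≤ S)
    (h : expD 𝕜 a = X * expD 𝕜 b * Y) (i : Fin d) :
    Real.exp (a i) ≤ d * (R * (d * S)) * Real.exp (b i) := by
  -- As in the min-max principle: by dimension count some vector `v` supported on the coordinates `≤
  -- i` has `Y *ᵥ v` vanishing on the coordinates `< i`. On `v` the left side expands at least by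
  -- `exp (a i)`, the right side at most by a constant times `exp (b i)`. The sup norm replaces the
  -- Euclidean one.
  obtain ⟨c, hc0, hc⟩ := exists_ne_zero_mulVec_eq_zero (𝕜 := 𝕜) (m := {k : Fin d // k < i})
    (n := {k : Fin d // k ≤ i})
    (Fintype.card_lt_of_injective_of_notMem (b := ⟨i, le_refl i⟩)
      (fun k => ⟨k.1, k.2.le⟩) (fun k l hkl => Subtype.ext (congrArg (fun z => z.1) hkl))
      (by rintro ⟨k, hk⟩; exact k.2.ne (congrArg (fun z => z.1) hk)))
    (Matrix.of fun k l => Y k.1 l.1)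
  set v : Fin d → 𝕜 := fun k => if hk : k ≤ i then c ⟨k, hk⟩ else 0 with hv
  have hvY : ∀ k, k < i → (Y *ᵥ v) k = 0 := by
    intro k hk
    have h1 := congrFun hc ⟨k, hk⟩
    rw [Matrix.mulVec, dotProduct] at h1 ⊢
    rw [Pi.zero_apply] at h1
    rw [← h1]
    symm
    rw [← Finset.sum_subset (Finset.subset_univ (Finset.univ.filter fun l : Fin d => l ≤ i))]
    · rw [Finset.sum_subtype (p := fun l => l ≤ i) _ (by simp)]
      refine Finset.sum_congr rfl fun l _ => ?_
      simp [hv, l.2]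
    · intro l _ hl
      have : ¬ l ≤ i := by simpa using hl
      simp [hv, this]
  have : Nonempty (Fin d) := ⟨i⟩
  obtain ⟨k, hk⟩ := Finite.exists_max fun l => ‖v l‖
  obtain ⟨l0, hl0⟩ := Function.ne_iff.1 hc0
  have hm : 0 < ‖v k‖ := by
    refine lt_of_lt_of_le ?_ (hk l0.1)
    simpa [hv, l0.2] using hl0
  have hki : k ≤ i := by
    by_contra hki
    simp [hv, hki] at hm
  have hS : 0 ≤ S := (norm_nonneg _).trans (hY i i)
  have hR : 0 ≤ R := (norm_nonneg _).trans (hX i i)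
  have hYv : ∀ l, ‖(Y *ᵥ v) l‖ ≤ d * (S * ‖v k‖) := by
    intro l
    rw [Matrix.mulVec, dotProduct]
    refine (norm_sum_le _ _).trans ?_
    have : ∑ m, ‖Y l m * v m‖ ≤ ∑ _m : Fin d, S * ‖v k‖ := by
      refine Finset.sum_le_sum fun m _ => ?_
      rw [norm_mul]
      exact mul_le_mul (hY _ _) (hk m) (norm_nonneg _) hS
    refine this.trans (le_of_eq ?_)
    rw [Finset.sum_const, Finset.card_univ, Fintype.card_fin, nsmul_eq_mul]
  have hbYv : ∀ l, ‖(expD 𝕜 b *ᵥ (Y *ᵥ v)) l‖ ≤ Real.exp (b i) * (d * (S * ‖v k‖)) := by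
    intro l
    rw [expD, diagR, Matrix.mulVec_diagonal, norm_mul, RCLike.norm_ofReal, Real.abs_exp]
    by_cases hl : l < i
    · rw [hvY l hl, norm_zero, mul_zero]; positivity
    · exact mul_le_mul (Real.exp_le_exp.2 (hb (not_lt.1 hl))) (hYv l) (norm_nonneg _)
        (Real.exp_pos _).le
  have h1 : (expD 𝕜 a *ᵥ v) k = (X *ᵥ (expD 𝕜 b *ᵥ (Y *ᵥ v))) k := by
    rw [h, Matrix.mulVec_mulVec, Matrix.mulVec_mulVec, mul_assoc]
  have h2 : ‖(X *ᵥ (expD 𝕜 b *ᵥ (Y *ᵥ v))) k‖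
      ≤ d * (R * (Real.exp (b i) * (d * (S * ‖v k‖)))) := by
    rw [Matrix.mulVec, dotProduct]
    refine (norm_sum_le _ _).trans ?_
    have : ∑ m, ‖X k m * (expD 𝕜 b *ᵥ (Y *ᵥ v)) m‖
        ≤ ∑ _m : Fin d, R * (Real.exp (b i) * (d * (S * ‖v k‖))) := by
      refine Finset.sum_le_sum fun m _ => ?_
      rw [norm_mul]
      exact mul_le_mul (hX _ _) (hbYv m) (norm_nonneg _) hR
    refine this.trans (le_of_eq ?_)
    rw [Finset.sum_const, Finset.card_univ, Fintype.card_fin, nsmul_eq_mul]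
  rw [← h1, expD, diagR, Matrix.mulVec_diagonal, norm_mul, RCLike.norm_ofReal, Real.abs_exp] at h2
  have h3 : Real.exp (a i) * ‖v k‖ ≤ Real.exp (a k) * ‖v k‖ :=
    mul_le_mul_of_nonneg_right (Real.exp_le_exp.2 (ha hki)) hm.le
  refine le_of_mul_le_mul_right (h3.trans (h2.trans (le_of_eq ?_))) hm
  ring

/-- Corrects a determinant of modulus 1 to 1 by a diagonal matrix of phases, which leaves real
diagonal forms unchanged. -/
theorem exists_phase (i0 : Fin d) {z : 𝕜} (hz : ‖z‖ = 1) : ∃ p : Fin d → 𝕜, (∀ i, ‖p i‖ = 1) ∧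
    z * (Matrix.diagonal p).det = 1 := by
  refine ⟨fun i => if i = i0 then star z else 1, fun i => ?_, ?_⟩
  · beta_reduce; split_ifs <;> simp [hz]
  · rw [Matrix.det_diagonal, Finset.prod_ite_eq' Finset.univ i0 fun _ => star z]
    simp [RCLike.mul_conj, hz]

theorem diagonal_phase {p : Fin d → 𝕜} (hp : ∀ i, ‖p i‖ = 1) :
    (Matrix.diagonal p)ᴴ * Matrix.diagonal p = 1 := by
  rw [Matrix.diagonal_conjTranspose, Matrix.diagonal_mul_diagonal, ← Matrix.diagonal_one]
  congr 1; funext i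
  simp [RCLike.conj_mul, hp]

theorem diagonal_phase_conj {p : Fin d → 𝕜} (hp : ∀ i, ‖p i‖ = 1) (x : Fin d → ℝ) :
    (Matrix.diagonal p)ᴴ * diagR 𝕜 x * Matrix.diagonal p = diagR 𝕜 x := by
  rw [diagR, Matrix.diagonal_conjTranspose, Matrix.diagonal_mul_diagonal,
    Matrix.diagonal_mul_diagonal]
  congr 1; funext i
  have : star (p i) * p i = 1 := by simp [RCLike.conj_mul, hp]
  rw [Pi.star_apply]
  linear_combination (x i : 𝕜) * this

theorem norm_det_of_unitary {U : Mat d 𝕜} (hU : Uᴴ * U = 1) : ‖U.det‖ = 1 := by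
  have h := congrArg Matrix.det hU
  rw [Matrix.det_mul, Matrix.det_conjTranspose, Matrix.det_one] at h
  have h2 := congrArg norm h
  rw [norm_mul, norm_star, norm_one] at h2
  nlinarith [norm_nonneg U.det]

theorem exists_unitary_diag {M : Mat d 𝕜} (hM : M.IsHermitian) :
    ∃ (U : Mat d 𝕜) (x : Fin d → ℝ), Uᴴ * U = 1 ∧ Antitone x ∧ M * U = U * diagR 𝕜 x := by
  set π := Tuple.sort fun i => - hM.eigenvalues i with hπ
  have hmono := Tuple.monotone_sort fun i => - hM.eigenvalues i
  refine ⟨(hM.eigenvectorUnitary : Mat d 𝕜).submatrix id π, hM.eigenvalues ∘ π, ?_, ?_, ?_⟩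
  · rw [Matrix.conjTranspose_submatrix, ← Matrix.submatrix_mul _ _ _ _ _ Function.bijective_id]
    have := Unitary.coe_star_mul_self hM.eigenvectorUnitary
    rw [Matrix.star_eq_conjTranspose] at this
    rw [this, Matrix.submatrix_one_equiv]
  · intro i j hij
    have := hmono hij
    simpa using this
  · ext i j
    have h1 := congrFun (hM.mulVec_eigenvectorBasis (π j)) i
    rw [Matrix.mul_apply, diagR, Matrix.mul_diagonal]
    simp only [Matrix.submatrix_apply, id, Matrix.IsHermitian.eigenvectorUnitary_apply,
      Function.comp]
    rw [Matrix.mulVec, dotProduct] at h1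
    rw [h1, Pi.smul_apply, RCLike.real_smul_eq_coe_mul, mul_comm]

theorem norm_apply_le_of_unitary {U : Mat d 𝕜} (hU : Uᴴ * U = 1) (i j : Fin d) : ‖U i j‖ ≤ 1 := by
  have h := congrFun (congrFun hU j) j
  rw [Matrix.mul_apply, Matrix.one_apply_eq] at h
  have h2 : ∑ k, ‖U k j‖ ^ 2 = 1 := by
    have : ((∑ k, ‖U k j‖ ^ 2 : ℝ) : 𝕜) = 1 := by
      rw [← h]; push_cast
      refine Finset.sum_congr rfl fun k _ => ?_
      rw [Matrix.conjTranspose_apply, RCLike.star_def, RCLike.conj_mul]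
    exact_mod_cast this
  have h3 : ‖U i j‖ ^ 2 ≤ 1 := by
    rw [← h2]
    exact Finset.single_le_sum (f := fun k => ‖U k j‖ ^ 2) (fun _ _ => by positivity)
      (Finset.mem_univ i)
  exact (sq_le_one_iff₀ (norm_nonneg _)).1 h3

theorem det_expD (a : Fin d → ℝ) : (expD 𝕜 a).det = ((Real.exp (∑ i, a i) : ℝ) : 𝕜) := by
  rw [expD, diagR, Matrix.det_diagonal, Real.exp_sum]; push_cast; rfl

/-- Singular value decomposition: diagonalize `Aᴴ * A` by a unitary `U` of determinant 1, let
`exp(2a)` be its spectrum, and take `A U exp(-a)` as left factor. -/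
theorem exists_cartan_decomp (i0 : Fin d) {A : Mat d 𝕜} (hA : A.det = 1) :
    ∃ (K L : Mat d 𝕜) (a : Fin d → ℝ), Kᴴ * K = 1 ∧ K.det = 1 ∧ Lᴴ * L = 1 ∧ L.det = 1 ∧
      Antitone a ∧ ∑ i, a i = 0 ∧ A = K * expD 𝕜 a * L := by
  obtain ⟨U0, x, hU0, hx, hAU0⟩ := exists_unitary_diag (Matrix.isHermitian_conjTranspose_mul_self A)
  obtain ⟨p, hp, hpdet⟩ := exists_phase i0 (norm_det_of_unitary hU0)
  set U := U0 * Matrix.diagonal p with hUdef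
  have hUdet : U.det = 1 := by rw [hUdef, Matrix.det_mul, hpdet]
  have hU : Uᴴ * U = 1 := by
    rw [hUdef, Matrix.conjTranspose_mul]
    calc (Matrix.diagonal p)ᴴ * U0ᴴ * (U0 * Matrix.diagonal p)
        = (Matrix.diagonal p)ᴴ * (U0ᴴ * U0) * Matrix.diagonal p := by simp only [mul_assoc]
      _ = 1 := by rw [hU0, mul_one, diagonal_phase hp]
  have hU' : U * Uᴴ = 1 := mul_eq_one_comm.1 hU
  have hUx : Uᴴ * (Aᴴ * A) * U = diagR 𝕜 x := by
    rw [hUdef, Matrix.conjTranspose_mul]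
    calc (Matrix.diagonal p)ᴴ * U0ᴴ * (Aᴴ * A) * (U0 * Matrix.diagonal p)
        = (Matrix.diagonal p)ᴴ * (U0ᴴ * (Aᴴ * A * U0)) * Matrix.diagonal p := by
          simp only [mul_assoc]
      _ = (Matrix.diagonal p)ᴴ * (U0ᴴ * U0 * diagR 𝕜 x) * Matrix.diagonal p := by
          rw [hAU0]; simp only [mul_assoc]
      _ = _ := by rw [hU0, one_mul, diagonal_phase_conj hp]
  set B := A * U with hB
  have hBx : Bᴴ * B = diagR 𝕜 x := by
    rw [← hUx, hB, Matrix.conjTranspose_mul]; simp only [mul_assoc]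
  have hBdet : B.det = 1 := by rw [hB, Matrix.det_mul, hA, hUdet, one_mul]
  have hxpos : ∀ i, 0 < x i := by
    have h0 : ∀ i, 0 ≤ x i := by
      intro i
      have h1 := congrFun (congrFun hBx i) i
      rw [Matrix.mul_apply, diagR_apply, if_pos rfl] at h1
      have : x i = ∑ k, ‖B k i‖ ^ 2 := by
        have : (x i : 𝕜) = ((∑ k, ‖B k i‖ ^ 2 : ℝ) : 𝕜) := by
          rw [← h1]; push_cast
          refine Finset.sum_congr rfl fun k _ => ?_
          rw [Matrix.conjTranspose_apply, RCLike.star_def, RCLike.conj_mul]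
        exact_mod_cast this
      rw [this]; positivity
    intro i
    refine (h0 i).lt_of_ne fun h => ?_
    have h1 := congrArg Matrix.det hBx
    rw [Matrix.det_mul, Matrix.det_conjTranspose, hBdet, star_one, one_mul, diagR,
      Matrix.det_diagonal, Finset.prod_eq_zero (Finset.mem_univ i) (by rw [← h]; simp)] at h1
    exact one_ne_zero h1
  set a : Fin d → ℝ := fun i => Real.log (x i) / 2 with ha
  have hax : expD 𝕜 a * expD 𝕜 a = diagR 𝕜 x := by
    rw [expD_mul, expD]; congr 1; funext i
    rw [Pi.add_apply, ha, add_halves, Real.exp_log (hxpos i)]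
  have hsum : ∑ i, a i = 0 := by
    have h1 := congrArg Matrix.det hBx
    rw [Matrix.det_mul, Matrix.det_conjTranspose, hBdet, star_one, one_mul, ← hax, expD_mul,
      det_expD] at h1
    have h2 : Real.exp (∑ i, (a + a) i) = 1 := by exact_mod_cast h1.symm
    rw [Real.exp_eq_one_iff] at h2
    simp only [Pi.add_apply, Finset.sum_add_distrib] at h2
    linarith
  refine ⟨B * expD 𝕜 (-a), Uᴴ, a, ?_, ?_, ?_, ?_, ?_, hsum, ?_⟩
  · rw [Matrix.conjTranspose_mul, expD_conjTranspose]
    calc expD 𝕜 (-a) * Bᴴ * (B * expD 𝕜 (-a)) = expD 𝕜 (-a) * (Bᴴ * B) * expD 𝕜 (-a) := by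
          simp only [mul_assoc]
      _ = (expD 𝕜 (-a) * expD 𝕜 a) * (expD 𝕜 a * expD 𝕜 (-a)) := by
          rw [hBx, ← hax]; simp only [mul_assoc]
      _ = 1 := by rw [expD_neg_mul, expD_mul_neg, one_mul]
  · rw [Matrix.det_mul, hBdet, det_expD]; simp [hsum]
  · rw [Matrix.conjTranspose_conjTranspose, hU']
  · rw [Matrix.det_conjTranspose, hUdet, star_one]
  · intro i j hij
    have := Real.log_le_log (hxpos j) (hx hij)
    simp only [ha]; linarith
  · rw [mul_assoc B, expD_neg_mul, mul_one, hB, mul_assoc, hU', mul_one]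

/-! ### Inertia and permutations -/

/-- Some term of the Leibniz expansion is nonzero. -/
theorem exists_perm_ne_zero {M : Mat d 𝕜} (hM : M.det ≠ 0) :
    ∃ σ : Equiv.Perm (Fin d), ∀ i, M (σ i) i ≠ 0 := by
  by_contra! h
  apply hM
  rw [Matrix.det_apply]
  refine Finset.sum_eq_zero fun σ _ => ?_
  obtain ⟨i, hi⟩ := h σ
  have h0 : ∏ i, M (σ i) i = 0 := Finset.prod_eq_zero (Finset.mem_univ i) hi
  exact (congrArg (fun z => Equiv.Perm.sign σ • z) h0).trans (smul_zero _)

/-- Half of Sylvester's law of inertia: otherwise a nonzero vector supported on the positive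
coordinates of `ε'` would be mapped by `Z` into the span of the negative coordinates of `ε`. -/
theorem card_pos_le_of_conj {Z : Mat d 𝕜} {ε ε' : Fin d → ℝ} (hε : IsSigns ε)
    (h : Zᴴ * diagR 𝕜 ε * Z = diagR 𝕜 ε') :
    Fintype.card {i // ε' i = 1} ≤ Fintype.card {i // ε i = 1} := by
  classical
  by_contra! hlt
  obtain ⟨c, hc0, hc⟩ := exists_ne_zero_mulVec_eq_zero (𝕜 := 𝕜) hlt
    (Matrix.of fun k l => Z k.1 l.1)
  set v : Fin d → 𝕜 := fun k => if hk : ε' k = 1 then c ⟨k, hk⟩ else 0 with hv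
  have hvZ : ∀ k, ε k = 1 → (Z *ᵥ v) k = 0 := by
    intro k hk
    have h1 := congrFun hc ⟨k, hk⟩
    rw [Matrix.mulVec, dotProduct] at h1 ⊢
    rw [Pi.zero_apply] at h1
    rw [← h1]
    symm
    rw [← Finset.sum_subset (Finset.subset_univ (Finset.univ.filter fun l : Fin d => ε' l = 1))]
    · rw [Finset.sum_subtype (p := fun l => ε' l = 1) _ (by simp)]
      refine Finset.sum_congr rfl fun l _ => ?_
      simp [hv, l.2]
    · intro l _ hl
      have : ¬ ε' l = 1 := by simpa using hl
      simp [hv, this]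
  have hq : ∀ (y : Fin d → ℝ) (u : Fin d → 𝕜), star u ⬝ᵥ (diagR 𝕜 y *ᵥ u)
      = ((∑ i, y i * ‖u i‖ ^ 2 : ℝ) : 𝕜) := by
    intro y u
    rw [dotProduct]; push_cast
    refine Finset.sum_congr rfl fun i _ => ?_
    rw [diagR, Matrix.mulVec_diagonal, Pi.star_apply, mul_left_comm, RCLike.star_def,
      RCLike.conj_mul]
  have h1 : star v ⬝ᵥ (diagR 𝕜 ε' *ᵥ v) = star (Z *ᵥ v) ⬝ᵥ (diagR 𝕜 ε *ᵥ (Z *ᵥ v)) := by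
    rw [← h, Matrix.star_mulVec, ← Matrix.dotProduct_mulVec, Matrix.mulVec_mulVec,
      Matrix.mulVec_mulVec, mul_assoc]
  rw [hq, hq] at h1
  have h2 : ∑ i, ε' i * ‖v i‖ ^ 2 = ∑ i, ε i * ‖(Z *ᵥ v) i‖ ^ 2 := by exact_mod_cast h1
  have h3 : ∑ i, ε i * ‖(Z *ᵥ v) i‖ ^ 2 ≤ 0 := by
    refine Finset.sum_nonpos fun i _ => ?_
    rcases hε i with hi | hi
    · rw [hvZ i hi]; simp
    · rw [hi]; nlinarith [sq_nonneg ‖(Z *ᵥ v) i‖]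
  obtain ⟨l0, hl0⟩ := Function.ne_iff.1 hc0
  have h4 : 0 < ∑ i, ε' i * ‖v i‖ ^ 2 := by
    refine Finset.sum_pos' (fun i _ => ?_) ⟨l0.1, Finset.mem_univ _, ?_⟩
    · by_cases hi : ε' i = 1
      · rw [hi]; positivity
      · simp [hv, hi]
    · have : 0 < ‖v l0.1‖ := by simpa [hv, l0.2] using hl0
      rw [l0.2]; positivity
  linarith

/-- Inertia in both directions gives equal numbers of positive signs, and a bijection between them
extends to a permutation. -/
theorem exists_perm_signs {Z : Mat d 𝕜} {ε ε' : Fin d → ℝ} (hε : IsSigns ε) (hε' : IsSigns ε')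
    (h : Zᴴ * diagR 𝕜 ε * Z = diagR 𝕜 ε') :
    ∃ ρ : Equiv.Perm (Fin d), ∀ j, ε (ρ j) = ε' j := by
  classical
  have hZ : IsUnit Z.det := by
    have := congrArg Matrix.det h
    rw [Matrix.det_mul] at this
    refine isUnit_of_mul_isUnit_right (x := (Zᴴ * diagR 𝕜 ε).det) ?_
    rw [this, diagR, Matrix.det_diagonal, isUnit_iff_ne_zero, Finset.prod_ne_zero_iff]
    intro i _
    exact_mod_cast hε'.ne_zero i
  have h1 : Z * Z⁻¹ = 1 := Matrix.mul_nonsing_inv _ hZ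
  have h2 : (Z⁻¹)ᴴ * Zᴴ = 1 := by rw [← Matrix.conjTranspose_mul, h1, Matrix.conjTranspose_one]
  have h' : (Z⁻¹)ᴴ * diagR 𝕜 ε' * Z⁻¹ = diagR 𝕜 ε := by
    rw [← h]
    calc (Z⁻¹)ᴴ * (Zᴴ * diagR 𝕜 ε * Z) * Z⁻¹ = ((Z⁻¹)ᴴ * Zᴴ) * diagR 𝕜 ε * (Z * Z⁻¹) := by
          simp only [mul_assoc]
      _ = _ := by rw [h1, h2, one_mul, mul_one]
  have hcard := le_antisymm (card_pos_le_of_conj hε h) (card_pos_le_of_conj hε' h')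
  set e := Fintype.equivOfCardEq hcard
  refine ⟨e.extendSubtype, fun j => ?_⟩
  rcases hε' j with hj | hj
  · rw [hj]; exact e.extendSubtype_mem j hj
  · rw [hj]
    refine (hε _).resolve_left (e.extendSubtype_not_mem j ?_)
    rw [hj]; norm_num

/-- `X` is sorted along each sign class. -/
def SortedOn (ε X : Fin d → ℝ) : Prop := ∀ i j, i < j → ε i = ε j → X j ≤ X i

/-- A family has only one sorted rearrangement. Listing the indices by sign and then backwards turns
sortedness on each sign class into monotonicity of the pairs (sign, value) in lexicographic order.
-/
theorem SortedOn.eq_of_perm {ε X : Fin d → ℝ} {σ : Equiv.Perm (Fin d)} (hσ : ∀ i, ε (σ i) = ε i)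
    (hX : SortedOn ε X) (hY : SortedOn ε (X ∘ σ)) : X ∘ σ = X := by
  set c := Tuple.sort fun i => toLex (ε i, OrderDual.toDual i) with hc
  have hmono := Tuple.monotone_sort fun i : Fin d => toLex (ε i, OrderDual.toDual i)
  have key : ∀ Y : Fin d → ℝ, SortedOn ε Y → Monotone ((fun i => toLex (ε i, Y i)) ∘ c) := by
    intro Y hY i j hij
    have h1 := hmono hij
    simp only [Function.comp, Prod.Lex.toLex_le_toLex] at h1 ⊢
    rcases h1 with h1 | ⟨h1, h2⟩
    · exact Or.inl h1
    · refine Or.inr ⟨h1, ?_⟩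
      have h3 : c j ≤ c i := h2
      rcases h3.lt_or_eq with h3 | h3
      · exact hY _ _ h3 h1.symm
      · rw [h3]
  have h1 := key X hX
  have h2 : Monotone ((fun i => toLex (ε i, X i)) ∘ (c.trans σ)) := by
    have := key _ hY
    intro i j hij
    simpa [hσ] using this hij
  have h3 := Tuple.unique_monotone h2 h1
  funext i
  have h4 := congrFun h3 (c.symm i)
  simp only [Function.comp, Equiv.trans_apply, Equiv.apply_symm_apply] at h4
  exact (Prod.ext_iff.1 (toLex.injective h4)).2

/-- Compose two enumerations of the indices grouped by sign, one increasing and the other decreasing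
inside each group; both give the same sequence of signs. -/
theorem exists_opposition_perm (ε : Fin d → ℝ) : ∃ ω : Equiv.Perm (Fin d), (∀ i, ε (ω i) = ε i) ∧
    ∀ i j, i < j → ε i = ε j → ω j < ω i := by
  set c := Tuple.sort fun i => toLex (ε i, i) with hc
  set c' := Tuple.sort fun i => toLex (ε i, OrderDual.toDual i) with hc'
  have hm := Tuple.monotone_sort fun i : Fin d => toLex (ε i, i)
  have hm' := Tuple.monotone_sort fun i : Fin d => toLex (ε i, OrderDual.toDual i)
  have h1 : Monotone (ε ∘ c) := fun i j hij => by
    have := hm hij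
    simp only [Function.comp, Prod.Lex.toLex_le_toLex] at this
    rcases this with h | h
    · exact h.le
    · exact h.1.le
  have h2 : Monotone (ε ∘ c') := fun i j hij => by
    have := hm' hij
    simp only [Function.comp, Prod.Lex.toLex_le_toLex] at this
    rcases this with h | h
    · exact h.le
    · exact h.1.le
  have h3 := Tuple.unique_monotone h2 h1
  have hω : ∀ i, ε ((c.symm.trans c') i) = ε i := by
    intro i
    have := congrFun h3 (c.symm i)
    simpa using this
  refine ⟨c.symm.trans c', hω, fun i j hij hε => ?_⟩
  have h4 : c.symm i < c.symm j := by
    by_contra hcon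
    have := hm (not_lt.1 hcon)
    simp only [Function.comp, Prod.Lex.toLex_le_toLex] at this
    rw [← hc, Equiv.apply_symm_apply, Equiv.apply_symm_apply, hε] at this
    rcases this with h | h
    · exact lt_irrefl _ h
    · exact absurd h.2 (not_le.2 hij)
  have h5 := hm' h4.le
  simp only [Function.comp, Prod.Lex.toLex_le_toLex] at h5
  have e1 := hω i
  have e2 := hω j
  simp only [Equiv.trans_apply] at e1 e2 ⊢
  rw [← hc', e1, e2, hε] at h5
  rcases h5 with h | h
  · exact absurd h (lt_irrefl _)
  · refine lt_of_le_of_ne h.2 fun h6 => ?_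
    exact h4.ne' (c'.injective h6)

/-! ### Permutation matrices -/

/-- The matrix of the linear map `e_j ↦ e_{σ j}`. -/
def permM (𝕜 : Type*) [RCLike 𝕜] (σ : Equiv.Perm (Fin d)) : Mat d 𝕜 :=
  (1 : Mat d 𝕜).submatrix id σ

theorem permM_apply (σ : Equiv.Perm (Fin d)) (i j : Fin d) :
    permM 𝕜 σ i j = if i = σ j then 1 else 0 := by
  simp [permM, Matrix.one_apply]

theorem mul_permM_apply (A : Mat d 𝕜) (σ : Equiv.Perm (Fin d)) (i j : Fin d) :
    (A * permM 𝕜 σ) i j = A i (σ j) := by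
  simp [Matrix.mul_apply, permM_apply]

theorem permM_conj_apply (A : Mat d 𝕜) (σ : Equiv.Perm (Fin d)) (i j : Fin d) :
    ((permM 𝕜 σ)ᴴ * A * permM 𝕜 σ) i j = A (σ i) (σ j) := by
  rw [mul_permM_apply]
  simp [Matrix.mul_apply, permM_apply]

theorem permM_unitary (σ : Equiv.Perm (Fin d)) : (permM 𝕜 σ)ᴴ * permM 𝕜 σ = 1 := by
  ext i j
  have := permM_conj_apply (𝕜 := 𝕜) 1 σ i j
  rw [mul_one] at this
  rw [this]
  simp [Matrix.one_apply]

theorem permM_conj_diagR (σ : Equiv.Perm (Fin d)) (x : Fin d → ℝ) :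
    (permM 𝕜 σ)ᴴ * diagR 𝕜 x * permM 𝕜 σ = diagR 𝕜 (x ∘ σ) := by
  ext i j
  rw [permM_conj_apply, diagR_apply, diagR_apply]
  simp

theorem diagR_mul_permM (σ : Equiv.Perm (Fin d)) (x : Fin d → ℝ) :
    diagR 𝕜 x * permM 𝕜 σ = permM 𝕜 σ * diagR 𝕜 (x ∘ σ) := by
  rw [← permM_conj_diagR σ x]
  simp only [← mul_assoc]
  rw [mul_eq_one_comm.1 (permM_unitary (𝕜 := 𝕜) σ), one_mul]

/-- The matrix reversing the standard basis. -/
def revM (d : ℕ) (𝕜 : Type*) [RCLike 𝕜] : Mat d 𝕜 := permM 𝕜 Fin.revPerm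

theorem revM_conjTranspose : (revM d 𝕜)ᴴ = revM d 𝕜 := by
  ext i j
  have : j = Fin.rev i ↔ i = Fin.rev j := by rw [eq_comm, Fin.rev_eq_iff]
  simp [revM, permM_apply, this]

/-! ### Comparison of Cartan decompositions -/

theorem expD_injective_apply {a b : Fin d → ℝ} {z : 𝕜} {i j : Fin d} (hz : z ≠ 0)
    (h : z * (Real.exp (a i) : 𝕜) = (Real.exp (b j) : 𝕜) * z) : a i = b j := by
  rw [mul_comm] at h
  have := mul_right_cancel₀ hz h
  have h2 : Real.exp (a i) = Real.exp (b j) := by exact_mod_cast this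
  exact Real.exp_injective h2

/-- The unitary matrix `N = L * K'` satisfies `N exp(2a') = exp(-2a) N`, so a nonzero entry at `(i,
j)` forces `a' j = - a i`. As `a` has distinct entries, `N` is monomial, and as `a'` is decreasing
its permutation is the reversal. In terms of flags, this locates the repellor of the product in the
source. -/
theorem exists_phase_of_cartan_inv {K L K' L' : Mat d 𝕜} {a a' : Fin d → ℝ}
    (hK : Kᴴ * K = 1) (hL : Lᴴ * L = 1) (hK' : K'ᴴ * K' = 1) (hL' : L'ᴴ * L' = 1)
    (ha : ∀ i j, i < j → a j < a i) (ha' : Antitone a')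
    (h : K * expD 𝕜 a * L * (K' * expD 𝕜 a' * L') = 1) :
    ∃ p : Fin d → 𝕜, (∀ i, ‖p i‖ = 1) ∧ L * K' = revM d 𝕜 * Matrix.diagonal p := by
  set N := L * K' with hN
  have hNu : Nᴴ * N = 1 := by
    rw [hN, Matrix.conjTranspose_mul]
    calc K'ᴴ * Lᴴ * (L * K') = K'ᴴ * (Lᴴ * L) * K' := by simp only [mul_assoc]
      _ = 1 := by rw [hL, mul_one, hK']
  have hNu' : N * Nᴴ = 1 := mul_eq_one_comm.1 hNu
  have hL'' : L' * L'ᴴ = 1 := mul_eq_one_comm.1 hL'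
  have h1 : expD 𝕜 a * N * expD 𝕜 a' = Kᴴ * L'ᴴ := by
    calc expD 𝕜 a * N * expD 𝕜 a' = (Kᴴ * K) * (expD 𝕜 a * N * expD 𝕜 a') * (L' * L'ᴴ) := by
          rw [hK, hL'', one_mul, mul_one]
      _ = Kᴴ * (K * expD 𝕜 a * L * (K' * expD 𝕜 a' * L')) * L'ᴴ := by
          rw [hN]; simp only [mul_assoc]
      _ = _ := by rw [h, mul_one]
  have h2 : (expD 𝕜 a * N * expD 𝕜 a') * (expD 𝕜 a * N * expD 𝕜 a')ᴴ = 1 := by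
    rw [h1, Matrix.conjTranspose_mul, Matrix.conjTranspose_conjTranspose,
      Matrix.conjTranspose_conjTranspose]
    calc Kᴴ * L'ᴴ * (L' * K) = Kᴴ * (L'ᴴ * L') * K := by simp only [mul_assoc]
      _ = 1 := by rw [hL', mul_one, hK]
  have h3 : N * expD 𝕜 (a' + a') = expD 𝕜 (-a + -a) * N := by
    rw [Matrix.conjTranspose_mul, Matrix.conjTranspose_mul, expD_conjTranspose,
      expD_conjTranspose] at h2
    calc N * expD 𝕜 (a' + a')
        = (expD 𝕜 (-a) * expD 𝕜 a) * (N * (expD 𝕜 a' * expD 𝕜 a') * Nᴴ)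
            * (expD 𝕜 a * expD 𝕜 (-a)) * N := by
          rw [expD_neg_mul, expD_mul_neg, expD_mul, one_mul, mul_one, mul_assoc _ Nᴴ, hNu, mul_one]
      _ = expD 𝕜 (-a) * (expD 𝕜 a * N * expD 𝕜 a' * (expD 𝕜 a' * (Nᴴ * expD 𝕜 a)))
            * expD 𝕜 (-a) * N := by simp only [mul_assoc]
      _ = _ := by rw [h2, mul_one, expD_mul]
  have hent : ∀ i j, N i j ≠ 0 → a' j = - a i := by
    intro i j hij
    have h4 := congrFun (congrFun h3 i) j
    rw [expD, expD, diagR, diagR, Matrix.mul_diagonal, Matrix.diagonal_mul] at h4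
    have := expD_injective_apply hij h4
    simp only [Pi.add_apply, Pi.neg_apply] at this
    linarith
  have hinj : ∀ i j, a i = a j → i = j := by
    intro i j hij
    by_contra hne
    rcases lt_or_gt_of_ne hne with h | h
    · exact (ha i j h).ne' hij
    · exact (ha j i h).ne hij
  -- A permutation carrying nonzero entries exists since `N` is invertible; the orderings of `a` and
  -- `a'` identify it.
  obtain ⟨σ, hσ⟩ := exists_perm_ne_zero (M := N) (by
    intro h0
    have := norm_det_of_unitary hNu
    rw [h0, norm_zero] at this; exact zero_ne_one this)
  have hσanti : Antitone (id ∘ σ) := by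
    intro i j hij
    by_contra hcon
    have h5 : σ i < σ j := not_le.1 hcon
    have h6 := ha _ _ h5
    have h7 := ha' hij
    rw [hent _ _ (hσ i), hent _ _ (hσ j)] at h7
    linarith
  have hrev : Antitone (id ∘ (Fin.revPerm (n := d))) := fun i j hij => by
    simpa using hij
  have hσrev : ∀ i, σ i = Fin.rev i := fun i => congrFun (Tuple.unique_antitone hσanti hrev) i
  have hzero : ∀ i j, i ≠ Fin.rev j → N i j = 0 := by
    intro i j hij
    by_contra hne
    apply hij
    apply hinj
    have h5 := hent _ _ hne
    have h6 := hent _ _ (hσ j)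
    rw [hσrev] at h6
    linarith
  have hNp : N = revM d 𝕜 * Matrix.diagonal fun j => N (Fin.rev j) j := by
    ext i j
    rw [Matrix.mul_diagonal, revM, permM_apply, Fin.revPerm_apply]
    by_cases hij : i = Fin.rev j
    · rw [if_pos hij, one_mul, hij]
    · rw [if_neg hij, zero_mul, hzero _ _ hij]
  refine ⟨fun j => N (Fin.rev j) j, fun j => ?_, hNp⟩
  have h8 := congrFun (congrFun hNu j) j
  rw [Matrix.mul_apply, Finset.sum_eq_single (Fin.rev j), Matrix.one_apply_eq,
    Matrix.conjTranspose_apply, RCLike.star_def, RCLike.conj_mul] at h8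
  · have h9 : ‖N (Fin.rev j) j‖ ^ 2 = 1 := by exact_mod_cast h8
    exact (pow_eq_one_iff_of_nonneg (norm_nonneg _) two_ne_zero).1 h9
  · intro b _ hb
    rw [hzero _ _ hb, mul_zero]
  · simp

/-- The Cartan projection of `Q diag(μ) Q⁻¹` is within bounded distance of `log |μ|`. -/
theorem exists_cartan_bound {Q Q' : Mat d 𝕜} (hQ : Q * Q' = 1) : ∃ C : ℝ,
    ∀ (K L : Mat d 𝕜) (a b : Fin d → ℝ) (s : Fin d → 𝕜), Kᴴ * K = 1 → Lᴴ * L = 1 → Antitone a →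
      Antitone b → (∀ i, ‖s i‖ = 1) →
      K * expD 𝕜 a * L = Q * (expD 𝕜 b * Matrix.diagonal s) * Q' → ∀ i, |a i - b i| ≤ C := by
  have hQ' : Q' * Q = 1 := mul_eq_one_comm.1 hQ
  set q := ∑ i, ∑ j, (‖Q i j‖ + ‖Q' i j‖) with hq
  have hle : ∀ i j, ‖Q i j‖ + ‖Q' i j‖ ≤ q := fun i j =>
    (Finset.single_le_sum (f := fun j => ‖Q i j‖ + ‖Q' i j‖) (fun _ _ => by positivity)
      (Finset.mem_univ j)).trans
      (Finset.single_le_sum (f := fun i => ∑ j, (‖Q i j‖ + ‖Q' i j‖)) (fun _ _ => by positivity)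
      (Finset.mem_univ i))
  have hQq : ∀ i j, ‖Q i j‖ ≤ q := fun i j =>
    (le_add_of_nonneg_right (norm_nonneg _)).trans (hle i j)
  have hQ'q : ∀ i j, ‖Q' i j‖ ≤ q := fun i j =>
    (le_add_of_nonneg_left (norm_nonneg _)).trans (hle i j)
  -- Entries of a unitary matrix are at most 1, so `R` bounds those of any product of `Q` or `Q'`
  -- with a unitary factor.
  set R : ℝ := d * (q * 1) with hR
  refine ⟨|Real.log (d * (R * (d * R)))|, fun K L a b s hK hL ha hb hs h i => ?_⟩
  have hK' : K * Kᴴ = 1 := mul_eq_one_comm.1 hK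
  have hL' : L * Lᴴ = 1 := mul_eq_one_comm.1 hL
  have hKe := norm_apply_le_of_unitary hK
  have hLe := norm_apply_le_of_unitary hL
  have hss := diagonal_phase hs
  have hss' : Matrix.diagonal s * (Matrix.diagonal s)ᴴ = 1 := mul_eq_one_comm.1 hss
  have hd1 : ∀ (A : Mat d 𝕜) i j, ‖(A * (Matrix.diagonal s)ᴴ) i j‖ = ‖A i j‖ := by
    intro A i j
    rw [Matrix.diagonal_conjTranspose, Matrix.mul_diagonal, norm_mul, Pi.star_apply, norm_star, hs,
      mul_one]
  have hd2 : ∀ (A : Mat d 𝕜) i j, ‖(Matrix.diagonal s * A) i j‖ = ‖A i j‖ := by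
    intro A i j
    rw [Matrix.diagonal_mul, norm_mul, hs, one_mul]
  have e1 : expD 𝕜 a = (Kᴴ * Q) * expD 𝕜 b * (Matrix.diagonal s * (Q' * Lᴴ)) := by
    calc expD 𝕜 a = (Kᴴ * K) * expD 𝕜 a * (L * Lᴴ) := by rw [hK, hL', one_mul, mul_one]
      _ = Kᴴ * (K * expD 𝕜 a * L) * Lᴴ := by simp only [mul_assoc]
      _ = _ := by rw [h]; simp only [mul_assoc]
  have e2 : expD 𝕜 b = (Q' * K) * expD 𝕜 a * ((L * Q) * (Matrix.diagonal s)ᴴ) := by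
    calc expD 𝕜 b = (Q' * Q) * (expD 𝕜 b * Matrix.diagonal s) * (Q' * Q) * (Matrix.diagonal s)ᴴ := by
          rw [hQ', one_mul, mul_one, mul_assoc, hss', mul_one]
      _ = Q' * (Q * (expD 𝕜 b * Matrix.diagonal s) * Q') * Q * (Matrix.diagonal s)ᴴ := by
          simp only [mul_assoc]
      _ = _ := by rw [← h]; simp only [mul_assoc]
  have hqR : (d : ℝ) * (1 * q) = R := by rw [hR, one_mul, mul_one]
  have i1 := exp_le_of_expD_eq ha hb (R := R) (S := R)
    (fun i j => hqR ▸ norm_mul_apply_le (norm_conjTranspose_apply_le hKe) hQq i j)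
    (fun i j => by
      rw [hd2]; exact norm_mul_apply_le hQ'q (norm_conjTranspose_apply_le hLe) i j) e1 i
  have i2 := exp_le_of_expD_eq hb ha (R := R) (S := R)
    (fun i j => norm_mul_apply_le hQ'q hKe i j)
    (fun i j => by rw [hd1]; exact hqR ▸ norm_mul_apply_le hLe hQq i j) e2 i
  have hpos : 0 < d * (R * (d * R)) := by
    have := (Real.exp_pos (a i)).trans_le i1
    exact (pos_iff_pos_of_mul_pos this).2 (Real.exp_pos _)
  have l1 := Real.log_le_log (Real.exp_pos _) i1
  have l2 := Real.log_le_log (Real.exp_pos _) i2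
  rw [Real.log_mul hpos.ne' (Real.exp_pos _).ne', Real.log_exp, Real.log_exp] at l1 l2
  have := le_abs_self (Real.log (d * (R * (d * R))))
  rw [abs_le]
  constructor <;> linarith

/-- Compare two consecutive partial products: their quotients on the two sides have the same sign.
-/
theorem signs_of_prod {D ε : Fin d → ℝ} (hε : IsSigns ε)
    (h : ∀ j (h : j ≤ d), ∃ c : ℝ, 0 < c ∧
      ∏ i : Fin j, D (Fin.castLE h i) = c * ∏ i : Fin j, ε (Fin.castLE h i)) (i : Fin d) :
    0 < D i * ε i := by
  obtain ⟨c1, hc1, h1⟩ := h i (le_of_lt i.2)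
  obtain ⟨c2, hc2, h2⟩ := h (i + 1) i.2
  rw [Fin.prod_univ_castSucc, Fin.prod_univ_castSucc] at h2
  have e1 : ∀ k : Fin (i : ℕ), Fin.castLE i.2 k.castSucc = Fin.castLE (le_of_lt i.2) k := fun _ => rfl
  have e2 : Fin.castLE i.2 (Fin.last (i : ℕ)) = i := rfl
  simp only [Nat.succ_eq_add_one] at h2 e1 e2
  simp only [e1, e2] at h2
  set P := ∏ k : Fin (i : ℕ), ε (Fin.castLE (le_of_lt i.2) k) with hP
  have hP0 : P ≠ 0 := Finset.prod_ne_zero_iff.2 fun k _ => hε.ne_zero _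
  rw [h1] at h2
  have h3 : c1 * D i = c2 * ε i := by
    apply mul_right_cancel₀ hP0
    linear_combination h2
  have h4 : c1 * (D i * ε i) = c2 := by
    linear_combination (ε i) * h3 + c2 * hε.mul_self i
  rw [← h4] at hc2
  exact (pos_iff_pos_of_mul_pos hc2).1 hc1

/-- The decomposition of a group element with large singular gaps, with generic attractor and
repellor, with respect to a diagonal form. -/
theorem exists_orthogonal_diag (d : ℕ) (δ : ℝ) (hδ : 0 < δ) : ∃ l : ℝ, 0 < l ∧ ∃ D : ℝ, 0 < D ∧
    ∀ (K L K' L' : Mat d 𝕜) (a a' ε ε' : Fin d → ℝ), Kᴴ * K = 1 → Lᴴ * L = 1 → K'ᴴ * K' = 1 →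
      L'ᴴ * L' = 1 → (∀ i j, i < j → l < a i - a j) → Antitone a' →
      K * expD 𝕜 a * L * (K' * expD 𝕜 a' * L') = 1 → IsSigns ε → IsSigns ε' →
      (∀ j h, δ ≤ ‖leadMinor (Kᴴ * diagR 𝕜 ε * K) j h‖) →
      (∀ j h, δ ≤ ‖leadMinor (K'ᴴ * diagR 𝕜 ε * K') j h‖) →
      (∀ j h, ∃ c : ℝ, 0 < c ∧ leadMinor (K'ᴴ * diagR 𝕜 ε * K') j h
        = ((c * ∏ i : Fin j, ε' (Fin.castLE h i).rev : ℝ) : 𝕜)) →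
      ∃ (Q : Mat d 𝕜) (μ : Fin d → ℝ), Qᴴ * diagR 𝕜 ε * Q = diagR 𝕜 ε' ∧
        (K * expD 𝕜 a * L * Q)ᴴ * diagR 𝕜 ε * (K * expD 𝕜 a * L * Q) = diagR 𝕜 (μ * ε') ∧
        (∀ i, |Real.log |μ i| - 2 * a i| ≤ D) ∧ (∀ i, μ i ≠ 0) ∧ ∀ i j, i < j → |μ j| < |μ i| := by
  obtain ⟨C, hC, hlow⟩ := exists_lower_diagonalize (𝕜 := 𝕜) d δ (d * (d * (1 * 1) * 1)) hδ
  -- The pivots lie between `C⁻¹` and `C` in modulus, so the normalizing factors `S i` lie between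
  -- `c⁻¹` and `c`.
  set c := Real.sqrt C with hc
  have hcp : 0 < c := Real.sqrt_pos.2 hC
  set R : ℝ := d * (d * (1 * 1) * 1) + C * c with hR
  obtain ⟨l, hl, D0, hD0, hmain⟩ := exists_pencil_diag (𝕜 := 𝕜) d R (min δ c⁻¹)
    (lt_min hδ (inv_pos.2 hcp))
  refine ⟨l, hl, D0, hD0, ?_⟩
  intro K L K' L' a a' ε ε' hK hL hK' hL' ha ha' hinv hε hε' hKδ hKδ' hsign
  have hJ : ∀ i j, ‖diagR 𝕜 ε i j‖ ≤ 1 := by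
    intro i j
    rw [diagR_apply]
    split_ifs
    · rw [RCLike.norm_ofReal, hε.abs]
    · simp
  have hbd : ∀ U : Mat d 𝕜, Uᴴ * U = 1 → ∀ i j, ‖(Uᴴ * diagR 𝕜 ε * U) i j‖
      ≤ d * (d * (1 * 1) * 1) := by
    intro U hU
    have := norm_apply_le_of_unitary hU
    exact norm_mul_apply_le (norm_mul_apply_le (norm_conjTranspose_apply_le this) hJ) this
  obtain ⟨p, hp, hLK⟩ := exists_phase_of_cartan_inv hK hL hK' hL'
    (fun i j hij => by have := ha i j hij; linarith) ha' hinv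
  have hherm : ∀ U : Mat d 𝕜, (Uᴴ * diagR 𝕜 ε * U).IsHermitian := fun U =>
    Matrix.isHermitian_conjTranspose_mul_mul U (diagR_isHermitian ε)
  obtain ⟨u, Ds, hu0, hu1, huC, hDs, huN, hprod⟩ := hlow _ (hherm K') (hbd K' hK') hKδ'
  have hDs0 : ∀ i, 0 < |Ds i| := fun i => (inv_pos.2 hC).trans_le (hDs i).1
  have hpos : ∀ i, 0 < Ds i * ε' (Fin.rev i) := by
    refine signs_of_prod (ε := fun i => ε' (Fin.rev i)) (fun i => hε' _) fun j h => ?_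
    obtain ⟨c, hc, hc'⟩ := hsign j h
    refine ⟨c, hc, ?_⟩
    rw [hprod j h] at hc'
    exact_mod_cast hc'
  set S : Fin d → ℝ := fun i => (Real.sqrt |Ds i|)⁻¹ with hS
  have hsq : ∀ i, 0 < Real.sqrt |Ds i| := fun i => Real.sqrt_pos.2 (hDs0 i)
  have hSle : ∀ i, |S i| ≤ c := by
    intro i
    rw [abs_of_pos (inv_pos.2 (hsq i)), inv_le_comm₀ (hsq i) hcp, hc, ← Real.sqrt_inv]
    exact Real.sqrt_le_sqrt (hDs i).1
  have hSge : ∀ i, c⁻¹ ≤ |S i| := by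
    intro i
    rw [abs_of_pos (inv_pos.2 (hsq i)), inv_le_inv₀ hcp (hsq i)]
    exact Real.sqrt_le_sqrt (hDs i).2
  have hSD : ∀ i, S i * Ds i * S i = ε' (Fin.rev i) := by
    intro i
    have h2 : Real.sqrt |Ds i| * Real.sqrt |Ds i| = |Ds i| := Real.mul_self_sqrt (abs_nonneg _)
    have h4 : Ds i = ε' (Fin.rev i) * |Ds i| := by
      have := hpos i
      rcases hε' (Fin.rev i) with h | h <;> rw [h] at this ⊢
      · rw [abs_of_pos (by linarith)]; ring
      · rw [abs_of_neg (by linarith)]; ring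
    have : S i * Ds i * S i = Ds i / (Real.sqrt |Ds i| * Real.sqrt |Ds i|) := by
      rw [hS]; have := (hsq i).ne'; field_simp
    rw [this, h2, h4, abs_mul, hε'.abs, one_mul, abs_abs]
    have := (hDs0 i).ne'
    field_simp
  set w := revM d 𝕜 with hw
  -- An orthonormalized basis adapted to the repellor flag; its signs are `ε'` read backwards, which
  -- the factor `w` will put back in order.
  set Y := K' * uᴴ * diagR 𝕜 S with hY
  -- This is `L * (Y * w)`. The upper triangular `uᴴ` becomes lower triangular between the two
  -- reversals, which is the direction contracted by `exp(a)`.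
  set b := w * Matrix.diagonal p * uᴴ * diagR 𝕜 S * w with hb
  have hYJ : Yᴴ * diagR 𝕜 ε * Y = diagR 𝕜 fun i => ε' (Fin.rev i) := by
    have : Yᴴ * diagR 𝕜 ε * Y = diagR 𝕜 S * (u * (K'ᴴ * diagR 𝕜 ε * K') * uᴴ) * diagR 𝕜 S := by
      rw [hY, Matrix.conjTranspose_mul, Matrix.conjTranspose_mul, diagR_conjTranspose,
        Matrix.conjTranspose_conjTranspose]
      simp only [mul_assoc]
    rw [this, huN]
    change diagR 𝕜 S * diagR 𝕜 Ds * diagR 𝕜 S = _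
    rw [diagR_mul, diagR_mul]
    congr 1; funext i; exact hSD i
  have hYwJ : (Y * w)ᴴ * diagR 𝕜 ε * (Y * w) = diagR 𝕜 ε' := by
    have : (Y * w)ᴴ * diagR 𝕜 ε * (Y * w) = wᴴ * (Yᴴ * diagR 𝕜 ε * Y) * w := by
      rw [Matrix.conjTranspose_mul]; simp only [mul_assoc]
    rw [this, hYJ, hw, revM, permM_conj_diagR]
    congr 1; funext i; simp
  have hAY : K * expD 𝕜 a * L * (Y * w) = K * expD 𝕜 a * b := by
    calc K * expD 𝕜 a * L * (Y * w) = K * expD 𝕜 a * (L * K') * uᴴ * diagR 𝕜 S * w := by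
          rw [hY]; simp only [mul_assoc]
      _ = _ := by rw [hLK, hb]; simp only [mul_assoc]
  have hbent : ∀ i j, b i j = p (Fin.rev i) * star (u (Fin.rev j) (Fin.rev i)) * (S (Fin.rev j) : 𝕜) := by
    intro i j
    have h1 : b = w * (Matrix.diagonal p * uᴴ * diagR 𝕜 S) * w := by
      rw [hb]; simp only [mul_assoc]
    have h2 : w = (permM 𝕜 Fin.revPerm)ᴴ := by rw [hw, ← revM, revM_conjTranspose]
    rw [h1]
    nth_rewrite 1 [h2]
    rw [hw, revM, permM_conj_apply, diagR, Matrix.mul_diagonal, Matrix.diagonal_mul]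
    rfl
  have hbabs : ∀ i j, ‖b i j‖ = ‖u (Fin.rev j) (Fin.rev i)‖ * |S (Fin.rev j)| := by
    intro i j
    rw [hbent, norm_mul, norm_mul, hp, one_mul, norm_star, RCLike.norm_ofReal]
  have hd0 : (0 : ℝ) ≤ d * (d * (1 * 1) * 1) := by positivity
  obtain ⟨V, μ, hV1, hV2, hμD, hμ0, hμlt⟩ := hmain (Kᴴ * diagR 𝕜 ε * K) b ε' a (hherm K)
    (fun i j => (hbd K hK i j).trans (by rw [hR]; have := mul_pos hC hcp; linarith))
    (fun j h => (min_le_left _ _).trans (hKδ j h))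
    (fun i j hij => by
      rw [hbent, hu0 _ _ (Fin.rev_lt_rev.2 hij)]; simp)
    (fun i j => by
      rw [hbabs]
      have := mul_le_mul (huC (Fin.rev j) (Fin.rev i)) (hSle (Fin.rev j)) (abs_nonneg _) hC.le
      rw [hR]; linarith)
    (fun i => by
      rw [hbabs, hu1, norm_one, one_mul]
      exact (min_le_right _ _).trans (hSge _))
    hε' ha
  refine ⟨Y * w * V, μ, ?_, ?_, hμD, hμ0, hμlt⟩
  · have : (Y * w * V)ᴴ * diagR 𝕜 ε * (Y * w * V) = Vᴴ * ((Y * w)ᴴ * diagR 𝕜 ε * (Y * w)) * V := by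
      rw [Matrix.conjTranspose_mul _ V]; simp only [mul_assoc]
    rw [this, hYwJ, hV1]
  · rw [← mul_assoc _ (Y * w) V, hAY, ← hV2]
    simp only [Matrix.conjTranspose_mul, expD_conjTranspose, mul_assoc]

/-! ### Frames adapted to a Cartan subspace -/

/-- The joint eigenspaces of a commuting family of symmetric operators decompose the space
orthogonally. The family may be infinite, but only finitely many joint eigenspaces are nonzero, so
an orthonormal basis can be chosen inside them. -/
theorem exists_simultaneous_diag (S : Set (Mat d 𝕜)) (hS : ∀ M ∈ S, M.IsHermitian)
    (hcomm : ∀ M ∈ S, ∀ N ∈ S, M * N = N * M) :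
    ∃ U : Mat d 𝕜, Uᴴ * U = 1 ∧ ∀ M ∈ S, ∃ x : Fin d → ℝ, M * U = U * diagR 𝕜 x := by
  classical
  set E := EuclideanSpace 𝕜 (Fin d)
  set T : S → E →ₗ[𝕜] E := fun M => Matrix.toEuclideanLin (M : Mat d 𝕜) with hT
  have hsym : ∀ M, (T M).IsSymmetric := fun M => Matrix.isSymmetric_toEuclideanLin_iff.2 (hS _ M.2)
  have hc : Pairwise (fun M N => Commute (T M) (T N)) := by
    intro M N _
    have h1 := hcomm _ M.2 _ N.2
    apply LinearMap.ext
    intro v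
    change WithLp.toLp 2 ((M : Mat d 𝕜) *ᵥ ((N : Mat d 𝕜) *ᵥ v.ofLp))
      = WithLp.toLp 2 ((N : Mat d 𝕜) *ᵥ ((M : Mat d 𝕜) *ᵥ v.ofLp))
    rw [Matrix.mulVec_mulVec, Matrix.mulVec_mulVec, h1]
  have hV := LinearMap.IsSymmetric.directSum_isInternal_of_pairwise_commute hsym hc
  have hO := LinearMap.IsSymmetric.orthogonalFamily_iInf_eigenspaces hsym
  set A : (S → 𝕜) → Submodule 𝕜 E := fun α => ⨅ j, Module.End.eigenspace (T j) (α j) with hA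
  have hfin : {i | A i ≠ ⊥}.Finite := WellFoundedGT.finite_ne_bot_of_iSupIndep hV.submodule_iSupIndep
  have : Fintype {i // A i ≠ ⊥} := hfin.fintype
  have hV' := DirectSum.isInternal_ne_bot_iff.2 hV
  have hO' : OrthogonalFamily 𝕜 (fun i : {i // A i ≠ ⊥} => A i) fun i => (A i).subtypeₗᵢ :=
    hO.comp Subtype.val_injective
  have hn : Module.finrank 𝕜 E = d := by simp [E]
  set b := hV'.subordinateOrthonormalBasis hn hO' with hb
  have hbmem : ∀ a M, T M (b a) = (hV'.subordinateOrthonormalBasisIndex hn a hO').1 M • b a := by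
    intro a M
    have h1 := hV'.subordinateOrthonormalBasis_subordinate hn a hO'
    exact Module.End.mem_eigenspace_iff.1 ((Submodule.mem_iInf _).1 h1 M)
  set χ := fun a => (hV'.subordinateOrthonormalBasisIndex hn a hO').1 with hχ
  set U : Mat d 𝕜 := Matrix.of fun i a => b a i with hU
  have hUU : Uᴴ * U = 1 := by
    ext i j
    have h1 := orthonormal_iff_ite.1 b.orthonormal i j
    rw [Matrix.mul_apply, Matrix.one_apply, ← h1, PiLp.inner_apply]
    refine Finset.sum_congr rfl fun k _ => ?_
    simp [hU, RCLike.inner_apply, mul_comm]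
  have hMU : ∀ M : S, (M : Mat d 𝕜) * U = U * Matrix.diagonal fun a => χ a M := by
    intro M
    ext i a
    have h1 := congrArg (fun v : E => v i) (hbmem a M)
    rw [Matrix.mul_diagonal, mul_comm]
    exact h1
  refine ⟨U, hUU, fun M hM => ⟨fun a => RCLike.re (χ a ⟨M, hM⟩), ?_⟩⟩
  have h1 := hMU ⟨M, hM⟩
  have h2 : Uᴴ * M * U = Matrix.diagonal fun a => χ a ⟨M, hM⟩ := by
    rw [mul_assoc]
    change Uᴴ * (M * U) = _
    rw [h1, ← mul_assoc, hUU, one_mul]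
  have h3 : (Uᴴ * M * U).IsHermitian := Matrix.isHermitian_conjTranspose_mul_mul U (hS M hM)
  change M * U = _ at h1
  rw [h1]
  congr 1
  rw [diagR]
  congr 1
  funext a
  have h4 := h3.coe_re_apply_self a
  rw [h2, Matrix.diagonal_apply_eq] at h4
  exact h4.symm

/-- A component of the complement of the hyperplanes is a cell with prescribed signs of the roots:
signs cannot change on a connected set, and the cell is convex. Its closure is given by the weak
inequalities, because adding a small multiple of `x` makes them strict. -/
theorem weylChamber_eq {𝔟 : LieSubalgebra ℝ (Mat d 𝕜)} {R : Set (Module.Dual ℝ 𝔟)}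
    (hR : ∀ α ∈ R, Continuous α) {S : Set 𝔟} (hS : IsWeylChamber R S) :
    ∃ x : 𝔟, (∀ α ∈ R, α x ≠ 0) ∧ S = {y | ∀ α ∈ R, 0 ≤ α x * α y} := by
  obtain ⟨x, hx, rfl⟩ := hS
  refine ⟨x, hx, ?_⟩
  have hline : ∀ u v : 𝔟, Continuous fun t : ℝ => u + t • v := by
    intro u v
    refine continuous_induced_rng.2 ?_
    change Continuous fun t : ℝ => (u : Mat d 𝕜) + t • (v : Mat d 𝕜)
    exact continuous_const.add (continuous_id.smul continuous_const)
  have hcomp : connectedComponentIn {X : 𝔟 | ∀ α ∈ R, α X ≠ 0} x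
      = {y | ∀ α ∈ R, 0 < α x * α y} := by
    apply Set.Subset.antisymm
    · intro y hy α hα
      have hyF : α y ≠ 0 := connectedComponentIn_subset _ _ hy α hα
      by_contra hcon
      have hneg : α x * α y ≤ 0 := not_lt.1 hcon
      have hpre := isPreconnected_connectedComponentIn (x := x) (F := {X : 𝔟 | ∀ α ∈ R, α X ≠ 0})
      have hivt := hpre.intermediate_value (mem_connectedComponentIn hx) hy
        (f := fun z => α x * α z) (continuous_const.mul (hR α hα)).continuousOn
      have hivt2 := hpre.intermediate_value hy (mem_connectedComponentIn hx)
        (f := fun z => α x * α z) (continuous_const.mul (hR α hα)).continuousOn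
      obtain ⟨z, hz, hz0⟩ := hivt2 ⟨hneg, mul_self_nonneg _⟩
      rcases mul_eq_zero.1 hz0 with h | h
      · exact hx α hα h
      · exact connectedComponentIn_subset _ _ hz α hα h
    · intro y hy
      have hpre : IsPreconnected ((fun t : ℝ => x + t • (y - x)) '' Set.Icc 0 1) :=
        isPreconnected_Icc.image _ (hline x (y - x)).continuousOn
      refine hpre.subset_connectedComponentIn ⟨0, by simp, by simp⟩ ?_ ⟨1, by simp, by simp⟩
      rintro _ ⟨t, ⟨ht0, ht1⟩, rfl⟩ α hα h0
      have h1 := hy α hα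
      have h2 : 0 < α x * α x := mul_self_pos.2 (hx α hα)
      have h3 : α x * α (x + t • (y - x)) = (1 - t) * (α x * α x) + t * (α x * α y) := by
        simp only [map_add, map_smul, map_sub, smul_eq_mul]; ring
      simp only at h0
      rw [h0, mul_zero] at h3
      rcases ht1.lt_or_eq with h | h
      · nlinarith [mul_pos (sub_pos.2 h) h2, mul_nonneg ht0 h1.le]
      · rw [h] at h3; linarith
  rw [hcomp]
  apply Set.Subset.antisymm
  · refine closure_minimal (fun y hy α hα => (hy α hα).le) ?_
    have : {y : 𝔟 | ∀ α ∈ R, 0 ≤ α x * α y} = ⋂ α ∈ R, {y | 0 ≤ α x * α y} := by ext; simp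
    rw [this]
    exact isClosed_biInter fun α hα => isClosed_le continuous_const (continuous_const.mul (hR α hα))
  · intro y hy
    have hlim : Tendsto (fun t : ℝ => y + t • x) (𝓝[>] 0) (𝓝 y) := by
      have := (hline y x).tendsto 0
      rw [zero_smul, add_zero] at this
      exact this.mono_left nhdsWithin_le_nhds
    refine mem_closure_of_tendsto hlim ?_
    filter_upwards [self_mem_nhdsWithin] with t ht α hα
    have h2 : 0 < α x * α x := mul_self_pos.2 (hx α hα)
    have h3 : α x * α (y + t • x) = α x * α y + t * (α x * α x) := by
      simp only [map_add, map_smul, smul_eq_mul]; ring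
    rw [h3]
    have := hy α hα
    have := mul_pos (show (0 : ℝ) < t from ht) h2
    linarith

/-- A basis (the columns of `P`) in which both forms are diagonal up to scaling, and `𝔟` is the
space of real traceless diagonal matrices. -/
structure IsFrame (o τ : HermForm d 𝕜) (𝔟 : LieSubalgebra ℝ (Mat d 𝕜)) (P P' : Mat d 𝕜)
    (t s : ℝ) (ε : Fin d → ℝ) : Prop where
  inv : P * P' = 1
  t_pos : 0 < t
  s_pos : 0 < s
  signs : IsSigns ε
  conj_τ : Pᴴ * τ.mat * P = (t : 𝕜) • (1 : Mat d 𝕜)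
  conj_o : Pᴴ * o.mat * P = (s : 𝕜) • diagR 𝕜 ε
  mem_iff : ∀ X, X ∈ 𝔟 ↔ ∃ x : Fin d → ℝ, ∑ i, x i = 0 ∧ X = P * diagR 𝕜 x * P'

theorem HermForm.adj_eq_iff (o : HermForm d 𝕜) (T : Mat d 𝕜) :
    o.adj T = T ↔ Tᴴ * o.mat = o.mat * T := by
  have h1 := Matrix.mul_nonsing_inv _ o.isUnit_det
  have h2 := Matrix.nonsing_inv_mul _ o.isUnit_det
  constructor
  · intro h
    calc Tᴴ * o.mat = (o.mat * o.mat⁻¹) * (Tᴴ * o.mat) := by rw [h1, one_mul]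
      _ = o.mat * o.adj T := by rw [HermForm.adj]; simp only [mul_assoc]
      _ = _ := by rw [h]
  · intro h
    rw [HermForm.adj, mul_assoc, h, ← mul_assoc, h2, one_mul]

theorem HermForm.mem_minusSpace_iff (o : HermForm d 𝕜) (X : Mat d 𝕜) :
    X ∈ o.minusSpace ↔ X.trace = 0 ∧ Xᴴ * o.mat = o.mat * X := by
  rw [← o.adj_eq_iff]
  simp [HermForm.minusSpace, HermForm.dsigma]

theorem dsigma_dsigma (o τ : HermForm d 𝕜) (X : Mat d 𝕜) :
    τ.dsigma (o.dsigma X) = (τ.mat⁻¹ * o.mat) * X * (o.mat⁻¹ * τ.mat) := by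
  simp only [HermForm.dsigma, HermForm.adj, Matrix.conjTranspose_neg, Matrix.conjTranspose_mul,
    Matrix.conjTranspose_nonsing_inv, o.isHermitian.eq, Matrix.conjTranspose_conjTranspose,
    mul_neg, neg_mul, neg_neg, mul_assoc]

/-- Both compositions of the involutions are conjugations, by `J = τ⁻¹ o` and by its inverse.
Commutation makes `J * J` commute with all traceless matrices; the off-diagonal matrix units already
force it to be scalar. -/
theorem HermForm.MemS.exists_sq_eq_smul {o τ : HermForm d 𝕜} (h : o.MemS τ) :
    ∃ z : 𝕜, (τ.mat⁻¹ * o.mat) * (τ.mat⁻¹ * o.mat) = z • (1 : Mat d 𝕜) := by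
  have o1 := Matrix.mul_nonsing_inv _ o.isUnit_det
  have o2 := Matrix.nonsing_inv_mul _ o.isUnit_det
  have t1 := Matrix.mul_nonsing_inv _ τ.isUnit_det
  have t2 := Matrix.nonsing_inv_mul _ τ.isUnit_det
  set J := τ.mat⁻¹ * o.mat with hJ
  set J' := o.mat⁻¹ * τ.mat with hJ'
  have hJJ' : J * J' = 1 := by
    rw [hJ, hJ', mul_assoc, ← mul_assoc o.mat, o1, one_mul, t2]
  have hJ'J : J' * J = 1 := mul_eq_one_comm.1 hJJ'
  have key : ∀ X : Mat d 𝕜, X.trace = 0 → J * J * X = X * (J * J) := by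
    intro X hX
    have h1 := h.2 X hX
    rw [dsigma_dsigma, dsigma_dsigma] at h1
    change J * X * J' = J' * X * J at h1
    calc J * J * X = J * (J * X * J') * J := by
          simp only [mul_assoc]; rw [hJ'J, mul_one]
      _ = (J * J') * X * (J * J) := by rw [h1]; simp only [mul_assoc]
      _ = _ := by rw [hJJ', one_mul]
  obtain ⟨z, hz⟩ := Matrix.mem_range_scalar_of_commute_single (M := J * J) (by
    intro i j hij
    refine (key _ ?_).symm
    exact Matrix.trace_single_eq_of_ne i j _ hij)
  refine ⟨z, ?_⟩
  rw [← hz, Matrix.smul_one_eq_diagonal]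
  rfl

theorem exists_orthonormal (τ : HermForm d 𝕜) (h : ∀ v, v ≠ 0 → 0 < RCLike.re (τ.form v v)) :
    ∃ P : Mat d 𝕜, Pᴴ * τ.mat * P = 1 := by
  obtain ⟨U, x, hU, -, hx⟩ := exists_unitary_diag τ.isHermitian
  have hUx : Uᴴ * τ.mat * U = diagR 𝕜 x := by
    rw [mul_assoc, hx, ← mul_assoc, hU, one_mul]
  have hpos : ∀ i, 0 < x i := by
    intro i
    have h1 := h (fun k => U k i) (fun h0 => by
      have := congrFun (congrFun hU i) i
      rw [Matrix.mul_apply, Matrix.one_apply_eq, Finset.sum_eq_zero] at this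
      · exact zero_ne_one this
      · intro k _
        rw [show U k i = 0 from congrFun h0 k, mul_zero])
    have h2 : τ.form (fun k => U k i) (fun k => U k i) = (Uᴴ * τ.mat * U) i i := by
      rw [mul_assoc, Matrix.mul_apply]
      rfl
    rw [h2, hUx, diagR_apply, if_pos rfl, RCLike.ofReal_re] at h1
    exact h1
  refine ⟨U * diagR 𝕜 fun i => (Real.sqrt (x i))⁻¹, ?_⟩
  have : (U * diagR 𝕜 fun i => (Real.sqrt (x i))⁻¹)ᴴ * τ.mat * (U * diagR 𝕜 fun i => (Real.sqrt (x i))⁻¹)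
      = (diagR 𝕜 fun i => (Real.sqrt (x i))⁻¹) * (Uᴴ * τ.mat * U) * (diagR 𝕜 fun i => (Real.sqrt (x i))⁻¹) := by
    rw [Matrix.conjTranspose_mul, diagR_conjTranspose]; simp only [mul_assoc]
  rw [this, hUx, diagR_mul, diagR_mul, ← diagR_one]
  congr 1; funext i
  have h2 : Real.sqrt (x i) * Real.sqrt (x i) = x i := Real.mul_self_sqrt (hpos i).le
  have h3 := (Real.sqrt_pos.2 (hpos i)).ne'
  simp only [Pi.mul_apply, Pi.one_apply]
  field_simp
  linarith

/-- Elements of 𝔟 are self-adjoint for both forms, and the bracket of two of them is both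
self-adjoint and anti-self-adjoint, hence zero. So 𝔟 and the operator comparing the two forms have a
common orthonormal eigenbasis. The real traceless diagonal matrices in this basis form an abelian
subalgebra of the same kind containing 𝔟, and maximality gives equality. -/
theorem exists_isFrame (i0 : Fin d) {o τ : HermForm d 𝕜} (hτ : o.MemS τ)
    {𝔟 : LieSubalgebra ℝ (Mat d 𝕜)} (h𝔟 : IsMaximalSubalgebra o τ 𝔟) :
    ∃ P P' t s ε, IsFrame o τ 𝔟 P P' t s ε := by
  have o1 := Matrix.mul_nonsing_inv _ o.isUnit_det
  have t1 := Matrix.mul_nonsing_inv _ τ.isUnit_det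
  have t2 := Matrix.nonsing_inv_mul _ τ.isUnit_det
  obtain ⟨z, hz⟩ := hτ.exists_sq_eq_smul
  obtain ⟨P1, hP1⟩ := exists_orthonormal τ hτ.1
  have hP1' : P1 * (P1ᴴ * τ.mat) = 1 := mul_eq_one_comm.1 hP1
  have hmemτ : ∀ X ∈ 𝔟, Xᴴ * τ.mat = τ.mat * X := fun X hX =>
    ((τ.mem_minusSpace_iff X).1 (h𝔟.prop hX).1).2
  have hmemo : ∀ X ∈ 𝔟, Xᴴ * o.mat = o.mat * X := fun X hX =>
    ((o.mem_minusSpace_iff X).1 (h𝔟.prop hX).2).2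
  have htr : ∀ X ∈ 𝔟, X.trace = 0 := fun X hX => ((τ.mem_minusSpace_iff X).1 (h𝔟.prop hX).1).1
  have hcomm : ∀ X ∈ 𝔟, ∀ Y ∈ 𝔟, X * Y = Y * X := by
    intro X hX Y hY
    have h1 : ⁅X, Y⁆ ∈ 𝔟 := 𝔟.lie_mem hX hY
    have h2 := hmemτ _ h1
    have h5 : ∀ X ∈ 𝔟, ∀ Y ∈ 𝔟, (X * Y)ᴴ * τ.mat = τ.mat * (Y * X) := by
      intro X hX Y hY
      rw [Matrix.conjTranspose_mul, mul_assoc, hmemτ X hX, ← mul_assoc, hmemτ Y hY, mul_assoc]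
    rw [Ring.lie_def, Matrix.conjTranspose_sub, sub_mul, mul_sub, h5 X hX Y hY, h5 Y hY X hX,
      sub_eq_sub_iff_add_eq_add] at h2
    have h3 : (2 : 𝕜) • (τ.mat * (X * Y)) = (2 : 𝕜) • (τ.mat * (Y * X)) := by
      rw [two_smul, two_smul, h2]
    have h4 := smul_right_injective _ (two_ne_zero' 𝕜) h3
    have := congrArg (fun M => τ.mat⁻¹ * M) h4
    simpa only [← mul_assoc, t2, one_mul] using this
  -- Matrices of o and of the elements of 𝔟 in a τ-orthonormal basis: a commuting family of
  -- Hermitian matrices.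
  set S : Set (Mat d 𝕜) := insert (P1ᴴ * o.mat * P1) ((fun X => P1ᴴ * τ.mat * X * P1) '' (𝔟 : Set (Mat d 𝕜)))
    with hS
  have hSh : ∀ M ∈ S, M.IsHermitian := by
    rintro M (rfl | ⟨X, hX, rfl⟩)
    · exact Matrix.isHermitian_conjTranspose_mul_mul P1 o.isHermitian
    · have h1 := hmemτ X hX
      rw [Matrix.IsHermitian]
      simp only [Matrix.conjTranspose_mul, Matrix.conjTranspose_conjTranspose, τ.isHermitian.eq]
      have h2 : P1ᴴ * (Xᴴ * (τ.mat * P1)) = P1ᴴ * ((Xᴴ * τ.mat) * P1) := by simp only [mul_assoc]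
      rw [h2, h1]; simp only [mul_assoc]
  have hXJ : ∀ X ∈ 𝔟, X * (P1 * P1ᴴ) * o.mat = (P1 * P1ᴴ) * o.mat * X := by
    intro X hX
    have e : P1 * P1ᴴ = τ.mat⁻¹ := by
      rw [← mul_one (P1 * P1ᴴ), ← t1, ← mul_assoc, mul_assoc P1, hP1', one_mul]
    rw [e]
    have h1 : X * τ.mat⁻¹ = τ.mat⁻¹ * Xᴴ := by
      calc X * τ.mat⁻¹ = (τ.mat⁻¹ * τ.mat) * X * τ.mat⁻¹ := by rw [t2, one_mul]
        _ = τ.mat⁻¹ * (Xᴴ * τ.mat) * τ.mat⁻¹ := by rw [hmemτ X hX]; simp only [mul_assoc]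
        _ = _ := by rw [mul_assoc, mul_assoc, t1, mul_one]
    rw [h1, mul_assoc, hmemo X hX, mul_assoc]
  have hSc : ∀ M ∈ S, ∀ N ∈ S, M * N = N * M := by
    have hXo : ∀ X ∈ 𝔟, (P1ᴴ * o.mat * P1) * (P1ᴴ * τ.mat * X * P1)
        = (P1ᴴ * τ.mat * X * P1) * (P1ᴴ * o.mat * P1) := by
      intro X hX
      calc (P1ᴴ * o.mat * P1) * (P1ᴴ * τ.mat * X * P1)
          = P1ᴴ * o.mat * (P1 * (P1ᴴ * τ.mat)) * X * P1 := by simp only [mul_assoc]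
        _ = P1ᴴ * τ.mat * ((P1 * P1ᴴ) * o.mat * X) * P1 := by
            rw [hP1', mul_one]
            have : P1ᴴ * τ.mat * (P1 * P1ᴴ * o.mat * X) * P1
              = (P1ᴴ * τ.mat * P1) * P1ᴴ * o.mat * X * P1 := by simp only [mul_assoc]
            rw [this, hP1, one_mul]
        _ = _ := by rw [← hXJ X hX]; simp only [mul_assoc]
    have hXY : ∀ X Y : Mat d 𝕜, (P1ᴴ * τ.mat * X * P1) * (P1ᴴ * τ.mat * Y * P1)
        = P1ᴴ * τ.mat * (X * Y) * P1 := by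
      intro X Y
      calc (P1ᴴ * τ.mat * X * P1) * (P1ᴴ * τ.mat * Y * P1)
          = P1ᴴ * τ.mat * X * (P1 * (P1ᴴ * τ.mat)) * Y * P1 := by simp only [mul_assoc]
        _ = _ := by rw [hP1', mul_one]; simp only [mul_assoc]
    rintro M (rfl | ⟨X, hX, rfl⟩) N (rfl | ⟨Y, hY, rfl⟩)
    · rfl
    · exact hXo Y hY
    · exact (hXo X hX).symm
    · change (P1ᴴ * τ.mat * X * P1) * (P1ᴴ * τ.mat * Y * P1)
        = (P1ᴴ * τ.mat * Y * P1) * (P1ᴴ * τ.mat * X * P1)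
      rw [hXY, hXY, hcomm X hX Y hY]
  obtain ⟨U, hU, hUS⟩ := exists_simultaneous_diag S hSh hSc
  set P := P1 * U with hP
  obtain ⟨P', hP'⟩ : ∃ P', P' = Pᴴ * τ.mat := ⟨_, rfl⟩
  have hPτ : Pᴴ * τ.mat * P = 1 := by
    calc Pᴴ * τ.mat * P = Uᴴ * (P1ᴴ * τ.mat * P1) * U := by
          rw [hP, Matrix.conjTranspose_mul]; simp only [mul_assoc]
      _ = 1 := by rw [hP1, mul_one, hU]
  have hPP' : P * P' = 1 := by rw [hP']; exact mul_eq_one_comm.1 hPτ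
  have hP'P : P' * P = 1 := by rw [hP', hPτ]
  obtain ⟨lam, hlam⟩ := hUS _ (Set.mem_insert _ _)
  have hPo : Pᴴ * o.mat * P = diagR 𝕜 lam := by
    calc Pᴴ * o.mat * P = Uᴴ * ((P1ᴴ * o.mat * P1) * U) := by
          rw [hP, Matrix.conjTranspose_mul]; simp only [mul_assoc]
      _ = _ := by rw [hlam, ← mul_assoc, hU, one_mul]
  have hX : ∀ X ∈ 𝔟, ∃ x : Fin d → ℝ, X = P * diagR 𝕜 x * P' := by
    intro X hX
    obtain ⟨x, hx⟩ := hUS _ (Set.mem_insert_of_mem _ ⟨X, hX, rfl⟩)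
    refine ⟨x, ?_⟩
    have h1 : P' * X * P = diagR 𝕜 x := by
      calc P' * X * P = Uᴴ * ((P1ᴴ * τ.mat * X * P1) * U) := by
            rw [hP', hP, Matrix.conjTranspose_mul]; simp only [mul_assoc]
        _ = _ := by rw [hx, ← mul_assoc, hU, one_mul]
    rw [← h1]
    calc X = (P * P') * X * (P * P') := by rw [hPP', one_mul, mul_one]
      _ = _ := by simp only [mul_assoc]
  -- The square of the comparison operator is scalar, so its eigenvalues share one modulus, which
  -- becomes the scale `s` and leaves only signs.
  have hlam2 : ∀ i, ((lam i * lam i : ℝ) : 𝕜) = z := by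
    intro i
    have h1 : diagR 𝕜 lam * diagR 𝕜 lam = z • (1 : Mat d 𝕜) := by
      have h2 : diagR 𝕜 lam = P' * (τ.mat⁻¹ * o.mat) * P := by
        rw [← hPo, hP']
        calc Pᴴ * o.mat * P = Pᴴ * (τ.mat * τ.mat⁻¹) * o.mat * P := by rw [t1, mul_one]
          _ = _ := by simp only [mul_assoc]
      calc diagR 𝕜 lam * diagR 𝕜 lam
          = P' * (τ.mat⁻¹ * o.mat) * (P * P') * (τ.mat⁻¹ * o.mat) * P := by
            rw [h2]; simp only [mul_assoc]
        _ = P' * ((τ.mat⁻¹ * o.mat) * (τ.mat⁻¹ * o.mat)) * P := by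
            rw [hPP', mul_one]; simp only [mul_assoc]
        _ = _ := by rw [hz, Matrix.mul_smul, Matrix.smul_mul, mul_one, hP'P]
    have h3 := congrFun (congrFun h1 i) i
    rw [diagR_mul, diagR_apply, if_pos rfl] at h3
    simpa using h3
  have hlam0 : ∀ i, lam i ≠ 0 := by
    intro i hi
    have h1 := congrArg Matrix.det hPo
    rw [diagR, Matrix.det_diagonal, Finset.prod_eq_zero (Finset.mem_univ i) (by rw [hi]; simp),
      Matrix.det_mul, Matrix.det_mul, Matrix.det_conjTranspose] at h1
    have hdP : P.det ≠ 0 := by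
      intro h0
      have := congrArg Matrix.det hPP'
      rw [Matrix.det_mul, h0, zero_mul, Matrix.det_one] at this
      exact zero_ne_one this
    exact mul_ne_zero (mul_ne_zero (star_ne_zero.2 hdP) o.isUnit_det.ne_zero) hdP h1
  have hlamabs : ∀ i, |lam i| = |lam i0| := by
    intro i
    have h1 : lam i * lam i = lam i0 * lam i0 := by
      have := (hlam2 i).trans (hlam2 i0).symm
      exact_mod_cast this
    exact (abs_eq_abs.2 (mul_self_eq_mul_self_iff.1 h1))
  have hs0 : 0 < |lam i0| := abs_pos.2 (hlam0 i0)
  -- The only place where maximality of 𝔟 enters.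
  have hsubset : ∀ x : Fin d → ℝ, ∑ i, x i = 0 → P * diagR 𝕜 x * P' ∈ 𝔟 := by
    set 𝔠 : LieSubalgebra ℝ (Mat d 𝕜) :=
      { carrier := {X | ∃ x : Fin d → ℝ, ∑ i, x i = 0 ∧ X = P * diagR 𝕜 x * P'}
        add_mem' := by
          rintro _ _ ⟨x, hx, rfl⟩ ⟨y, hy, rfl⟩
          refine ⟨x + y, by simp [Finset.sum_add_distrib, hx, hy], ?_⟩
          rw [← add_mul, ← mul_add]
          congr 2
          ext i j
          simp only [Matrix.add_apply, diagR_apply, Pi.add_apply]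
          split_ifs <;> simp
        zero_mem' := ⟨0, by simp, by
          have : diagR 𝕜 (0 : Fin d → ℝ) = 0 := by ext i j; simp [diagR_apply]
          rw [this]; simp⟩
        smul_mem' := by
          rintro c _ ⟨x, hx, rfl⟩
          refine ⟨c • x, by simp [← Finset.mul_sum, hx], ?_⟩
          rw [← Matrix.smul_mul, ← Matrix.mul_smul]
          congr 2
          ext i j
          simp only [Matrix.smul_apply, diagR_apply, Pi.smul_apply]
          split_ifs <;> simp [RCLike.real_smul_eq_coe_mul]
        lie_mem' := by
          rintro _ _ ⟨x, hx, rfl⟩ ⟨y, hy, rfl⟩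
          refine ⟨0, by simp, ?_⟩
          have h0 : diagR 𝕜 (0 : Fin d → ℝ) = 0 := by ext i j; simp [diagR_apply]
          have h1 : ∀ x y : Fin d → ℝ, P * diagR 𝕜 x * P' * (P * diagR 𝕜 y * P')
              = P * diagR 𝕜 (x * y) * P' := by
            intro x y
            calc P * diagR 𝕜 x * P' * (P * diagR 𝕜 y * P')
                = P * diagR 𝕜 x * (P' * P) * diagR 𝕜 y * P' := by simp only [mul_assoc]
              _ = _ := by rw [hP'P, mul_one, mul_assoc P, diagR_mul]
          rw [Ring.lie_def, h1, h1, mul_comm, sub_self, h0]; simp } with h𝔠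
    have h1 : (𝔟 : Set (Mat d 𝕜)) ⊆ 𝔠 := by
      intro X hXb
      obtain ⟨x, rfl⟩ := hX X hXb
      refine ⟨x, ?_, rfl⟩
      have := htr _ hXb
      rw [mul_assoc, Matrix.trace_mul_comm, mul_assoc, hP'P, mul_one, diagR,
        Matrix.trace_diagonal] at this
      exact_mod_cast this
    have hPP'h : P'ᴴ * Pᴴ = 1 := by
      rw [← Matrix.conjTranspose_mul, hPP', Matrix.conjTranspose_one]
    have hP'Ph : Pᴴ * P'ᴴ = 1 := mul_eq_one_comm.1 hPP'h
    have hform : ∀ (F : Mat d 𝕜) (y : Fin d → ℝ), Pᴴ * F * P = diagR 𝕜 y → ∀ x : Fin d → ℝ,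
        (P * diagR 𝕜 x * P')ᴴ * F = F * (P * diagR 𝕜 x * P') := by
      intro F y hF x
      have hF' : F = P'ᴴ * diagR 𝕜 y * P' := by
        rw [← hF]
        calc F = (P'ᴴ * Pᴴ) * F * (P * P') := by rw [hPP', hPP'h, one_mul, mul_one]
          _ = _ := by simp only [mul_assoc]
      rw [hF', Matrix.conjTranspose_mul, Matrix.conjTranspose_mul, diagR_conjTranspose]
      calc P'ᴴ * (diagR 𝕜 x * Pᴴ) * (P'ᴴ * diagR 𝕜 y * P')
          = P'ᴴ * diagR 𝕜 x * (Pᴴ * P'ᴴ) * diagR 𝕜 y * P' := by simp only [mul_assoc]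
        _ = P'ᴴ * (diagR 𝕜 y * diagR 𝕜 x) * P' := by
            rw [hP'Ph, mul_one, mul_assoc P'ᴴ, diagR_mul, diagR_mul, mul_comm x y]
        _ = P'ᴴ * diagR 𝕜 y * (P' * P) * diagR 𝕜 x * P' := by
            rw [hP'P, mul_one]; simp only [mul_assoc]
        _ = _ := by simp only [mul_assoc]
    have h2 : (𝔠 : Set (Mat d 𝕜)) ⊆ τ.minusSpace ∩ o.minusSpace := by
      rintro _ ⟨x, hx, rfl⟩
      have htr : (P * diagR 𝕜 x * P').trace = 0 := by
        rw [mul_assoc, Matrix.trace_mul_comm, mul_assoc, hP'P, mul_one, diagR,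
          Matrix.trace_diagonal]
        exact_mod_cast hx
      refine ⟨(τ.mem_minusSpace_iff _).2 ⟨htr, hform _ 1 ?_ x⟩,
        (o.mem_minusSpace_iff _).2 ⟨htr, hform _ _ hPo x⟩⟩
      rw [hPτ, diagR_one]
    intro x hx
    exact h𝔟.le_of_ge h2 h1 ⟨x, hx, rfl⟩
  refine ⟨P, P', 1, |lam i0|, fun i => lam i / |lam i0|, hPP', one_pos, hs0, ?_, ?_, ?_, ?_⟩
  · intro i
    refine (abs_eq zero_le_one).1 ?_
    rw [abs_div, abs_abs, hlamabs, div_self hs0.ne']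
  · simpa using hPτ
  · rw [hPo]
    ext i j
    rw [Matrix.smul_apply, diagR_apply, diagR_apply]
    split_ifs
    · rw [smul_eq_mul, ← RCLike.ofReal_mul, mul_div_cancel₀ _ hs0.ne']
    · simp
  · intro X
    constructor
    · intro hXb
      obtain ⟨x, hx⟩ := hX X hXb
      refine ⟨x, ?_, hx⟩
      have := htr _ hXb
      rw [hx, mul_assoc, Matrix.trace_mul_comm, mul_assoc, hP'P, mul_one, diagR,
        Matrix.trace_diagonal] at this
      exact_mod_cast this
    · rintro ⟨x, hx, rfl⟩
      exact hsubset x hx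

/-! ### Coordinates on 𝔟, restricted roots and Weyl chambers in a frame -/

section Coordinates

variable {𝔟 : LieSubalgebra ℝ (Mat d 𝕜)}

/-- The coordinates of an element of `𝔟` in a frame. -/
def coord (P P' : Mat d 𝕜) : 𝔟 →ₗ[ℝ] (Fin d → ℝ) where
  toFun X i := RCLike.re ((P' * (X : Mat d 𝕜) * P) i i)
  map_add' X Y := by
    funext i
    simp [mul_add, add_mul]
  map_smul' c X := by
    funext i
    simp [RCLike.real_smul_eq_coe_mul]

theorem continuous_coord (P P' : Mat d 𝕜) (i : Fin d) :
    Continuous fun X : 𝔟 => coord P P' X i := by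
  refine RCLike.continuous_re.comp ?_
  have h : Continuous fun X : 𝔟 => (X : Mat d 𝕜) := continuous_subtype_val
  exact ((continuous_const.matrix_mul h).matrix_mul continuous_const).matrix_elem i i

variable {o τ : HermForm d 𝕜} {P P' : Mat d 𝕜} {t s : ℝ} {ε : Fin d → ℝ}

namespace IsFrame

theorem inv' (hF : IsFrame o τ 𝔟 P P' t s ε) : P' * P = 1 := mul_eq_one_comm.1 hF.inv

theorem conj_diagR (hF : IsFrame o τ 𝔟 P P' t s ε) (M : Mat d 𝕜) : P' * (P * M * P') * P = M := by
  calc P' * (P * M * P') * P = (P' * P) * M * (P' * P) := by simp only [mul_assoc]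
    _ = M := by rw [hF.inv', one_mul, mul_one]

theorem coord_eq (hF : IsFrame o τ 𝔟 P P' t s ε) {X : 𝔟} {x : Fin d → ℝ}
    (h : (X : Mat d 𝕜) = P * diagR 𝕜 x * P') : coord P P' X = x := by
  funext i
  change RCLike.re ((P' * (X : Mat d 𝕜) * P) i i) = x i
  rw [h, hF.conj_diagR, diagR_apply, if_pos rfl, RCLike.ofReal_re]

theorem eq_coord (hF : IsFrame o τ 𝔟 P P' t s ε) (X : 𝔟) :
    (X : Mat d 𝕜) = P * diagR 𝕜 (coord P P' X) * P' := by
  obtain ⟨x, -, hx⟩ := (hF.mem_iff _).1 X.2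
  rw [hF.coord_eq hx]; exact hx

theorem sum_coord (hF : IsFrame o τ 𝔟 P P' t s ε) (X : 𝔟) : ∑ i, coord P P' X i = 0 := by
  obtain ⟨x, hx0, hx⟩ := (hF.mem_iff _).1 X.2
  rw [hF.coord_eq hx]; exact hx0

theorem exists_coord (hF : IsFrame o τ 𝔟 P P' t s ε) {x : Fin d → ℝ} (hx : ∑ i, x i = 0) :
    ∃ X : 𝔟, coord P P' X = x :=
  ⟨⟨P * diagR 𝕜 x * P', (hF.mem_iff _).2 ⟨x, hx, rfl⟩⟩, hF.coord_eq rfl⟩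

theorem coord_injective (hF : IsFrame o τ 𝔟 P P' t s ε) {X Y : 𝔟}
    (h : coord P P' X = coord P P' Y) : X = Y := by
  apply Subtype.ext
  rw [hF.eq_coord X, hF.eq_coord Y, h]

theorem exists_coord_sub_ne (hF : IsFrame o τ 𝔟 P P' t s ε) {i j : Fin d} (hij : i ≠ j) :
    ∃ X : 𝔟, coord P P' X i - coord P P' X j = 2 := by
  obtain ⟨X, hX⟩ := hF.exists_coord (x := Pi.single i 1 - Pi.single j 1) (by simp)
  refine ⟨X, ?_⟩
  rw [hX]
  simp [hij, hij.symm]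
  norm_num

theorem lie_conj (hF : IsFrame o τ 𝔟 P P' t s ε) (X : 𝔟) (Y : Mat d 𝕜) (i j : Fin d) :
    (P' * ⁅(X : Mat d 𝕜), Y⁆ * P) i j
      = ((coord P P' X i - coord P P' X j : ℝ) : 𝕜) * (P' * Y * P) i j := by
  have h : P' * ⁅(X : Mat d 𝕜), Y⁆ * P = diagR 𝕜 (coord P P' X) * (P' * Y * P)
      - (P' * Y * P) * diagR 𝕜 (coord P P' X) := by
    rw [Ring.lie_def, mul_sub, sub_mul]
    congr 1
    · conv_lhs => rw [hF.eq_coord X]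
      calc P' * (P * diagR 𝕜 (coord P P' X) * P' * Y) * P
          = (P' * P) * diagR 𝕜 (coord P P' X) * (P' * Y * P) := by simp only [mul_assoc]
        _ = _ := by rw [hF.inv', one_mul]
    · conv_lhs => rw [hF.eq_coord X]
      calc P' * (Y * (P * diagR 𝕜 (coord P P' X) * P')) * P
          = (P' * Y * P) * diagR 𝕜 (coord P P' X) * (P' * P) := by simp only [mul_assoc]
        _ = _ := by rw [hF.inv', mul_one]
  rw [h, Matrix.sub_apply, diagR, Matrix.diagonal_mul, Matrix.mul_diagonal]
  push_cast; ring

theorem trace_conj (hF : IsFrame o τ 𝔟 P P' t s ε) (Y : Mat d 𝕜) :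
    (P * Y * P').trace = Y.trace := by
  rw [Matrix.trace_mul_comm, ← mul_assoc, hF.inv', one_mul]

theorem conj_conj (hF : IsFrame o τ 𝔟 P P' t s ε) (Y : Mat d 𝕜) : P * (P' * Y * P) * P' = Y := by
  calc P * (P' * Y * P) * P' = (P * P') * Y * (P * P') := by simp only [mul_assoc]
    _ = Y := by rw [hF.inv, one_mul, mul_one]

/-- The root `e_i - e_j` is a restricted root in `𝔰` if `𝔰` contains the root vector. -/
theorem root_mem (hF : IsFrame o τ 𝔟 P P' t s ε) {𝔰 : Set (Mat d 𝕜)} {i j : Fin d} (hij : i ≠ j)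
    (h : P * Matrix.single i j 1 * P' ∈ 𝔰) {α : Module.Dual ℝ 𝔟}
    (hα : ∀ X, α X = coord P P' X i - coord P P' X j) : α ∈ restrictedRoots 𝔟 𝔰 := by
  refine ⟨?_, _, h, ?_, ?_⟩
  · rintro rfl
    obtain ⟨X, hX⟩ := hF.exists_coord_sub_ne hij
    have := hα X
    rw [hX] at this
    simp at this
  · intro h0
    have := hF.conj_diagR (Matrix.single i j (1 : 𝕜))
    rw [h0] at this
    have := congrFun (congrFun this i) j
    simp at this
  · intro X
    have h2 : P' * ⁅(X : Mat d 𝕜), P * Matrix.single i j (1 : 𝕜) * P'⁆ * P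
        = α X • Matrix.single i j (1 : 𝕜) := by
      ext k l
      rw [hF.lie_conj, hF.conj_diagR, hα, Matrix.smul_apply, RCLike.real_smul_eq_coe_mul]
      by_cases hkl : i = k ∧ j = l
      · rw [hkl.1, hkl.2]
      · rw [Matrix.single_apply_of_ne _ _ _ _ _ hkl]; simp
    rw [← hF.conj_conj ⁅(X : Mat d 𝕜), _⁆, h2, Matrix.mul_smul, Matrix.smul_mul]

/-- Read the root equation at a nonzero matrix entry of the root vector. -/
theorem exists_of_root (hF : IsFrame o τ 𝔟 P P' t s ε) {𝔰 : Set (Mat d 𝕜)} {α : Module.Dual ℝ 𝔟}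
    (hα : α ∈ restrictedRoots 𝔟 𝔰) : ∃ Y ∈ 𝔰, ∃ i j, i ≠ j ∧ (P' * Y * P) i j ≠ 0 ∧
      ∀ X, α X = coord P P' X i - coord P P' X j := by
  obtain ⟨hα0, Y, hY, hY0, hlie⟩ := hα
  have hne : P' * Y * P ≠ 0 := by
    intro h0
    apply hY0
    rw [← hF.conj_conj Y, h0]; simp
  obtain ⟨i, j, hij⟩ : ∃ i j, (P' * Y * P) i j ≠ 0 := by
    by_contra! h
    exact hne (by ext i j; exact h i j)
  have hαX : ∀ X, α X = coord P P' X i - coord P P' X j := by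
    intro X
    have h1 := hF.lie_conj X Y i j
    rw [hlie X, Matrix.mul_smul, Matrix.smul_mul, Matrix.smul_apply,
      RCLike.real_smul_eq_coe_mul] at h1
    exact_mod_cast mul_right_cancel₀ hij h1
  refine ⟨Y, hY, i, j, ?_, hij, hαX⟩
  rintro rfl
  apply hα0
  apply LinearMap.ext
  intro X
  rw [hαX]; simp

theorem root_lieG (hF : IsFrame o τ 𝔟 P P' t s ε) {i j : Fin d} (hij : i ≠ j)
    {α : Module.Dual ℝ 𝔟} (hα : ∀ X, α X = coord P P' X i - coord P P' X j) :
    α ∈ restrictedRoots 𝔟 (lieG d 𝕜) := by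
  refine hF.root_mem hij ?_ hα
  change (P * Matrix.single i j 1 * P').trace = 0
  rw [hF.trace_conj, Matrix.trace_single_eq_of_ne i j _ hij]

/-- In the frame the involution is conjugation by the sign matrix, so its fixed algebra is block
diagonal for the sign classes. This is why its roots only compare coordinates of equal sign. -/
theorem involution_eq (hF : IsFrame o τ 𝔟 P P' t s ε) (Y : Mat d 𝕜) :
    τ.dsigma (o.dsigma Y) = P * (diagR 𝕜 ε * (P' * Y * P) * diagR 𝕜 ε) * P' := by
  have ht : (t : 𝕜) ≠ 0 := by exact_mod_cast hF.t_pos.ne'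
  have hs : (s : 𝕜) ≠ 0 := by exact_mod_cast hF.s_pos.ne'
  have o1 := Matrix.mul_nonsing_inv _ o.isUnit_det
  have t1 := Matrix.nonsing_inv_mul _ τ.isUnit_det
  have h1 : τ.mat⁻¹ * o.mat = ((s : 𝕜) / t) • (P * diagR 𝕜 ε * P') := by
    have e : o.mat * P = ((s : 𝕜) / t) • (τ.mat * P * diagR 𝕜 ε) := by
      have hu : IsUnit (Pᴴ).det := by
        rw [Matrix.det_conjTranspose]
        have := congrArg Matrix.det hF.inv
        rw [Matrix.det_mul, Matrix.det_one] at this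
        exact (IsUnit.of_mul_eq_one _ this).star
      have h2 : Pᴴ * (o.mat * P) = Pᴴ * (((s : 𝕜) / t) • (τ.mat * P * diagR 𝕜 ε)) := by
        rw [← mul_assoc, hF.conj_o, Matrix.mul_smul, ← mul_assoc, ← mul_assoc, hF.conj_τ,
          Matrix.smul_mul, one_mul, smul_smul, div_mul_cancel₀ _ ht]
      have h3 := congrArg (fun M => (Pᴴ)⁻¹ * M) h2
      simpa only [← mul_assoc, Matrix.nonsing_inv_mul _ hu, one_mul] using h3
    calc τ.mat⁻¹ * o.mat = τ.mat⁻¹ * (o.mat * P) * P' := by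
          rw [← mul_assoc, mul_assoc _ P, hF.inv, mul_one]
      _ = _ := by
          rw [e, Matrix.mul_smul, Matrix.smul_mul, ← mul_assoc, ← mul_assoc, t1, one_mul]
  have h2 : o.mat⁻¹ * τ.mat = ((t : 𝕜) / s) • (P * diagR 𝕜 ε * P') := by
    have e1 : (τ.mat⁻¹ * o.mat) * (o.mat⁻¹ * τ.mat) = 1 := by
      rw [mul_assoc, ← mul_assoc o.mat, o1, one_mul, t1]
    have e2 : (((t : 𝕜) / s) • (P * diagR 𝕜 ε * P')) * (τ.mat⁻¹ * o.mat) = 1 := by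
      rw [h1, Matrix.smul_mul, Matrix.mul_smul, smul_smul]
      have : P * diagR 𝕜 ε * P' * (P * diagR 𝕜 ε * P') = 1 := by
        calc P * diagR 𝕜 ε * P' * (P * diagR 𝕜 ε * P')
            = P * diagR 𝕜 ε * (P' * P) * diagR 𝕜 ε * P' := by simp only [mul_assoc]
          _ = _ := by
            rw [hF.inv', mul_one, mul_assoc P, hF.signs.diagR_mul_self, mul_one, hF.inv]
      rw [this]
      have : (t : 𝕜) / s * (s / t) = 1 := by field_simp
      rw [this, one_smul]
    calc o.mat⁻¹ * τ.mat = ((((t : 𝕜) / s) • (P * diagR 𝕜 ε * P')) * (τ.mat⁻¹ * o.mat))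
          * (o.mat⁻¹ * τ.mat) := by rw [e2, one_mul]
      _ = _ := by rw [mul_assoc, e1, mul_one]
  rw [dsigma_dsigma, h1, h2]
  simp only [Matrix.smul_mul, Matrix.mul_smul, smul_smul]
  have : (t : 𝕜) / s * (s / t) = 1 := by field_simp
  rw [this, one_smul]
  simp only [mul_assoc]

theorem root_lieGTauO (hF : IsFrame o τ 𝔟 P P' t s ε) {i j : Fin d} (hij : i ≠ j)
    (hε : ε i = ε j) {α : Module.Dual ℝ 𝔟} (hα : ∀ X, α X = coord P P' X i - coord P P' X j) :
    α ∈ restrictedRoots 𝔟 (lieGTauO o τ) := by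
  have htr : (P * Matrix.single i j 1 * P').trace = 0 := by
    rw [hF.trace_conj, Matrix.trace_single_eq_of_ne i j _ hij]
  refine hF.root_mem hij (show P * Matrix.single i j 1 * P' ∈ lieGTauO o τ from ⟨htr, ?_⟩) hα
  · rw [hF.involution_eq, hF.conj_diagR]
    congr 2
    ext k l
    rw [diagR, Matrix.mul_diagonal, Matrix.diagonal_mul]
    by_cases hkl : i = k ∧ j = l
    · rw [← hkl.1, ← hkl.2, hε]
      have := hF.signs.mul_self j
      have h2 : (ε j : 𝕜) * ε j = 1 := by exact_mod_cast this
      simp [h2]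
    · rw [Matrix.single_apply_of_ne _ _ _ _ _ hkl]; simp

theorem exists_of_root_lieGTauO (hF : IsFrame o τ 𝔟 P P' t s ε) {α : Module.Dual ℝ 𝔟}
    (hα : α ∈ restrictedRoots 𝔟 (lieGTauO o τ)) :
    ∃ i j, i ≠ j ∧ ε i = ε j ∧ ∀ X, α X = coord P P' X i - coord P P' X j := by
  obtain ⟨Y, hY, i, j, hij, hYij, hX⟩ := hF.exists_of_root hα
  refine ⟨i, j, hij, ?_, hX⟩
  have h1 := hY.2
  rw [hF.involution_eq] at h1
  have h2 := hF.conj_diagR (diagR 𝕜 ε * (P' * Y * P) * diagR 𝕜 ε)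
  rw [h1] at h2
  have h3 := congrFun (congrFun h2 i) j
  rw [diagR, Matrix.mul_diagonal, Matrix.diagonal_mul] at h3
  have h4 : (ε i * ε j : 𝕜) = 1 := by
    apply mul_right_cancel₀ hYij
    rw [one_mul]
    conv_rhs => rw [h3]
    ring
  have h5 : ε i * ε j = 1 := by exact_mod_cast h4
  rcases hF.signs i with h | h <;> rcases hF.signs j with h' | h' <;> rw [h, h'] at h5 ⊢ <;>
    norm_num at h5

/-- The difference of two coordinates. -/
theorem exists_dual (i j : Fin d) : ∃ α : Module.Dual ℝ 𝔟,
    ∀ X, α X = coord P P' X i - coord P P' X j :=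
  ⟨((LinearMap.proj i : (Fin d → ℝ) →ₗ[ℝ] ℝ) - LinearMap.proj j).comp (coord P P'), fun _ => rfl⟩

/-- The root hyperplanes are all the equalities between two coordinates, so a chamber amounts to a
total order of the coordinates, here that of an interior point. -/
theorem weylChamber_lieG (hF : IsFrame o τ 𝔟 P P' t s ε) {S : Set 𝔟}
    (hS : IsWeylChamber (restrictedRoots 𝔟 (lieG d 𝕜)) S) :
    ∃ x : 𝔟, Function.Injective (coord P P' x) ∧
      S = {y | ∀ i j, coord P P' x j ≤ coord P P' x i → coord P P' y j ≤ coord P P' y i} := by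
  obtain ⟨x, hx, rfl⟩ := weylChamber_eq (fun α hα => by
    obtain ⟨Y, -, i, j, -, -, h⟩ := hF.exists_of_root hα
    have : (α : 𝔟 → ℝ) = fun X => coord P P' X i - coord P P' X j := funext h
    rw [this]
    exact (continuous_coord P P' i).sub (continuous_coord P P' j)) hS
  have hinj : Function.Injective (coord P P' x) := by
    intro i j hij
    by_contra hne
    obtain ⟨α, hα⟩ := exists_dual (𝔟 := 𝔟) (P := P) (P' := P') i j
    apply hx α (hF.root_lieG hne hα)
    rw [hα, hij, sub_self]
  refine ⟨x, hinj, Set.ext fun y => ⟨fun hy i j hij => ?_, fun hy α hα => ?_⟩⟩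
  · by_cases hne : i = j
    · rw [hne]
    · obtain ⟨α, hα⟩ := exists_dual (𝔟 := 𝔟) (P := P) (P' := P') i j
      have h1 := hy α (hF.root_lieG hne hα)
      rw [hα, hα] at h1
      have h2 : 0 < coord P P' x i - coord P P' x j :=
        sub_pos.2 (lt_of_le_of_ne hij fun h => hne (hinj h.symm))
      exact sub_nonneg.1 (nonneg_of_mul_nonneg_right h1 h2)
  · obtain ⟨Y, -, i, j, -, -, h⟩ := hF.exists_of_root hα
    rw [h, h]
    rcases le_total (coord P P' x j) (coord P P' x i) with h1 | h1
    · exact mul_nonneg (sub_nonneg.2 h1) (sub_nonneg.2 (hy i j h1))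
    · exact mul_nonneg_of_nonpos_of_nonpos (sub_nonpos.2 h1) (sub_nonpos.2 (hy j i h1))

theorem weylChamber_lieGTauO (hF : IsFrame o τ 𝔟 P P' t s ε) {S : Set 𝔟}
    (hS : IsWeylChamber (restrictedRoots 𝔟 (lieGTauO o τ)) S) :
    ∃ x : 𝔟, (∀ i j, ε i = ε j → coord P P' x i = coord P P' x j → i = j) ∧
      S = {y | ∀ i j, ε i = ε j → coord P P' x j ≤ coord P P' x i →
        coord P P' y j ≤ coord P P' y i} := by
  obtain ⟨x, hx, rfl⟩ := weylChamber_eq (fun α hα => by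
    obtain ⟨Y, -, i, j, -, -, h⟩ := hF.exists_of_root hα
    have : (α : 𝔟 → ℝ) = fun X => coord P P' X i - coord P P' X j := funext h
    rw [this]
    exact (continuous_coord P P' i).sub (continuous_coord P P' j)) hS
  have hinj : ∀ i j, ε i = ε j → coord P P' x i = coord P P' x j → i = j := by
    intro i j hε hij
    by_contra hne
    obtain ⟨α, hα⟩ := exists_dual (𝔟 := 𝔟) (P := P) (P' := P') i j
    apply hx α (hF.root_lieGTauO hne hε hα)
    rw [hα, hij, sub_self]
  refine ⟨x, hinj, Set.ext fun y => ⟨fun hy i j hε hij => ?_, fun hy α hα => ?_⟩⟩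
  · by_cases hne : i = j
    · rw [hne]
    · obtain ⟨α, hα⟩ := exists_dual (𝔟 := 𝔟) (P := P) (P' := P') i j
      have h1 := hy α (hF.root_lieGTauO hne hε hα)
      rw [hα, hα] at h1
      have h2 : 0 < coord P P' x i - coord P P' x j :=
        sub_pos.2 (lt_of_le_of_ne hij fun h => hne (hinj _ _ hε h.symm))
      exact sub_nonneg.1 (nonneg_of_mul_nonneg_right h1 h2)
  · obtain ⟨i, j, -, hε, h⟩ := hF.exists_of_root_lieGTauO hα
    rw [h, h]
    rcases le_total (coord P P' x j) (coord P P' x i) with h1 | h1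
    · exact mul_nonneg (sub_nonneg.2 h1) (sub_nonneg.2 (hy i j hε h1))
    · exact mul_nonneg_of_nonpos_of_nonpos (sub_nonpos.2 h1) (sub_nonpos.2 (hy j i hε.symm h1))

/-- Reordering and rescaling a frame. -/
theorem change (hF : IsFrame o τ 𝔟 P P' t s ε) (π : Equiv.Perm (Fin d)) {p : Fin d → 𝕜}
    (hp : ∀ i, ‖p i‖ = 1) {r : ℝ} (hr : 0 < r) :
    IsFrame o τ 𝔟 ((r : 𝕜) • (P * permM 𝕜 π * Matrix.diagonal p))
      ((r : 𝕜)⁻¹ • ((Matrix.diagonal p)ᴴ * (permM 𝕜 π)ᴴ * P')) (r * r * t) (r * r * s) (ε ∘ π) ∧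
    ∀ X : 𝔟, coord ((r : 𝕜) • (P * permM 𝕜 π * Matrix.diagonal p))
      ((r : 𝕜)⁻¹ • ((Matrix.diagonal p)ᴴ * (permM 𝕜 π)ᴴ * P')) X = coord P P' X ∘ π := by
  have hr' : (r : 𝕜) ≠ 0 := by exact_mod_cast hr.ne'
  set n := permM 𝕜 π * Matrix.diagonal p with hn
  have hnn : nᴴ * n = 1 := by
    rw [hn, Matrix.conjTranspose_mul]
    calc (Matrix.diagonal p)ᴴ * (permM 𝕜 π)ᴴ * (permM 𝕜 π * Matrix.diagonal p)
        = (Matrix.diagonal p)ᴴ * ((permM 𝕜 π)ᴴ * permM 𝕜 π) * Matrix.diagonal p := by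
          simp only [mul_assoc]
      _ = 1 := by rw [permM_unitary, mul_one, diagonal_phase hp]
  have hnn' : n * nᴴ = 1 := mul_eq_one_comm.1 hnn
  have hnd : ∀ x : Fin d → ℝ, nᴴ * diagR 𝕜 x * n = diagR 𝕜 (x ∘ π) := by
    intro x
    rw [hn, Matrix.conjTranspose_mul]
    calc (Matrix.diagonal p)ᴴ * (permM 𝕜 π)ᴴ * diagR 𝕜 x * (permM 𝕜 π * Matrix.diagonal p)
        = (Matrix.diagonal p)ᴴ * ((permM 𝕜 π)ᴴ * diagR 𝕜 x * permM 𝕜 π) * Matrix.diagonal p := by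
          simp only [mul_assoc]
      _ = _ := by rw [permM_conj_diagR, diagonal_phase_conj hp]
  have hnd' : ∀ x : Fin d → ℝ, diagR 𝕜 x = n * diagR 𝕜 (x ∘ π) * nᴴ := by
    intro x
    rw [← hnd]
    calc diagR 𝕜 x = (n * nᴴ) * diagR 𝕜 x * (n * nᴴ) := by rw [hnn', one_mul, mul_one]
      _ = _ := by simp only [mul_assoc]
  have e1 : (r : 𝕜) • (P * permM 𝕜 π * Matrix.diagonal p) = (r : 𝕜) • (P * n) := by
    rw [hn, mul_assoc]
  have e2 : (r : 𝕜)⁻¹ • ((Matrix.diagonal p)ᴴ * (permM 𝕜 π)ᴴ * P') = (r : 𝕜)⁻¹ • (nᴴ * P') := by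
    rw [hn, Matrix.conjTranspose_mul]
  have hform : ∀ (F : Mat d 𝕜) (c : ℝ) (y : Fin d → ℝ), Pᴴ * F * P = (c : 𝕜) • diagR 𝕜 y →
      ((r : 𝕜) • (P * n))ᴴ * F * ((r : 𝕜) • (P * n)) = ((r * r * c : ℝ) : 𝕜) • diagR 𝕜 (y ∘ π) := by
    intro F c y h
    have : (P * n)ᴴ * F * (P * n) = nᴴ * (Pᴴ * F * P) * n := by
      rw [Matrix.conjTranspose_mul]; simp only [mul_assoc]
    rw [Matrix.conjTranspose_smul, Matrix.smul_mul, Matrix.smul_mul, Matrix.mul_smul, this, h,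
      Matrix.mul_smul, Matrix.smul_mul, hnd, smul_smul, smul_smul]
    congr 1
    simp
  have hsand : ∀ x : Fin d → ℝ, (r : 𝕜) • (P * n) * diagR 𝕜 (x ∘ π) * ((r : 𝕜)⁻¹ • (nᴴ * P'))
      = P * diagR 𝕜 x * P' := by
    intro x
    rw [Matrix.smul_mul, Matrix.smul_mul, Matrix.mul_smul, smul_smul, mul_inv_cancel₀ hr', one_smul]
    conv_rhs => rw [hnd' x]
    simp only [mul_assoc]
  have hframe : IsFrame o τ 𝔟 ((r : 𝕜) • (P * n)) ((r : 𝕜)⁻¹ • (nᴴ * P')) (r * r * t) (r * r * s)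
      (ε ∘ π) := by
    refine ⟨?_, mul_pos (mul_pos hr hr) hF.t_pos, mul_pos (mul_pos hr hr) hF.s_pos,
      fun i => hF.signs _, ?_, hform _ _ _ hF.conj_o, fun X => ?_⟩
    · have := hsand 1
      rw [diagR_one, mul_one, hF.inv] at this
      rw [← this]
      have : diagR 𝕜 ((1 : Fin d → ℝ) ∘ π) = 1 := by rw [← diagR_one]; rfl
      rw [this, mul_one]
    · have := hform τ.mat t 1 (by rw [hF.conj_τ, diagR_one])
      rw [this, ← diagR_one]; rfl
    · rw [hF.mem_iff]
      constructor
      · rintro ⟨x, hx, rfl⟩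
        exact ⟨x ∘ π, by rw [← hx]; exact Equiv.sum_comp π x, (hsand x).symm⟩
      · rintro ⟨x, hx, rfl⟩
        refine ⟨x ∘ π.symm, by rw [← hx]; exact Equiv.sum_comp π.symm x, ?_⟩
        rw [← hsand]
        congr 3
        funext i; simp
  rw [e1, e2]
  refine ⟨hframe, fun X => hframe.coord_eq ?_⟩
  rw [hsand]; exact hF.eq_coord X

end IsFrame

/-- A frame in `SL(V)` for which the two Weyl chambers are the standard ones. -/
structure IsAdaptedFrame (o τ : HermForm d 𝕜) (𝔟 : LieSubalgebra ℝ (Mat d 𝕜)) (aplus bplus : Set 𝔟)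
    (P P' : Mat d 𝕜) (t s : ℝ) (ε : Fin d → ℝ) : Prop extends IsFrame o τ 𝔟 P P' t s ε where
  aplus_eq : aplus = {X | Antitone (coord P P' X)}
  bplus_eq : bplus = {X | SortedOn ε (coord P P' X)}
  det_eq : P.det = 1

/-- Reorder the frame by decreasing coordinates of an interior point `x` of `aplus`, then rescale it
to determinant 1. The inclusion of `aplus` in `bplus` guarantees that the same order describes
`bplus` on each sign class. -/
theorem exists_isAdaptedFrame (i0 : Fin d) {o τ : HermForm d 𝕜} (hτ : o.MemS τ)
    {𝔟 : LieSubalgebra ℝ (Mat d 𝕜)} (h𝔟 : IsMaximalSubalgebra o τ 𝔟) {aplus bplus : Set 𝔟}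
    (hb : IsWeylChamber (restrictedRoots 𝔟 (lieGTauO o τ)) bplus)
    (ha : IsCompatibleChamber 𝔟 bplus aplus) :
    ∃ P P' t s ε, IsAdaptedFrame o τ 𝔟 aplus bplus P P' t s ε := by
  obtain ⟨P, P', t, s, ε, hF⟩ := exists_isFrame i0 hτ h𝔟
  obtain ⟨x, hxinj, hax⟩ := hF.weylChamber_lieG ha.1
  obtain ⟨y, hyinj, hby⟩ := hF.weylChamber_lieGTauO hb
  set π := Tuple.sort fun i => - coord P P' x i with hπ
  have hmono : Antitone (coord P P' x ∘ π) := by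
    intro i j hij
    have := Tuple.monotone_sort (fun i => - coord P P' x i) hij
    simpa using this
  have hstrict : ∀ i j, i < j ↔ coord P P' x (π j) < coord P P' x (π i) := by
    intro i j
    constructor
    · intro h
      refine lt_of_le_of_ne (hmono h.le) fun h' => ?_
      exact h.ne' (π.injective (hxinj h'))
    · intro h
      by_contra hcon
      exact absurd (hmono (not_lt.1 hcon)) (not_le.2 h)
  have hPdet : P.det ≠ 0 := by
    intro h0
    have := congrArg Matrix.det hF.inv
    rw [Matrix.det_mul, h0, zero_mul, Matrix.det_one] at this
    exact zero_ne_one this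
  set z := (P * permM 𝕜 π).det with hz
  have hz0 : 0 < ‖z‖ := by
    rw [hz, Matrix.det_mul, norm_mul, norm_det_of_unitary (permM_unitary π), mul_one, norm_pos_iff]
    exact hPdet
  have hd : d ≠ 0 := by rintro rfl; exact i0.elim0
  -- The real factor fixes the modulus of the determinant; the phases `p` then fix its argument.
  set r : ℝ := ‖z‖⁻¹ ^ ((d : ℝ)⁻¹) with hr
  have hrp : 0 < r := Real.rpow_pos_of_pos (inv_pos.2 hz0) _
  have hrd : r ^ d = ‖z‖⁻¹ := Real.rpow_inv_natCast_pow (inv_pos.2 hz0).le hd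
  obtain ⟨p, hp, hpdet⟩ := exists_phase (𝕜 := 𝕜) i0 (z := ((r : 𝕜) • (P * permM 𝕜 π)).det) (by
    rw [Matrix.det_smul, norm_mul, norm_pow, RCLike.norm_ofReal, abs_of_pos hrp, Fintype.card_fin,
      hrd, inv_mul_cancel₀ hz0.ne'])
  obtain ⟨hF', hcoord⟩ := hF.change π hp hrp
  -- The interior point `x` lies in `bplus`, so the point `y` defining `bplus` cannot order a sign
  -- class differently.
  have hyx : ∀ i j, i < j → ε (π i) = ε (π j) → coord P P' y (π j) ≤ coord P P' y (π i) := by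
    intro i j hij hε
    by_contra hcon
    have h1 : x ∈ bplus := ha.2 (by rw [hax]; exact fun i j h => h)
    rw [hby] at h1
    have h2 := h1 (π j) (π i) hε.symm (not_le.1 hcon).le
    exact absurd h2 (not_le.2 ((hstrict i j).1 hij))
  refine ⟨_, _, _, _, _, hF', ?_, ?_, ?_⟩
  · rw [hax]
    ext X
    simp only [Set.mem_ofPred_eq, hcoord]
    constructor
    · intro h i j hij
      exact h _ _ (hmono hij)
    · intro h i j hij
      have h1 : π.symm i ≤ π.symm j := by
        by_contra hcon
        have := (hstrict _ _).1 (not_le.1 hcon)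
        rw [Equiv.apply_symm_apply, Equiv.apply_symm_apply] at this
        exact absurd hij (not_le.2 this)
      simpa using h h1
  · rw [hby]
    ext X
    simp only [Set.mem_ofPred_eq, hcoord]
    constructor
    · intro h i j hij hε
      exact h _ _ hε (hyx i j hij hε)
    · intro h i j hε hij
      by_cases hne : i = j
      · rw [hne]
      · have h1 : π.symm i < π.symm j := by
          by_contra hcon
          have h3 := lt_of_le_of_ne (not_lt.1 hcon) fun h => hne (π.symm.injective h).symm
          have h4 := hyx _ _ h3 (by simpa using hε.symm)
          rw [Equiv.apply_symm_apply, Equiv.apply_symm_apply] at h4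
          exact hne (hyinj _ _ hε (le_antisymm h4 hij))
        simpa using h _ _ h1 (by simpa using hε)
  · rw [← Matrix.smul_mul, Matrix.det_mul, hpdet]

end Coordinates

/-! ### Lifting from G to SL(V) -/

/-- The special linear group of `V`. -/
abbrev SL (d : ℕ) (𝕜 : Type*) [RCLike 𝕜] := Matrix.SpecialLinearGroup (Fin d) 𝕜

theorem SL.mul_inv_coe (A : SL d 𝕜) : (A : Mat d 𝕜) * ((A⁻¹ : SL d 𝕜) : Mat d 𝕜) = 1 := by
  rw [← Matrix.SpecialLinearGroup.coe_mul, mul_inv_cancel, Matrix.SpecialLinearGroup.coe_one]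

theorem SL.inv_mul_coe (A : SL d 𝕜) : ((A⁻¹ : SL d 𝕜) : Mat d 𝕜) * (A : Mat d 𝕜) = 1 := by
  rw [← Matrix.SpecialLinearGroup.coe_mul, inv_mul_cancel, Matrix.SpecialLinearGroup.coe_one]

/-- The projection from `SL(V)` to `G`. -/
def toG : SL d 𝕜 →* G d 𝕜 := QuotientGroup.mk' _

theorem toG_surjective : Function.Surjective (toG : SL d 𝕜 → G d 𝕜) :=
  QuotientGroup.mk'_surjective _

theorem toG_smul_sub (A : SL d 𝕜) (W : Sub d 𝕜) :
    toG A • W = W.map (Matrix.mulVecLin (A : Mat d 𝕜)) := rfl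

/-- The element of `G` with matrix `B` in the basis given by the columns of `S`. -/
def frameHom (S : SL d 𝕜) : SL d 𝕜 →* G d 𝕜 :=
  toG.comp (MulAut.conj S).toMonoidHom

theorem frameHom_apply (S B : SL d 𝕜) : frameHom S B = toG (S * B * S⁻¹) := rfl

theorem frameHom_surjective (S : SL d 𝕜) : Function.Surjective (frameHom S) := by
  intro g
  obtain ⟨A, rfl⟩ := toG_surjective g
  refine ⟨S⁻¹ * A * S, ?_⟩
  rw [frameHom_apply]
  congr 1
  group

theorem norm_eq_one_of_pow {r : 𝕜} (i0 : Fin d) (h : r ^ d = 1) : ‖r‖ = 1 := by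
  have hd : d ≠ 0 := by rintro rfl; exact i0.elim0
  refine (pow_eq_one_iff_of_nonneg (norm_nonneg r) hd).1 ?_
  rw [← norm_pow, h, norm_one]

theorem toG_eq (A B : SL d 𝕜) (h : toG A = toG B) :
    ∃ r : 𝕜, r ^ d = 1 ∧ (B : Mat d 𝕜) = r • (A : Mat d 𝕜) := by
  replace h := QuotientGroup.eq.1 h
  obtain ⟨r, hr1, hr⟩ := Matrix.SpecialLinearGroup.mem_center_iff.1 h
  refine ⟨r, by simpa using hr1, ?_⟩
  have h1 : (B : Mat d 𝕜) = (A : Mat d 𝕜) * ((A⁻¹ * B : SL d 𝕜) : Mat d 𝕜) := by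
    rw [← Matrix.SpecialLinearGroup.coe_mul, mul_inv_cancel_left]
  rw [h1, ← hr, Matrix.scalar_apply, ← Matrix.smul_one_eq_diagonal, Matrix.mul_smul, mul_one]

theorem frameHom_eq (S A B : SL d 𝕜) (h : frameHom S A = frameHom S B) :
    ∃ r : 𝕜, r ^ d = 1 ∧ (B : Mat d 𝕜) = r • (A : Mat d 𝕜) := by
  obtain ⟨r, hr1, hr⟩ := toG_eq _ _ h
  refine ⟨r, hr1, ?_⟩
  change ((S * B * S⁻¹ : SL d 𝕜) : Mat d 𝕜) = r • ((S * A * S⁻¹ : SL d 𝕜) : Mat d 𝕜) at hr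
  simp only [Matrix.SpecialLinearGroup.coe_mul] at hr
  calc (B : Mat d 𝕜) = (((S⁻¹ : SL d 𝕜) : Mat d 𝕜) * S) * B * (((S⁻¹ : SL d 𝕜) : Mat d 𝕜) * S) := by
        rw [SL.inv_mul_coe, one_mul, mul_one]
    _ = ((S⁻¹ : SL d 𝕜) : Mat d 𝕜) * (S * B * ((S⁻¹ : SL d 𝕜) : Mat d 𝕜)) * S := by
        simp only [mul_assoc]
    _ = r • ((((S⁻¹ : SL d 𝕜) : Mat d 𝕜) * S) * A * (((S⁻¹ : SL d 𝕜) : Mat d 𝕜) * S)) := by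
        rw [hr]; simp only [Matrix.mul_smul, Matrix.smul_mul, mul_assoc]
    _ = _ := by rw [SL.inv_mul_coe, one_mul, mul_one]

/-- Two ambiguities disappear. A lift is determined up to a root of unity, which does not affect a
sesquilinear form; and the homothety factor is a positive number whose `d`-th power is 1, by
determinants. -/
theorem frameHom_mem_stab_iff (i0 : Fin d) (F : HermForm d 𝕜) (S : SL d 𝕜) {c : 𝕜} (hc : c ≠ 0)
    {M : Mat d 𝕜} (hM : (S : Mat d 𝕜)ᴴ * F.mat * S = c • M) (B : SL d 𝕜) :
    frameHom S B ∈ F.stab ↔ (B : Mat d 𝕜)ᴴ * M * B = M := by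
  have hd : d ≠ 0 := by rintro rfl; exact i0.elim0
  have hdet : M.det ≠ 0 := by
    intro h0
    have := congrArg Matrix.det hM
    rw [Matrix.det_smul, h0, mul_zero, Matrix.det_mul, Matrix.det_mul, Matrix.det_conjTranspose, S.2,
      star_one, one_mul, mul_one] at this
    exact F.isUnit_det.ne_zero this
  have key : ∀ (A : SL d 𝕜) (e : 𝕜), ((S * A * S⁻¹ : SL d 𝕜) : Mat d 𝕜)ᴴ * F.mat
      * ((S * A * S⁻¹ : SL d 𝕜) : Mat d 𝕜) = e • F.mat ↔ (A : Mat d 𝕜)ᴴ * M * A = e • M := by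
    intro A e
    have e1 := SL.inv_mul_coe S
    have e2 : (S : Mat d 𝕜)ᴴ * ((S⁻¹ : SL d 𝕜) : Mat d 𝕜)ᴴ = 1 := by
      rw [← Matrix.conjTranspose_mul, e1, Matrix.conjTranspose_one]
    have e3 := SL.mul_inv_coe S
    have e4 : ((S⁻¹ : SL d 𝕜) : Mat d 𝕜)ᴴ * (S : Mat d 𝕜)ᴴ = 1 := mul_eq_one_comm.1 e2
    have h1 : ((S * A * S⁻¹ : SL d 𝕜) : Mat d 𝕜)ᴴ * F.mat * ((S * A * S⁻¹ : SL d 𝕜) : Mat d 𝕜)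
        = c • (((S⁻¹ : SL d 𝕜) : Mat d 𝕜)ᴴ * ((A : Mat d 𝕜)ᴴ * M * A) * ((S⁻¹ : SL d 𝕜) : Mat d 𝕜)) := by
      simp only [Matrix.SpecialLinearGroup.coe_mul, Matrix.conjTranspose_mul]
      calc ((S⁻¹ : SL d 𝕜) : Mat d 𝕜)ᴴ * ((A : Mat d 𝕜)ᴴ * (S : Mat d 𝕜)ᴴ) * F.mat
            * (S * A * ((S⁻¹ : SL d 𝕜) : Mat d 𝕜))
          = ((S⁻¹ : SL d 𝕜) : Mat d 𝕜)ᴴ * ((A : Mat d 𝕜)ᴴ * ((S : Mat d 𝕜)ᴴ * F.mat * S) * A)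
            * ((S⁻¹ : SL d 𝕜) : Mat d 𝕜) := by simp only [mul_assoc]
        _ = _ := by rw [hM]; simp only [Matrix.mul_smul, Matrix.smul_mul]
    have h2 : F.mat = c • (((S⁻¹ : SL d 𝕜) : Mat d 𝕜)ᴴ * M * ((S⁻¹ : SL d 𝕜) : Mat d 𝕜)) := by
      calc F.mat = (((S⁻¹ : SL d 𝕜) : Mat d 𝕜)ᴴ * (S : Mat d 𝕜)ᴴ) * F.mat * (S * ((S⁻¹ : SL d 𝕜) : Mat d 𝕜)) := by
            rw [e4, e3, one_mul, mul_one]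
        _ = ((S⁻¹ : SL d 𝕜) : Mat d 𝕜)ᴴ * ((S : Mat d 𝕜)ᴴ * F.mat * S) * ((S⁻¹ : SL d 𝕜) : Mat d 𝕜) := by
            simp only [mul_assoc]
        _ = _ := by rw [hM]; simp only [Matrix.mul_smul, Matrix.smul_mul]
    rw [h1]
    constructor
    · intro h
      rw [h2, smul_comm e c] at h
      have h3 := smul_right_injective _ hc h
      have h4 := congrArg (fun N => (S : Mat d 𝕜)ᴴ * N * S) h3
      have h5 : ∀ N : Mat d 𝕜, (S : Mat d 𝕜)ᴴ * (((S⁻¹ : SL d 𝕜) : Mat d 𝕜)ᴴ * N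
          * ((S⁻¹ : SL d 𝕜) : Mat d 𝕜)) * S = N := by
        intro N
        calc _ = ((S : Mat d 𝕜)ᴴ * ((S⁻¹ : SL d 𝕜) : Mat d 𝕜)ᴴ) * N
              * (((S⁻¹ : SL d 𝕜) : Mat d 𝕜) * S) := by simp only [mul_assoc]
          _ = N := by rw [e1, e2, one_mul, mul_one]
      simp only [Matrix.mul_smul, Matrix.smul_mul] at h4
      rw [h5, h5] at h4
      exact h4
    · intro h
      rw [h]
      conv_rhs => rw [h2]
      simp only [Matrix.mul_smul, Matrix.smul_mul]
      rw [smul_comm]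
  constructor
  · rintro ⟨A, ⟨e, he, hA⟩, hAB⟩
    obtain ⟨A', rfl⟩ : ∃ A', A = S * A' * S⁻¹ := ⟨S⁻¹ * A * S, by group⟩
    rw [key] at hA
    obtain ⟨r, hr1, hr⟩ := frameHom_eq S A' B hAB
    have hrn := norm_eq_one_of_pow i0 hr1
    have hss : star r * r = 1 := by
      rw [RCLike.star_def, RCLike.conj_mul, hrn]; simp
    have h1 : e = 1 := by
      have h2 := congrArg Matrix.det hA
      rw [Matrix.det_smul, Matrix.det_mul, Matrix.det_mul, Matrix.det_conjTranspose, A'.2, star_one,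
        one_mul, mul_one, Fintype.card_fin] at h2
      have h3 : (e : 𝕜) ^ d = 1 := by
        apply mul_right_cancel₀ hdet; rw [one_mul]; exact h2.symm
      have h4 : e ^ d = 1 := by exact_mod_cast h3
      exact (pow_eq_one_iff_of_nonneg he.le hd).1 h4
    rw [h1] at hA
    rw [hr, Matrix.conjTranspose_smul, Matrix.smul_mul, Matrix.smul_mul, Matrix.mul_smul, hA,
      smul_smul, hss]
    simp
  · intro h
    exact ⟨S * B * S⁻¹, ⟨1, one_pos, (key B _).2 (by rw [h]; simp)⟩, rfl⟩

/-! ### Lines and flags in a frame -/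

/-- The line spanned by the `i`-th column of a matrix. -/
def lineOf (A : Mat d 𝕜) (i : Fin d) : Sub d 𝕜 := Submodule.span 𝕜 {A.col i}

theorem toG_smul_lineOf (A : SL d 𝕜) (B : Mat d 𝕜) (i : Fin d) :
    toG A • lineOf B i = lineOf ((A : Mat d 𝕜) * B) i := by
  rw [toG_smul_sub, lineOf, Submodule.map_span, Set.image_singleton, lineOf]
  rfl

theorem col_smul_mul (A : Mat d 𝕜) (σ : Equiv.Perm (Fin d)) (p : Fin d → 𝕜) (i : Fin d) :
    (A * (permM 𝕜 σ * Matrix.diagonal p)).col i = p i • A.col (σ i) := by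
  ext k
  rw [Matrix.col_apply, ← mul_assoc, Matrix.mul_diagonal, mul_permM_apply]
  simp [mul_comm]

theorem lineOf_perm (A : Mat d 𝕜) (σ : Equiv.Perm (Fin d)) {p : Fin d → 𝕜} (hp : ∀ i, ‖p i‖ = 1)
    (i : Fin d) : lineOf (A * (permM 𝕜 σ * Matrix.diagonal p)) i = lineOf A (σ i) := by
  have : p i ≠ 0 := fun h => by simpa [h] using hp i
  rw [lineOf, lineOf, col_smul_mul, Submodule.span_singleton_smul_eq (IsUnit.mk0 _ this)]

theorem smul_iSup (g : G d 𝕜) {ι : Sort*} (f : ι → Sub d 𝕜) : g • (⨆ i, f i) = ⨆ i, g • f i := by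
  obtain ⟨A, rfl⟩ := toG_surjective g
  exact Submodule.map_iSup (Matrix.mulVecLin (A : Mat d 𝕜)) f

theorem stdFlag_sub (k : Fin (d + 1)) :
    (stdFlag : FullFlag d 𝕜).sub k = ⨆ i : Fin d, ⨆ _ : i.castSucc < k, lineOf 1 i := by
  change (Pi.basisFun 𝕜 (Fin d)).flag k = _
  rw [Module.Basis.flag, Submodule.span_eq_iSup_of_singleton_spans, iSup_image]
  refine iSup_congr fun i => ?_
  refine iSup_congr fun _ => ?_
  rw [lineOf]
  congr 2
  ext j
  simp [Matrix.one_apply, Pi.single_apply]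

theorem smul_stdFlag_sub (A : SL d 𝕜) (k : Fin (d + 1)) :
    (toG A • stdFlag : FullFlag d 𝕜).sub k
      = ⨆ i : Fin d, ⨆ _ : i.castSucc < k, lineOf (A : Mat d 𝕜) i := by
  change toG A • (stdFlag : FullFlag d 𝕜).sub k = _
  rw [stdFlag_sub]
  simp only [smul_iSup, toG_smul_lineOf, mul_one]

/-- `ξ` is the flag spanned by the columns of `A`, in the order given by `σ`. -/
def IsPermFlag (A : Mat d 𝕜) (ξ : FullFlag d 𝕜) (σ : Equiv.Perm (Fin d)) : Prop :=
  ∀ k, ξ.sub k = ⨆ i : Fin d, ⨆ _ : i.castSucc < k, lineOf A (σ i)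

theorem IsPermFlag.flag_eq {A : Mat d 𝕜} {ξ η : FullFlag d 𝕜} {σ : Equiv.Perm (Fin d)}
    (h : IsPermFlag A ξ σ) (h' : IsPermFlag A η σ) : ξ = η :=
  FullFlag.ext (funext fun k => (h k).trans (h' k).symm)

/-- Row `σ j` of the inverse matrix is a linear functional detecting the column `σ j` and killing
the others. -/
theorem col_mem_iff {A B : Mat d 𝕜} (hAB : B * A = 1) (σ : Equiv.Perm (Fin d)) (j : Fin d)
    (k : Fin (d + 1)) : A.col (σ j) ∈ (⨆ i : Fin d, ⨆ _ : i.castSucc < k, lineOf A (σ i)) ↔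
      j.castSucc < k := by
  constructor
  · intro h
    by_contra hk
    have h1 : (⨆ i : Fin d, ⨆ _ : i.castSucc < k, lineOf A (σ i)) ≤
        LinearMap.ker ((LinearMap.proj (σ j) : (Fin d → 𝕜) →ₗ[𝕜] 𝕜).comp (Matrix.mulVecLin B)) := by
      refine iSup₂_le fun i hi => ?_
      rw [lineOf, Submodule.span_singleton_le_iff_mem, LinearMap.mem_ker]
      change (B * A) (σ j) (σ i) = 0
      rw [hAB, Matrix.one_apply_ne]
      intro h
      rw [σ.injective h] at hk
      exact hk hi
    have h2 := h1 h
    rw [LinearMap.mem_ker] at h2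
    change (B * A) (σ j) (σ j) = 0 at h2
    rw [hAB, Matrix.one_apply_eq] at h2
    exact one_ne_zero h2
  · intro h
    exact Submodule.mem_iSup_of_mem j (Submodule.mem_iSup_of_mem h
      (Submodule.mem_span_singleton_self _))

theorem perm_eq_one_of_monotone {σ : Equiv.Perm (Fin d)} (h : ∀ i j, i ≤ j → σ i ≤ σ j) : σ = 1 := by
  have hs : StrictMono σ := Monotone.strictMono_of_injective (fun i j hij => h i j hij) σ.injective
  have : (hs.orderIsoOfSurjective _ σ.surjective) = OrderIso.refl _ := Subsingleton.elim _ _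
  ext i
  have h2 := congrArg (fun e : Fin d ≃o Fin d => e i) this
  simpa using congrArg Fin.val h2

/-- The position of a line in the order is the step at which its column enters the flag. -/
theorem IsPermFlag.perm_eq {A B : Mat d 𝕜} (hAB : B * A = 1) {ξ : FullFlag d 𝕜}
    {σ ρ : Equiv.Perm (Fin d)} (h : IsPermFlag A ξ σ) (h' : IsPermFlag A ξ ρ) : σ = ρ := by
  have h1 : ∀ l k, (σ.symm l).castSucc < k ↔ (ρ.symm l).castSucc < k := by
    intro l k
    rw [← col_mem_iff hAB σ, ← col_mem_iff hAB ρ, ← h k, ← h' k]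
    simp
  have h2 : ∀ l, σ.symm l = ρ.symm l := by
    intro l
    have a := (h1 l (ρ.symm l).succ).2 (Fin.castSucc_lt_succ)
    have b := (h1 l (σ.symm l).succ).1 (Fin.castSucc_lt_succ)
    rw [Fin.castSucc_lt_succ_iff] at a b
    exact le_antisymm a b
  have : σ.symm = ρ.symm := Equiv.ext h2
  simpa using congrArg Equiv.symm this

theorem exists_permSL (𝕜 : Type*) [RCLike 𝕜] (i0 : Fin d) (σ : Equiv.Perm (Fin d)) :
    ∃ (N : SL d 𝕜) (p : Fin d → 𝕜),
    (∀ i, ‖p i‖ = 1) ∧ (N : Mat d 𝕜) = permM 𝕜 σ * Matrix.diagonal p := by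
  obtain ⟨p, hp, h⟩ := exists_phase (𝕜 := 𝕜) i0 (norm_det_of_unitary (permM_unitary σ))
  exact ⟨⟨permM 𝕜 σ * Matrix.diagonal p, by rw [Matrix.det_mul, h]⟩, p, hp, rfl⟩

theorem isPermFlag_smul (S N : SL d 𝕜) {p : Fin d → 𝕜} {σ : Equiv.Perm (Fin d)}
    (hp : ∀ i, ‖p i‖ = 1) (hN : (N : Mat d 𝕜) = permM 𝕜 σ * Matrix.diagonal p) :
    IsPermFlag (S : Mat d 𝕜) (toG (S * N) • stdFlag) σ := by
  intro k
  rw [smul_stdFlag_sub, Matrix.SpecialLinearGroup.coe_mul, hN]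
  simp only [lineOf_perm _ _ hp]

theorem exists_isPermFlag (i0 : Fin d) (S : SL d 𝕜) (σ : Equiv.Perm (Fin d)) :
    ∃ ξ, IsPermFlag (S : Mat d 𝕜) ξ σ := by
  obtain ⟨N, p, hp, hN⟩ := exists_permSL 𝕜 i0 σ
  exact ⟨_, isPermFlag_smul S N hp hN⟩

theorem isPermFlag_one (S : SL d 𝕜) :
    IsPermFlag (S : Mat d 𝕜) (toG S • stdFlag) 1 := fun k =>
  smul_stdFlag_sub S k

/-! ### Exponential, eigenlines, chambers and flags in a frame -/

section FrameTranslation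

variable {𝔟 : LieSubalgebra ℝ (Mat d 𝕜)}

/-- The coordinates of an element of `𝔟` in the basis given by the columns of `S`. -/
abbrev crd (S : SL d 𝕜) : 𝔟 →ₗ[ℝ] (Fin d → ℝ) := coord (S : Mat d 𝕜) ((S⁻¹ : SL d 𝕜) : Mat d 𝕜)

/-- The diagonal matrix `exp x` as an element of `SL(V)`. -/
def expSL (𝕜 : Type*) [RCLike 𝕜] (x : Fin d → ℝ) (hx : ∑ i, x i = 0) : SL d 𝕜 :=
  ⟨expD 𝕜 x, by rw [det_expD, hx]; simp⟩

theorem SL.coe_inv_eq (S : SL d 𝕜) : ((S⁻¹ : SL d 𝕜) : Mat d 𝕜) = (S : Mat d 𝕜)⁻¹ :=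
  (Matrix.inv_eq_right_inv (SL.mul_inv_coe S)).symm

theorem exp_diagR (x : Fin d → ℝ) : NormedSpace.exp (diagR 𝕜 x) = expD 𝕜 x := by
  rw [diagR, Matrix.exp_diagonal, expD, diagR]
  congr 1
  funext i
  rw [Pi.coe_exp, Real.exp_eq_exp_ℝ, ← RCLike.algebraMap_eq_ofReal]
  exact (NormedSpace.algebraMap_exp_comm (x i)).symm

theorem Ad_frameHom (S N : SL d 𝕜) (X : Mat d 𝕜) : Ad (frameHom S N) X
    = ((S * N * S⁻¹ : SL d 𝕜) : Mat d 𝕜) * X * ((S * N⁻¹ * S⁻¹ : SL d 𝕜) : Mat d 𝕜) := by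
  have : S * N⁻¹ * S⁻¹ = (S * N * S⁻¹)⁻¹ := by group
  rw [this]
  rfl

theorem lineOf_injective (S : SL d 𝕜) : Function.Injective (lineOf (S : Mat d 𝕜)) := by
  intro i j h
  have h1 : (S : Mat d 𝕜).col i ∈ lineOf (S : Mat d 𝕜) j := h ▸ Submodule.mem_span_singleton_self _
  obtain ⟨c, hc⟩ := Submodule.mem_span_singleton.1 h1
  by_contra hne
  have h2 : (((S⁻¹ : SL d 𝕜) : Mat d 𝕜) * (S : Mat d 𝕜)) i i
      = c * (((S⁻¹ : SL d 𝕜) : Mat d 𝕜) * (S : Mat d 𝕜)) i j := by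
    have h3 := congrArg (fun v => (((S⁻¹ : SL d 𝕜) : Mat d 𝕜) *ᵥ v) i) hc
    simp only [Matrix.mulVec_smul, Pi.smul_apply, smul_eq_mul] at h3
    exact h3.symm
  rw [SL.inv_mul_coe, Matrix.one_apply_eq, Matrix.one_apply_ne hne, mul_zero] at h2
  exact one_ne_zero h2

theorem col_ne_zero (S : SL d 𝕜) (i : Fin d) : (S : Mat d 𝕜).col i ≠ 0 := by
  intro h
  have h2 : (((S⁻¹ : SL d 𝕜) : Mat d 𝕜) * (S : Mat d 𝕜)) i i = 0 := by
    have h3 := congrArg (fun v => (((S⁻¹ : SL d 𝕜) : Mat d 𝕜) *ᵥ v) i) h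
    simp only [Matrix.mulVec_zero] at h3
    exact h3
  rw [SL.inv_mul_coe, Matrix.one_apply_eq] at h2
  exact one_ne_zero h2

/-- `k` permutes the lines of the frame by `σ`, and acts on them isometrically. -/
def IsMonomial (S : SL d 𝕜) (k : G d 𝕜) (σ : Equiv.Perm (Fin d)) : Prop :=
  ∃ (N : SL d 𝕜) (p : Fin d → 𝕜), (∀ i, ‖p i‖ = 1) ∧ (N : Mat d 𝕜) = permM 𝕜 σ * Matrix.diagonal p ∧
    k = frameHom S N

theorem exists_isMonomial_perm (i0 : Fin d) (S : SL d 𝕜) (σ : Equiv.Perm (Fin d)) :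
    ∃ k, IsMonomial S k σ := by
  obtain ⟨N, p, hp, hN⟩ := exists_permSL 𝕜 i0 σ
  exact ⟨_, N, p, hp, hN, rfl⟩

theorem IsMonomial.smul_lineOf {S : SL d 𝕜} {k : G d 𝕜} {σ : Equiv.Perm (Fin d)}
    (h : IsMonomial S k σ) (i : Fin d) :
    k • lineOf (S : Mat d 𝕜) i = lineOf (S : Mat d 𝕜) (σ i) := by
  obtain ⟨N, p, hp, hN, rfl⟩ := h
  rw [frameHom_apply, toG_smul_lineOf, ← Matrix.SpecialLinearGroup.coe_mul, inv_mul_cancel_right,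
    Matrix.SpecialLinearGroup.coe_mul, hN, lineOf_perm _ _ hp]

theorem IsMonomial.isPermFlag_smul {S : SL d 𝕜} {k : G d 𝕜} {σ ρ : Equiv.Perm (Fin d)}
    (h : IsMonomial S k σ) {ξ : FullFlag d 𝕜} (hξ : IsPermFlag (S : Mat d 𝕜) ξ ρ) :
    IsPermFlag (S : Mat d 𝕜) (k • ξ) (σ * ρ) := by
  intro j
  change k • ξ.sub j = _
  rw [hξ j]
  simp only [smul_iSup, h.smul_lineOf]
  rfl

variable {o τ : HermForm d 𝕜} {S : SL d 𝕜} {t s : ℝ} {ε : Fin d → ℝ}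

namespace IsFrame

theorem expG_eq (hF : IsFrame o τ 𝔟 (S : Mat d 𝕜) ((S⁻¹ : SL d 𝕜) : Mat d 𝕜) t s ε) (X : 𝔟) :
    expG (X : Mat d 𝕜) = frameHom S (expSL 𝕜 (crd S X) (hF.sum_coord X)) := by
  have h : NormedSpace.exp (X : Mat d 𝕜)
      = ((S * expSL 𝕜 (crd S X) (hF.sum_coord X) * S⁻¹ : SL d 𝕜) : Mat d 𝕜) := by
    have h1 : ∀ x, NormedSpace.exp ((S : Mat d 𝕜) * diagR 𝕜 x * ((S⁻¹ : SL d 𝕜) : Mat d 𝕜))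
        = (S : Mat d 𝕜) * expD 𝕜 x * ((S⁻¹ : SL d 𝕜) : Mat d 𝕜) := by
      intro x
      rw [SL.coe_inv_eq, Matrix.exp_conj _ _ (IsUnit.of_mul_eq_one _ (SL.mul_inv_coe S)), exp_diagR]
    conv_lhs => rw [hF.eq_coord X]
    rw [h1]
    rfl
  have hdet : (NormedSpace.exp (X : Mat d 𝕜)).det = 1 := by rw [h]; exact (S * _ * S⁻¹ : SL d 𝕜).2
  rw [expG, dif_pos hdet, frameHom_apply]
  exact congrArg toG (Subtype.ext h)

theorem mulVec_col (hF : IsFrame o τ 𝔟 (S : Mat d 𝕜) ((S⁻¹ : SL d 𝕜) : Mat d 𝕜) t s ε) (X : 𝔟)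
    (i : Fin d) : (X : Mat d 𝕜) *ᵥ (S : Mat d 𝕜).col i = (crd S X i : 𝕜) • (S : Mat d 𝕜).col i := by
  have h : (X : Mat d 𝕜) * S = S * diagR 𝕜 (crd S X) := by
    conv_lhs => rw [hF.eq_coord X]
    rw [mul_assoc, SL.inv_mul_coe, mul_one]
  ext k
  have := congrFun (congrFun h k) i
  rw [diagR, Matrix.mul_diagonal] at this
  exact this.trans (by simp [mul_comm])

/-- Any two coordinates are separated by some element of 𝔟, so a common eigenvector has only one
nonzero coordinate. -/
theorem mem_eigenLines_iff (hF : IsFrame o τ 𝔟 (S : Mat d 𝕜) ((S⁻¹ : SL d 𝕜) : Mat d 𝕜) t s ε)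
    (l : Sub d 𝕜) : l ∈ eigenLines 𝔟 ↔ ∃ i, l = lineOf (S : Mat d 𝕜) i := by
  constructor
  · rintro ⟨h1, h2⟩
    obtain ⟨⟨v, hv⟩, hv0, hl⟩ := finrank_eq_one_iff'.1 h1
    have hv0' : v ≠ 0 := fun h => hv0 (Subtype.ext h)
    have hlv : l = Submodule.span 𝕜 {v} := by
      refine le_antisymm (fun w hw => ?_) (by simpa using hv)
      obtain ⟨c, hc⟩ := hl ⟨w, hw⟩
      exact Submodule.mem_span_singleton.2 ⟨c, congrArg Subtype.val hc⟩
    set w := ((S⁻¹ : SL d 𝕜) : Mat d 𝕜) *ᵥ v with hw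
    have hSw : (S : Mat d 𝕜) *ᵥ w = v := by
      rw [hw, Matrix.mulVec_mulVec, SL.mul_inv_coe, Matrix.one_mulVec]
    obtain ⟨i, hi⟩ : ∃ i, w i ≠ 0 := by
      by_contra! h
      apply hv0'
      rw [← hSw, show w = 0 from funext h, Matrix.mulVec_zero]
    have key : ∀ X : 𝔟, ∃ c : 𝕜, ∀ j, (crd S X j : 𝕜) * w j = c * w j := by
      intro X
      have h3 := h2 X X.2 v hv
      rw [hlv] at h3
      obtain ⟨c, hc⟩ := Submodule.mem_span_singleton.1 h3
      refine ⟨c, fun j => ?_⟩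
      have h4 := congrArg (fun u => (((S⁻¹ : SL d 𝕜) : Mat d 𝕜) *ᵥ u) j) hc
      simp only [Matrix.mulVec_smul, Pi.smul_apply, smul_eq_mul] at h4
      rw [← hw] at h4
      rw [h4, hF.eq_coord X, ← hSw, Matrix.mulVec_mulVec, Matrix.mulVec_mulVec]
      have h5 : ((S⁻¹ : SL d 𝕜) : Mat d 𝕜) * ((S : Mat d 𝕜) * diagR 𝕜 (crd S X)
          * ((S⁻¹ : SL d 𝕜) : Mat d 𝕜)) * S = diagR 𝕜 (crd S X) := hF.conj_diagR _
      rw [h5, diagR, Matrix.mulVec_diagonal]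
    have hw0 : ∀ j, j ≠ i → w j = 0 := by
      intro j hj
      by_contra hne
      obtain ⟨X, hX⟩ := hF.exists_coord_sub_ne hj
      obtain ⟨c, hc⟩ := key X
      have e1 := mul_right_cancel₀ hi (hc i)
      have e2 := mul_right_cancel₀ hne (hc j)
      have e3 : crd S X i = crd S X j := by exact_mod_cast e1.trans e2.symm
      rw [e3, sub_self] at hX
      norm_num at hX
    have hws : w = Pi.single i (w i) := by
      funext j
      by_cases hj : j = i
      · rw [hj, Pi.single_eq_same]
      · rw [Pi.single_eq_of_ne hj, hw0 j hj]
    refine ⟨i, ?_⟩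
    have : v = w i • (S : Mat d 𝕜).col i := by
      rw [← hSw, hws, Matrix.mulVec_single]
      ext k; simp [mul_comm]
    rw [hlv, this, lineOf, Submodule.span_singleton_smul_eq (IsUnit.mk0 _ hi)]
  · rintro ⟨i, rfl⟩
    refine ⟨finrank_span_singleton (col_ne_zero S i), fun X hX v hv => ?_⟩
    obtain ⟨c, rfl⟩ := Submodule.mem_span_singleton.1 hv
    rw [Matrix.mulVec_smul, hF.mulVec_col ⟨X, hX⟩, smul_smul]
    exact Submodule.smul_mem _ _ (Submodule.mem_span_singleton_self _)

theorem eig_lineOf (hF : IsFrame o τ 𝔟 (S : Mat d 𝕜) ((S⁻¹ : SL d 𝕜) : Mat d 𝕜) t s ε) (i : Fin d)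
    (X : 𝔟) : eig (lineOf (S : Mat d 𝕜) i) (X : Mat d 𝕜) = crd S X i := by
  have h := Classical.epsilon_spec (p := fun a : ℝ => ∀ v ∈ lineOf (S : Mat d 𝕜) i,
    (X : Mat d 𝕜) *ᵥ v = (a : 𝕜) • v) ⟨crd S X i, fun v hv => by
      obtain ⟨c, rfl⟩ := Submodule.mem_span_singleton.1 hv
      rw [Matrix.mulVec_smul, hF.mulVec_col X, smul_comm]⟩
  have h1 := (hF.mulVec_col X i).symm.trans (h _ (Submodule.mem_span_singleton_self _))
  have h2 := smul_left_injective 𝕜 (col_ne_zero S i) h1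
  exact_mod_cast h2.symm

theorem isFlagOfChamber_iff (hF : IsFrame o τ 𝔟 (S : Mat d 𝕜) ((S⁻¹ : SL d 𝕜) : Mat d 𝕜) t s ε)
    (c : Set 𝔟) (ξ : FullFlag d 𝕜) : IsFlagOfChamber 𝔟 c ξ ↔ ∃ σ : Equiv.Perm (Fin d),
      c = {X | Antitone (crd S X ∘ σ)} ∧ IsPermFlag (S : Mat d 𝕜) ξ σ := by
  constructor
  · rintro ⟨e, he, hr, hc, hξ⟩
    have h1 : ∀ i, ∃ j, e i = lineOf (S : Mat d 𝕜) j := fun i =>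
      (hF.mem_eigenLines_iff _).1 (hr ▸ Set.mem_range_self i)
    choose f hf using h1
    have hfi : Function.Injective f := by
      intro i j hij
      apply he
      rw [hf, hf, hij]
    refine ⟨Equiv.ofBijective f (Finite.injective_iff_bijective.1 hfi), ?_, ?_⟩
    · rw [hc]
      ext X
      simp only [hf, hF.eig_lineOf]
      rfl
    · intro k
      rw [hξ k]
      simp only [hf]
      rfl
  · rintro ⟨σ, hc, hξ⟩
    refine ⟨fun i => lineOf (S : Mat d 𝕜) (σ i), fun i j h => σ.injective (lineOf_injective S h), ?_,
      ?_, hξ⟩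
    · ext l
      rw [hF.mem_eigenLines_iff]
      constructor
      · rintro ⟨i, rfl⟩; exact ⟨σ i, rfl⟩
      · rintro ⟨i, rfl⟩; exact ⟨σ.symm i, by simp⟩
    · rw [hc]
      ext X
      simp only [hF.eig_lineOf]
      rfl

theorem exists_strictAnti (hF : IsFrame o τ 𝔟 (S : Mat d 𝕜) ((S⁻¹ : SL d 𝕜) : Mat d 𝕜) t s ε)
    (σ : Equiv.Perm (Fin d)) : ∃ X : 𝔟, StrictAnti (crd S X ∘ σ) := by
  -- Coordinates decreasing by 1 along the order `σ`; subtracting from the mean `m` makes their sum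
  -- vanish.
  set m : ℝ := (∑ i : Fin d, ((σ.symm i : ℕ) : ℝ)) / d with hm
  obtain ⟨X, hX⟩ := hF.exists_coord (x := fun j => m - ((σ.symm j : ℕ) : ℝ)) (by
    rw [Finset.sum_sub_distrib, Finset.sum_const, Finset.card_univ, Fintype.card_fin, nsmul_eq_mul, hm]
    rcases Nat.eq_zero_or_pos d with rfl | hd
    · simp
    · have : (d : ℝ) ≠ 0 := by exact_mod_cast hd.ne'
      field_simp
      ring)
  refine ⟨X, fun i j hij => ?_⟩
  simp only [crd, hX, Function.comp_apply, Equiv.symm_apply_apply]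
  have : ((i : ℕ) : ℝ) < ((j : ℕ) : ℝ) := by exact_mod_cast hij
  linarith

/-- A strictly ordered point of the chamber determines the order. This is what pins down the choices
made by `flagChamber` and `chamberFlag`. -/
theorem chamber_perm_eq (hF : IsFrame o τ 𝔟 (S : Mat d 𝕜) ((S⁻¹ : SL d 𝕜) : Mat d 𝕜) t s ε)
    {σ ρ : Equiv.Perm (Fin d)}
    (h : {X : 𝔟 | Antitone (crd S X ∘ σ)} = {X : 𝔟 | Antitone (crd S X ∘ ρ)}) : σ = ρ := by
  obtain ⟨X, hX⟩ := hF.exists_strictAnti σ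
  have h1 : Antitone (crd S X ∘ ρ) := by
    have : X ∈ {X : 𝔟 | Antitone (crd S X ∘ σ)} := hX.antitone
    rw [h] at this
    exact this
  have h2 : σ⁻¹ * ρ = 1 := by
    refine perm_eq_one_of_monotone fun i j hij => ?_
    by_contra hcon
    have h3 := hX (not_le.1 hcon)
    have h4 := h1 hij
    have e : ∀ i, σ ((σ⁻¹ * ρ) i) = ρ i := fun i => σ.apply_symm_apply _
    simp only [Function.comp_apply, e] at h3 h4
    exact absurd h4 (not_le.2 h3)
  rw [inv_mul_eq_one] at h2
  exact h2

theorem flagChamber_eq (hF : IsFrame o τ 𝔟 (S : Mat d 𝕜) ((S⁻¹ : SL d 𝕜) : Mat d 𝕜) t s ε)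
    {ξ : FullFlag d 𝕜} {σ : Equiv.Perm (Fin d)} (hξ : IsPermFlag (S : Mat d 𝕜) ξ σ) :
    flagChamber 𝔟 ξ = {X | Antitone (crd S X ∘ σ)} := by
  have h := Classical.epsilon_spec (p := fun c => IsFlagOfChamber 𝔟 c ξ)
    ⟨_, (hF.isFlagOfChamber_iff _ _).2 ⟨σ, rfl, hξ⟩⟩
  obtain ⟨ρ, h1, h2⟩ := (hF.isFlagOfChamber_iff _ _).1 h
  rw [flagChamber, h1, hξ.perm_eq (SL.inv_mul_coe S) h2]

theorem chamberFlag_eq (hF : IsFrame o τ 𝔟 (S : Mat d 𝕜) ((S⁻¹ : SL d 𝕜) : Mat d 𝕜) t s ε)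
    {ξ : FullFlag d 𝕜} {σ : Equiv.Perm (Fin d)} (hξ : IsPermFlag (S : Mat d 𝕜) ξ σ) :
    chamberFlag 𝔟 {X : 𝔟 | Antitone (crd S X ∘ σ)} = ξ := by
  have h := Classical.epsilon_spec
    (p := fun η => IsFlagOfChamber 𝔟 {X : 𝔟 | Antitone (crd S X ∘ σ)} η)
    ⟨_, (hF.isFlagOfChamber_iff _ _).2 ⟨σ, rfl, hξ⟩⟩
  obtain ⟨ρ, h1, h2⟩ := (hF.isFlagOfChamber_iff _ _).1 h
  rw [← hF.chamber_perm_eq h1] at h2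
  exact h2.flag_eq hξ

end IsFrame

end FrameTranslation

/-! ### Weyl group, opposition and Cartan decompositions in a frame -/

section WeylTranslation

variable {𝔟 : LieSubalgebra ℝ (Mat d 𝕜)} {o τ : HermForm d 𝕜} {S : SL d 𝕜} {t s : ℝ}
  {ε : Fin d → ℝ} {aplus bplus : Set 𝔟}

theorem monomial_unitary {σ : Equiv.Perm (Fin d)} {p : Fin d → 𝕜} (hp : ∀ i, ‖p i‖ = 1) :
    (permM 𝕜 σ * Matrix.diagonal p)ᴴ * (permM 𝕜 σ * Matrix.diagonal p) = 1 := by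
  rw [Matrix.conjTranspose_mul]
  calc (Matrix.diagonal p)ᴴ * (permM 𝕜 σ)ᴴ * (permM 𝕜 σ * Matrix.diagonal p)
      = (Matrix.diagonal p)ᴴ * ((permM 𝕜 σ)ᴴ * permM 𝕜 σ) * Matrix.diagonal p := by
        simp only [mul_assoc]
    _ = 1 := by rw [permM_unitary, mul_one, diagonal_phase hp]

theorem diagR_mul_monomial (σ : Equiv.Perm (Fin d)) (p : Fin d → 𝕜) (x : Fin d → ℝ) :
    diagR 𝕜 x * (permM 𝕜 σ * Matrix.diagonal p) = (permM 𝕜 σ * Matrix.diagonal p) * diagR 𝕜 (x ∘ σ) := by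
  rw [← mul_assoc, diagR_mul_permM, mul_assoc, mul_assoc]
  congr 1
  rw [diagR, Matrix.diagonal_mul_diagonal, Matrix.diagonal_mul_diagonal]
  simp only [mul_comm]

namespace IsFrame

theorem mem_stab_τ_iff (i0 : Fin d)
    (hF : IsFrame o τ 𝔟 (S : Mat d 𝕜) ((S⁻¹ : SL d 𝕜) : Mat d 𝕜) t s ε) (B : SL d 𝕜) :
    frameHom S B ∈ τ.stab ↔ (B : Mat d 𝕜)ᴴ * (B : Mat d 𝕜) = 1 := by
  have ht : (t : 𝕜) ≠ 0 := by exact_mod_cast hF.t_pos.ne'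
  rw [frameHom_mem_stab_iff i0 τ S ht hF.conj_τ B, mul_one]

theorem mem_stab_o_iff (i0 : Fin d)
    (hF : IsFrame o τ 𝔟 (S : Mat d 𝕜) ((S⁻¹ : SL d 𝕜) : Mat d 𝕜) t s ε) (B : SL d 𝕜) :
    frameHom S B ∈ o.stab ↔ (B : Mat d 𝕜)ᴴ * diagR 𝕜 ε * (B : Mat d 𝕜) = diagR 𝕜 ε := by
  have hs : (s : 𝕜) ≠ 0 := by exact_mod_cast hF.s_pos.ne'
  exact frameHom_mem_stab_iff i0 o S hs hF.conj_o B

end IsFrame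

theorem IsMonomial.Ad_diagR {k : G d 𝕜} {σ : Equiv.Perm (Fin d)} (h : IsMonomial S k σ)
    (x : Fin d → ℝ) :
    Ad k ((S : Mat d 𝕜) * diagR 𝕜 x * ((S⁻¹ : SL d 𝕜) : Mat d 𝕜))
      = (S : Mat d 𝕜) * diagR 𝕜 (x ∘ σ.symm) * ((S⁻¹ : SL d 𝕜) : Mat d 𝕜) := by
  obtain ⟨N, p, hp, hN, rfl⟩ := h
  have h1 : diagR 𝕜 (x ∘ σ.symm) * (N : Mat d 𝕜) = (N : Mat d 𝕜) * diagR 𝕜 x := by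
    rw [hN, diagR_mul_monomial]
    congr 2
    funext i; simp
  rw [Ad_frameHom]
  simp only [Matrix.SpecialLinearGroup.coe_mul]
  calc (S : Mat d 𝕜) * N * ((S⁻¹ : SL d 𝕜) : Mat d 𝕜) * (S * diagR 𝕜 x * ((S⁻¹ : SL d 𝕜) : Mat d 𝕜))
        * (S * ((N⁻¹ : SL d 𝕜) : Mat d 𝕜) * ((S⁻¹ : SL d 𝕜) : Mat d 𝕜))
      = (S : Mat d 𝕜) * N * (((S⁻¹ : SL d 𝕜) : Mat d 𝕜) * S) * diagR 𝕜 x * (((S⁻¹ : SL d 𝕜) : Mat d 𝕜)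
        * S) * ((N⁻¹ : SL d 𝕜) : Mat d 𝕜) * ((S⁻¹ : SL d 𝕜) : Mat d 𝕜) := by simp only [mul_assoc]
    _ = (S : Mat d 𝕜) * (N * diagR 𝕜 x) * ((N⁻¹ : SL d 𝕜) : Mat d 𝕜) * ((S⁻¹ : SL d 𝕜) : Mat d 𝕜) := by
        rw [SL.inv_mul_coe, mul_one, mul_one]; simp only [mul_assoc]
    _ = (S : Mat d 𝕜) * diagR 𝕜 (x ∘ σ.symm) * (N * ((N⁻¹ : SL d 𝕜) : Mat d 𝕜))
        * ((S⁻¹ : SL d 𝕜) : Mat d 𝕜) := by rw [← h1]; simp only [mul_assoc]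
    _ = _ := by rw [SL.mul_inv_coe, mul_one]

theorem IsMonomial.Ad_mem (hF : IsFrame o τ 𝔟 (S : Mat d 𝕜) ((S⁻¹ : SL d 𝕜) : Mat d 𝕜) t s ε)
    {k : G d 𝕜} {σ : Equiv.Perm (Fin d)} (h : IsMonomial S k σ) {X : Mat d 𝕜} (hX : X ∈ 𝔟) :
    Ad k X ∈ 𝔟 := by
  obtain ⟨x, hx, rfl⟩ := (hF.mem_iff _).1 hX
  exact (hF.mem_iff _).2 ⟨x ∘ σ.symm, by rw [← hx]; exact Equiv.sum_comp σ.symm x, h.Ad_diagR x⟩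

theorem IsMonomial.inv {k : G d 𝕜} {σ : Equiv.Perm (Fin d)} (h : IsMonomial S k σ) :
    IsMonomial S k⁻¹ σ⁻¹ := by
  obtain ⟨N, p, hp, hN, rfl⟩ := h
  refine ⟨N⁻¹, fun i => (p (σ.symm i))⁻¹, fun i => by rw [norm_inv, hp, inv_one], ?_, (map_inv _ _).symm⟩
  rw [SL.coe_inv_eq]
  refine Matrix.inv_eq_right_inv ?_
  ext i j
  have hpi : ∀ i, p i ≠ 0 := fun i h => by simpa [h] using hp i
  rw [hN, ← mul_assoc, Matrix.mul_diagonal, mul_permM_apply, Matrix.mul_diagonal, permM_apply]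
  have e1 : σ (σ⁻¹ j) = j := σ.apply_symm_apply j
  have e2 : σ.symm j = σ⁻¹ j := rfl
  rw [e1, e2, Matrix.one_apply]
  split_ifs
  · rw [one_mul, mul_inv_cancel₀ (hpi _)]
  · simp

theorem IsMonomial.mem_hatW (i0 : Fin d)
    (hF : IsFrame o τ 𝔟 (S : Mat d 𝕜) ((S⁻¹ : SL d 𝕜) : Mat d 𝕜) t s ε)
    {k : G d 𝕜} {σ : Equiv.Perm (Fin d)} (h : IsMonomial S k σ) : k ∈ hatW τ 𝔟 := by
  refine ⟨?_, fun X => ⟨fun hX => ?_, h.Ad_mem hF⟩⟩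
  · obtain ⟨N, p, hp, hN, rfl⟩ := h
    rw [hF.mem_stab_τ_iff i0, hN, monomial_unitary hp]
  · have := h.inv.Ad_mem hF hX
    rwa [← Module.End.mul_apply, ← map_mul, inv_mul_cancel, map_one, Module.End.one_apply] at this

/-- The normalizer permutes the common eigenlines of 𝔟, which are the lines of the frame; unitarity
makes the nonzero entries phases. -/
theorem exists_isMonomial (i0 : Fin d)
    (hF : IsFrame o τ 𝔟 (S : Mat d 𝕜) ((S⁻¹ : SL d 𝕜) : Mat d 𝕜) t s ε)
    {k : G d 𝕜} (hk : k ∈ hatW τ 𝔟) : ∃ σ, IsMonomial S k σ := by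
  obtain ⟨N, rfl⟩ := frameHom_surjective S k
  have hN := (hF.mem_stab_τ_iff i0 N).1 hk.1
  have h1 : ∀ i, ∃ j, frameHom S N • lineOf (S : Mat d 𝕜) i = lineOf (S : Mat d 𝕜) j := by
    intro i
    rw [← hF.mem_eigenLines_iff]
    have hi := (hF.mem_eigenLines_iff _).2 ⟨i, rfl⟩
    refine ⟨by rw [finrank_smul]; exact hi.1, ?_⟩
    intro X hX v hv
    obtain ⟨w, hw, rfl⟩ := hv
    have hX' : Ad (frameHom S N) (Ad (frameHom S N⁻¹) X) = X := by
      rw [← Module.End.mul_apply, ← map_mul, ← map_mul, mul_inv_cancel, map_one, map_one,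
        Module.End.one_apply]
    have h3 := (hk.2 (Ad (frameHom S N⁻¹) X)).1 (by rw [hX']; exact hX)
    refine ⟨_, hi.2 _ h3 w hw, ?_⟩
    rw [Ad_frameHom, inv_inv]
    change ((S * N * S⁻¹ : SL d 𝕜) : Mat d 𝕜) *ᵥ _ = X *ᵥ (((S * N * S⁻¹ : SL d 𝕜) : Mat d 𝕜) *ᵥ w)
    have e : ((S * N * S⁻¹ : SL d 𝕜) : Mat d 𝕜) * ((S * N⁻¹ * S⁻¹ : SL d 𝕜) : Mat d 𝕜) = 1 := by
      rw [← Matrix.SpecialLinearGroup.coe_mul]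
      have : S * N * S⁻¹ * (S * N⁻¹ * S⁻¹) = 1 := by group
      rw [this, Matrix.SpecialLinearGroup.coe_one]
    rw [Matrix.mulVec_mulVec, Matrix.mulVec_mulVec, ← mul_assoc, ← mul_assoc, e, one_mul]
  choose f hf using h1
  have hfi : Function.Injective f := by
    intro i j hij
    apply lineOf_injective S
    apply smul_left_cancel (frameHom S N)
    rw [hf, hf, hij]
  have h2 : ∀ i, ∃ c : 𝕜, ∀ j, (N : Mat d 𝕜) j i = if j = f i then c else 0 := by
    intro i
    have h3 := hf i
    rw [frameHom_apply, toG_smul_lineOf, ← Matrix.SpecialLinearGroup.coe_mul,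
      inv_mul_cancel_right] at h3
    have h4 : ((S * N : SL d 𝕜) : Mat d 𝕜).col i ∈ lineOf (S : Mat d 𝕜) (f i) :=
      h3 ▸ Submodule.mem_span_singleton_self _
    obtain ⟨c, hc⟩ := Submodule.mem_span_singleton.1 h4
    refine ⟨c, fun j => ?_⟩
    have h5 := congrArg (fun v => (((S⁻¹ : SL d 𝕜) : Mat d 𝕜) *ᵥ v) j) hc
    simp only [Matrix.mulVec_smul, Pi.smul_apply, smul_eq_mul] at h5
    have h6 : c * (((S⁻¹ : SL d 𝕜) : Mat d 𝕜) * (S : Mat d 𝕜)) j (f i)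
        = (((S⁻¹ : SL d 𝕜) : Mat d 𝕜) * ((S * N : SL d 𝕜) : Mat d 𝕜)) j i := h5
    rw [← Matrix.SpecialLinearGroup.coe_mul, ← Matrix.SpecialLinearGroup.coe_mul, inv_mul_cancel,
      inv_mul_cancel_left, Matrix.SpecialLinearGroup.coe_one, Matrix.one_apply] at h6
    rw [← h6]; simp
  choose p hp using h2
  set σ := Equiv.ofBijective f (Finite.injective_iff_bijective.1 hfi) with hσ
  refine ⟨σ, N, p, fun i => ?_, ?_, rfl⟩
  · have h7 := congrFun (congrFun hN i) i
    rw [Matrix.mul_apply, Finset.sum_eq_single (f i)] at h7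
    · rw [Matrix.conjTranspose_apply, hp, if_pos rfl, Matrix.one_apply_eq, RCLike.star_def,
        RCLike.conj_mul] at h7
      have h8 : ‖p i‖ ^ 2 = 1 := by exact_mod_cast h7
      exact (pow_eq_one_iff_of_nonneg (norm_nonneg _) two_ne_zero).1 h8
    · intro j _ hj
      rw [hp, if_neg hj, mul_zero]
    · simp
  · ext j i
    rw [hp, Matrix.mul_diagonal, permM_apply]
    change _ = (if j = f i then (1 : 𝕜) else 0) * p i
    split_ifs <;> simp

theorem crd_weylAct_mk (hF : IsFrame o τ 𝔟 (S : Mat d 𝕜) ((S⁻¹ : SL d 𝕜) : Mat d 𝕜) t s ε)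
    (k : hatW τ 𝔟) {σ : Equiv.Perm (Fin d)} (h : IsMonomial S (k : G d 𝕜) σ) (X : 𝔟) :
    crd S (weylAct τ 𝔟 (QuotientGroup.mk k) X) = crd S X ∘ σ.symm := by
  apply hF.coord_eq
  change Ad (k : G d 𝕜) (X : Mat d 𝕜) = _
  conv_lhs => rw [hF.eq_coord X]
  exact h.Ad_diagR _

/-- The permutation taking the order `ρ` to the order `σ` is `σ * ρ⁻¹`, and a permutation of lines
acts on coordinates through its inverse. The flag `ξ` forces this permutation whichever
representative is chosen. -/
theorem crd_weylTo (i0 : Fin d) (hF : IsFrame o τ 𝔟 (S : Mat d 𝕜) ((S⁻¹ : SL d 𝕜) : Mat d 𝕜) t s ε)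
    {ξ η : FullFlag d 𝕜} {σ ρ : Equiv.Perm (Fin d)} (hξ : IsPermFlag (S : Mat d 𝕜) ξ σ)
    (hη : IsPermFlag (S : Mat d 𝕜) η ρ) (X : 𝔟) :
    crd S (weylAct τ 𝔟 (weylTo τ 𝔟 ξ η) X) = crd S X ∘ (ρ * σ⁻¹) := by
  have h := Classical.epsilon_spec
    (p := fun w : W τ 𝔟 => ∃ k : hatW τ 𝔟, QuotientGroup.mk k = w ∧ (k : G d 𝕜) • η = ξ) (by
      obtain ⟨k, hk⟩ := exists_isMonomial_perm i0 S (σ * ρ⁻¹)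
      refine ⟨_, ⟨k, hk.mem_hatW i0 hF⟩, rfl, ?_⟩
      have := hk.isPermFlag_smul hη
      rw [inv_mul_cancel_right] at this
      exact this.flag_eq hξ)
  obtain ⟨k, hk, hk'⟩ := h
  obtain ⟨π, hπ⟩ := exists_isMonomial i0 hF k.2
  have h1 := hπ.isPermFlag_smul hη
  rw [hk'] at h1
  have h2 := hξ.perm_eq (SL.inv_mul_coe S) h1
  have h3 : weylTo τ 𝔟 ξ η = QuotientGroup.mk k := hk.symm
  rw [h3, crd_weylAct_mk hF k hπ]
  have h4 : ρ * σ⁻¹ = π⁻¹ := by rw [h2]; group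
  rw [h4]; rfl

theorem re_form_smul_col (hF : IsFrame o τ 𝔟 (S : Mat d 𝕜) ((S⁻¹ : SL d 𝕜) : Mat d 𝕜) t s ε)
    (i : Fin d) (c : 𝕜) : RCLike.re (o.form (c • (S : Mat d 𝕜).col i) (c • (S : Mat d 𝕜).col i))
      = ‖c‖ ^ 2 * (s * ε i) := by
  have h1 : o.form ((S : Mat d 𝕜).col i) ((S : Mat d 𝕜).col i) = ((s * ε i : ℝ) : 𝕜) := by
    have h2 : o.form ((S : Mat d 𝕜).col i) ((S : Mat d 𝕜).col i)
        = ((S : Mat d 𝕜)ᴴ * o.mat * (S : Mat d 𝕜)) i i := by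
      rw [mul_assoc, Matrix.mul_apply]; rfl
    rw [h2, hF.conj_o, Matrix.smul_apply, diagR_apply, if_pos rfl, smul_eq_mul]
    push_cast; rfl
  have h3 : o.form (c • (S : Mat d 𝕜).col i) (c • (S : Mat d 𝕜).col i)
      = star c * c * o.form ((S : Mat d 𝕜).col i) ((S : Mat d 𝕜).col i) := by
    simp only [HermForm.form, star_smul, Matrix.mulVec_smul, smul_dotProduct, dotProduct_smul,
      smul_eq_mul]
    ring
  rw [h3, h1, RCLike.star_def, RCLike.conj_mul]
  have : (((‖c‖ : ℝ) : 𝕜) ^ 2 * ((s * ε i : ℝ) : 𝕜)) = ((‖c‖ ^ 2 * (s * ε i) : ℝ) : 𝕜) := by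
    push_cast; rfl
  rw [this, RCLike.ofReal_re]

theorem mem_posLines_iff (hF : IsFrame o τ 𝔟 (S : Mat d 𝕜) ((S⁻¹ : SL d 𝕜) : Mat d 𝕜) t s ε)
    (i : Fin d) : lineOf (S : Mat d 𝕜) i ∈ posLines 𝔟 o ↔ ε i = 1 := by
  have hs := hF.s_pos
  constructor
  · intro h
    have h1 := h.2 _ (Submodule.mem_span_singleton_self _) (col_ne_zero S i)
    have h2 := re_form_smul_col hF i 1
    rw [one_smul] at h2
    rw [h2] at h1
    rcases hF.signs i with h3 | h3
    · exact h3
    · rw [h3] at h1; simp at h1; linarith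
  · intro h
    refine ⟨(hF.mem_eigenLines_iff _).2 ⟨i, rfl⟩, fun v hv hv0 => ?_⟩
    obtain ⟨c, rfl⟩ := Submodule.mem_span_singleton.1 hv
    rw [re_form_smul_col hF, h]
    have : 0 < ‖c‖ := norm_pos_iff.2 fun h => hv0 (by rw [h, zero_smul])
    positivity

theorem mem_negLines_iff (hF : IsFrame o τ 𝔟 (S : Mat d 𝕜) ((S⁻¹ : SL d 𝕜) : Mat d 𝕜) t s ε)
    (i : Fin d) : lineOf (S : Mat d 𝕜) i ∈ negLines 𝔟 o ↔ ε i = -1 := by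
  have hs := hF.s_pos
  constructor
  · intro h
    have h1 := h.2 _ (Submodule.mem_span_singleton_self _) (col_ne_zero S i)
    have h2 := re_form_smul_col hF i 1
    rw [one_smul] at h2
    rw [h2] at h1
    rcases hF.signs i with h3 | h3
    · rw [h3] at h1; simp at h1; linarith
    · exact h3
  · intro h
    refine ⟨(hF.mem_eigenLines_iff _).2 ⟨i, rfl⟩, fun v hv hv0 => ?_⟩
    obtain ⟨c, rfl⟩ := Submodule.mem_span_singleton.1 hv
    rw [re_form_smul_col hF, h]
    have : 0 < ‖c‖ := norm_pos_iff.2 fun h => hv0 (by rw [h, zero_smul])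
    have : 0 < ‖c‖ ^ 2 * s := by positivity
    linarith

namespace IsAdaptedFrame

theorem chamberFlag_aplus
    (hA : IsAdaptedFrame o τ 𝔟 aplus bplus (S : Mat d 𝕜) ((S⁻¹ : SL d 𝕜) : Mat d 𝕜) t s ε)
    : IsPermFlag (S : Mat d 𝕜) (chamberFlag 𝔟 aplus) 1 := by
  have h := hA.toIsFrame.chamberFlag_eq (isPermFlag_one S)
  have e : aplus = {X : 𝔟 | Antitone (crd S X ∘ (1 : Equiv.Perm (Fin d)))} := hA.aplus_eq
  rw [e, h]
  exact isPermFlag_one S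

theorem precedes_iff
    (hA : IsAdaptedFrame o τ 𝔟 aplus bplus (S : Mat d 𝕜) ((S⁻¹ : SL d 𝕜) : Mat d 𝕜) t s ε)
    {i j : Fin d} (h : ε i = ε j) :
    Precedes bplus (lineOf (S : Mat d 𝕜) i) (lineOf (S : Mat d 𝕜) j) ↔ i ≤ j := by
  constructor
  · intro hP
    obtain ⟨X, hX⟩ := hA.toIsFrame.exists_strictAnti 1
    have h1 := hP X (by rw [hA.bplus_eq]; exact fun k l hkl _ => (hX hkl).le)
    rw [hA.toIsFrame.eig_lineOf, hA.toIsFrame.eig_lineOf] at h1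
    by_contra hcon
    exact absurd h1 (not_le.2 (hX (not_le.1 hcon)))
  · intro hij X hX
    rw [hA.toIsFrame.eig_lineOf, hA.toIsFrame.eig_lineOf]
    rw [hA.bplus_eq] at hX
    rcases hij.eq_or_lt with rfl | hij
    · exact le_rfl
    · exact hX i j hij h

theorem exists_of_compatibleFlag
    (hA : IsAdaptedFrame o τ 𝔟 aplus bplus (S : Mat d 𝕜) ((S⁻¹ : SL d 𝕜) : Mat d 𝕜) t s ε)
    {ξ : FullFlag d 𝕜} (h : IsCompatibleFlag 𝔟 bplus ξ) :
    ∃ σ, IsPermFlag (S : Mat d 𝕜) ξ σ ∧ ∀ i j, i < j → ε (σ i) = ε (σ j) → σ i < σ j := by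
  obtain ⟨c, hc, hξ⟩ := h
  obtain ⟨σ, hσ, hξσ⟩ := (hA.toIsFrame.isFlagOfChamber_iff _ _).1 hξ
  refine ⟨σ, hξσ, fun i j hij hε => ?_⟩
  obtain ⟨X, hX⟩ := hA.toIsFrame.exists_strictAnti σ
  have h1 : X ∈ bplus := hc.2 (by rw [hσ]; exact hX.antitone)
  rw [hA.bplus_eq] at h1
  by_contra hcon
  have hne : σ j < σ i := lt_of_le_of_ne (not_lt.1 hcon) fun h => hij.ne' (σ.injective h)
  exact absurd (h1 _ _ hne hε.symm) (not_le.2 (hX hij))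

/-- The opposition permutes the lines by some `ω`, hence ι acts on coordinates by `x ↦ -(x ∘ ω⁻¹)`.
Changing sign reverses the order, so a chamber of order `σ` goes to the chamber of order `ω * σ *
Fin.revPerm`. -/
theorem exists_iotaFlag
    (hA : IsAdaptedFrame o τ 𝔟 aplus bplus (S : Mat d 𝕜) ((S⁻¹ : SL d 𝕜) : Mat d 𝕜) t s ε)
    (i0 : Fin d) {ξ : FullFlag d 𝕜} {σ : Equiv.Perm (Fin d)}
    (hξ : IsPermFlag (S : Mat d 𝕜) ξ σ) : ∃ ω : Equiv.Perm (Fin d), (∀ i, ε (ω i) = ε i) ∧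
      (∀ i j, i < j → ε i = ε j → ω j < ω i) ∧
      IsPermFlag (S : Mat d 𝕜) (iotaFlag τ 𝔟 o bplus ξ) (ω * σ * Fin.revPerm) := by
  have hF := hA.toIsFrame
  have hlines : ∀ l ∈ eigenLines 𝔟, ∃ i, l = lineOf (S : Mat d 𝕜) i := fun l hl =>
    (hF.mem_eigenLines_iff l).1 hl
  -- An opposition must be exhibited before the chosen `wOpp` can be used; it comes from the sorting
  -- permutation of the signs.
  have hspec := Classical.epsilon_spec (p := fun w => IsOpposition τ 𝔟 o bplus w) (by
    obtain ⟨ω, h1, h2⟩ := exists_opposition_perm ε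
    obtain ⟨k, hk⟩ := exists_isMonomial_perm i0 S ω
    have hrev : ∀ i j, ε i = ε j → i ≤ j → ω j ≤ ω i := by
      intro i j hε hij
      rcases hij.eq_or_lt with rfl | hij
      · exact le_rfl
      · exact (h2 i j hij hε).le
    refine ⟨_, ⟨k, hk.mem_hatW i0 hF⟩, rfl, ?_, ?_, ?_, ?_⟩
    · intro l hl
      obtain ⟨i, rfl⟩ := hlines l hl.1
      change k • _ ∈ _
      rw [hk.smul_lineOf, mem_posLines_iff hF, h1]
      exact (mem_posLines_iff hF i).1 hl
    · intro l hl
      obtain ⟨i, rfl⟩ := hlines l hl.1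
      change k • _ ∈ _
      rw [hk.smul_lineOf, mem_negLines_iff hF, h1]
      exact (mem_negLines_iff hF i).1 hl
    · intro l hl l' hl' h
      obtain ⟨i, rfl⟩ := hlines l hl.1
      obtain ⟨j, rfl⟩ := hlines l' hl'.1
      rw [mem_posLines_iff hF] at hl hl'
      change Precedes bplus (k • _) (k • _)
      have hε : ε i = ε j := by rw [hl, hl']
      rw [hA.precedes_iff hε] at h
      rw [hk.smul_lineOf, hk.smul_lineOf, hA.precedes_iff (by rw [h1, h1, hε])]
      exact hrev i j hε h
    · intro l hl l' hl' h
      obtain ⟨i, rfl⟩ := hlines l hl.1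
      obtain ⟨j, rfl⟩ := hlines l' hl'.1
      rw [mem_negLines_iff hF] at hl hl'
      change Precedes bplus (k • _) (k • _)
      have hε : ε i = ε j := by rw [hl, hl']
      rw [hA.precedes_iff hε] at h
      rw [hk.smul_lineOf, hk.smul_lineOf, hA.precedes_iff (by rw [h1, h1, hε])]
      exact hrev i j hε h)
  obtain ⟨k, hk, hp, hn, hpp, hnn⟩ := hspec
  obtain ⟨ω, hω⟩ := exists_isMonomial i0 hF k.2
  have hεω : ∀ i, ε (ω i) = ε i := by
    intro i
    rcases hF.signs i with h | h
    · have := hp _ ((mem_posLines_iff hF i).2 h)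
      rw [hω.smul_lineOf, mem_posLines_iff hF] at this
      rw [this, h]
    · have := hn _ ((mem_negLines_iff hF i).2 h)
      rw [hω.smul_lineOf, mem_negLines_iff hF] at this
      rw [this, h]
  refine ⟨ω, hεω, fun i j hij hε => ?_, ?_⟩
  · refine lt_of_le_of_ne ?_ fun h => hij.ne' (ω.injective h)
    have hε' : ε (ω j) = ε (ω i) := by rw [hεω, hεω, hε]
    rw [← hA.precedes_iff hε', ← hω.smul_lineOf, ← hω.smul_lineOf]
    have hpre := (hA.precedes_iff hε).2 hij.le
    rcases hF.signs i with h | h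
    · exact hpp _ ((mem_posLines_iff hF i).2 h) _ ((mem_posLines_iff hF j).2 (hε ▸ h)) hpre
    · exact hnn _ ((mem_negLines_iff hF i).2 h) _ ((mem_negLines_iff hF j).2 (hε ▸ h)) hpre
  · have hw : wOpp τ 𝔟 o bplus = QuotientGroup.mk k := hk.symm
    have hio : ∀ X, crd S (iota τ 𝔟 o bplus X) = -(crd S X ∘ ω.symm) := by
      intro X
      rw [iota, hw, map_neg, crd_weylAct_mk hF k hω]
    obtain ⟨η, hη⟩ := exists_isPermFlag i0 S (ω * σ * Fin.revPerm)
    have hset : iota τ 𝔟 o bplus '' flagChamber 𝔟 ξ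
        = {Y : 𝔟 | Antitone (crd S Y ∘ (ω * σ * Fin.revPerm : Equiv.Perm (Fin d)))} := by
      rw [hF.flagChamber_eq hξ]
      ext Y
      constructor
      · rintro ⟨X, hX, rfl⟩ i j hij
        rw [hio]
        simp only [Function.comp_apply, Pi.neg_apply, Equiv.Perm.mul_apply, Equiv.symm_apply_apply,
          Fin.revPerm_apply]
        exact neg_le_neg (hX (Fin.rev_le_rev.2 hij))
      · intro hY
        obtain ⟨X, hX⟩ := hF.exists_coord (x := -(crd S Y ∘ ω)) (by
          simp only [Pi.neg_apply, Finset.sum_neg_distrib, Function.comp_apply]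
          rw [Equiv.sum_comp ω fun i => crd S Y i, hF.sum_coord Y, neg_zero])
        refine ⟨X, fun i j hij => ?_, hF.coord_injective ?_⟩
        · have := hY (Fin.rev_le_rev.2 hij)
          simp only [Function.comp_apply, Equiv.Perm.mul_apply, Fin.revPerm_apply, Fin.rev_rev] at this
          simp only [crd, hX, Function.comp_apply, Pi.neg_apply]
          exact neg_le_neg this
        · have := hio X
          refine this.trans ?_
          simp only [crd, hX]
          funext i; simp
    rw [iotaFlag, hset, hF.chamberFlag_eq hη]
    exact hη

theorem lt_of_posRoots
    (hA : IsAdaptedFrame o τ 𝔟 aplus bplus (S : Mat d 𝕜) ((S⁻¹ : SL d 𝕜) : Mat d 𝕜) t s ε)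
    {L : ℝ} {X : 𝔟} (h : ∀ α ∈ posRoots 𝔟 aplus, L < α X) {i j : Fin d}
    (hij : i < j) : L < crd S X i - crd S X j := by
  obtain ⟨α, hα⟩ := IsFrame.exists_dual (𝔟 := 𝔟) (P := (S : Mat d 𝕜))
    (P' := ((S⁻¹ : SL d 𝕜) : Mat d 𝕜)) i j
  have := h α ⟨hA.toIsFrame.root_lieG hij.ne hα, fun Y hY => by
    rw [hA.aplus_eq] at hY
    rw [hα]
    exact sub_nonneg.2 (hY hij.le)⟩
  rwa [hα] at this

/-- Lifts to SL(V) the very decomposition selected in the definitions of the Cartan projection and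
attractor, so that `K` and the exponent belong together. -/
theorem exists_cartan
    (hA : IsAdaptedFrame o τ 𝔟 aplus bplus (S : Mat d 𝕜) ((S⁻¹ : SL d 𝕜) : Mat d 𝕜) t s ε)
    (i0 : Fin d) (B : SL d 𝕜) : ∃ K L : SL d 𝕜,
    (K : Mat d 𝕜)ᴴ * (K : Mat d 𝕜) = 1 ∧ (L : Mat d 𝕜)ᴴ * (L : Mat d 𝕜) = 1 ∧
    Antitone (crd S (cartanProj τ 𝔟 aplus (frameHom S B))) ∧
    (B : Mat d 𝕜) = K * expD 𝕜 (crd S (cartanProj τ 𝔟 aplus (frameHom S B))) * L ∧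
    attractor τ 𝔟 aplus (frameHom S B) = toG (S * K) • stdFlag := by
  have hF := hA.toIsFrame
  have h := Classical.epsilon_spec (p := fun t => IsCartanDecomp τ 𝔟 aplus (frameHom S B) t) (by
    obtain ⟨K, L, a, hK, hKd, hL, hLd, ha, ha0, hB⟩ := exists_cartan_decomp i0 B.2
    obtain ⟨X, hX⟩ := hF.exists_coord ha0
    obtain ⟨K, rfl⟩ : ∃ K' : SL d 𝕜, (K' : Mat d 𝕜) = K := ⟨⟨K, hKd⟩, rfl⟩
    obtain ⟨L, rfl⟩ : ∃ L' : SL d 𝕜, (L' : Mat d 𝕜) = L := ⟨⟨L, hLd⟩, rfl⟩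
    refine ⟨(frameHom S K, X, frameHom S L), (hF.mem_stab_τ_iff i0 _).2 hK, ?_,
      (hF.mem_stab_τ_iff i0 _).2 hL, ?_⟩
    · rw [hA.aplus_eq]
      change Antitone (coord _ _ X)
      rw [hX]; exact ha
    · change _ = frameHom S K * expG (X : Mat d 𝕜) * frameHom S L
      rw [hF.expG_eq, ← map_mul, ← map_mul]
      congr 1
      apply Subtype.ext
      rw [hB]
      change _ = K * expD 𝕜 (crd S X) * L
      rw [show crd S X = a from hX])
  obtain ⟨hk, ha, hl, hg⟩ := h
  change _ = _ * expG (cartanProj τ 𝔟 aplus (frameHom S B) : Mat d 𝕜) * _ at hg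
  change cartanProj τ 𝔟 aplus (frameHom S B) ∈ aplus at ha
  obtain ⟨K, hK⟩ := frameHom_surjective S (cartanDecomp τ 𝔟 aplus (frameHom S B)).1
  obtain ⟨L, hL⟩ := frameHom_surjective S (cartanDecomp τ 𝔟 aplus (frameHom S B)).2.2
  change (cartanDecomp τ 𝔟 aplus (frameHom S B)).1 ∈ _ at hk
  change (cartanDecomp τ 𝔟 aplus (frameHom S B)).2.2 ∈ _ at hl
  rw [← hK, hF.mem_stab_τ_iff i0] at hk
  rw [← hL, hF.mem_stab_τ_iff i0] at hl
  have hg' : frameHom S B = frameHom S (K * expSL 𝕜 (crd S (cartanProj τ 𝔟 aplus (frameHom S B)))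
      (hF.sum_coord _) * L) := by
    rw [map_mul, map_mul, hK, hL, ← hF.expG_eq]
    exact hg
  -- Equality in G leaves a root of unity, absorbed into the right factor so that `K`, hence the
  -- attractor, is untouched.
  obtain ⟨r, hr1, hr⟩ := frameHom_eq _ _ _ hg'.symm
  have hrn := norm_eq_one_of_pow i0 hr1
  refine ⟨K, ⟨r • (L : Mat d 𝕜), by rw [Matrix.det_smul, L.2, mul_one, Fintype.card_fin, hr1]⟩, hk, ?_,
    ?_, ?_, ?_⟩
  · change (r • (L : Mat d 𝕜))ᴴ * (r • (L : Mat d 𝕜)) = 1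
    rw [Matrix.conjTranspose_smul, Matrix.smul_mul, Matrix.mul_smul, hl, smul_smul, RCLike.star_def,
      RCLike.conj_mul, hrn]
    simp
  · have h2 : ∀ X ∈ aplus, Antitone (crd S X) := fun X hX => by
      rw [hA.aplus_eq] at hX; exact hX
    exact h2 _ ha
  · rw [hr]
    change r • ((K : Mat d 𝕜) * expD 𝕜 _ * (L : Mat d 𝕜)) = _ * (r • (L : Mat d 𝕜))
    rw [Matrix.mul_smul]
  · have h1 : attractor τ 𝔟 aplus (frameHom S B) = frameHom S K • chamberFlag 𝔟 aplus := by
      rw [hK]; rfl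
    rw [h1, hA.chamberFlag_aplus.flag_eq (isPermFlag_one S), frameHom_apply, ← mul_smul, ← map_mul,
      inv_mul_cancel_right]

end IsAdaptedFrame

end WeylTranslation

/-! ### Leading minors as functions of the flag -/

section FlagMinors

theorem sum_castLE {j : ℕ} (h : j ≤ d) {f : Fin d → 𝕜} (hf : ∀ k : Fin d, j ≤ k → f k = 0) :
    ∑ k : Fin j, f (Fin.castLE h k) = ∑ k, f k := by
  refine Fintype.sum_of_injective (Fin.castLE h) (Fin.castLE_injective h) _ _ (fun k hk => ?_)
    fun _ => rfl
  refine hf k (not_lt.1 fun hlt => hk ⟨⟨k, hlt⟩, rfl⟩)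

theorem submatrix_mul_upper {R : Mat d 𝕜} (hR : ∀ i k, i < k → R k i = 0) (M : Mat d 𝕜) {j : ℕ}
    (h : j ≤ d) : (M * R).submatrix (Fin.castLE h) (Fin.castLE h)
      = M.submatrix (Fin.castLE h) (Fin.castLE h) * R.submatrix (Fin.castLE h) (Fin.castLE h) := by
  ext i k
  rw [Matrix.submatrix_apply, Matrix.mul_apply, Matrix.mul_apply]
  refine (sum_castLE h (f := fun l => M (Fin.castLE h i) l * R l (Fin.castLE h k)) fun l hl => ?_).symm
  rw [hR _ _ (Fin.lt_def.2 (lt_of_lt_of_le k.2 hl)), mul_zero]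

/-- An upper triangular matrix preserves the span of the first `j` vectors, so the restricted form
only undergoes a change of basis. -/
theorem leadMinor_conj_upper {R : Mat d 𝕜} (hR : ∀ i k, i < k → R k i = 0) (N : Mat d 𝕜) (j : ℕ)
    (h : j ≤ d) : leadMinor (Rᴴ * N * R) j h
      = ((‖(R.submatrix (Fin.castLE h) (Fin.castLE h)).det‖ ^ 2 : ℝ) : 𝕜) * leadMinor N j h := by
  have h1 : (Rᴴ * N).submatrix (Fin.castLE h) (Fin.castLE h)
      = (R.submatrix (Fin.castLE h) (Fin.castLE h))ᴴ * N.submatrix (Fin.castLE h) (Fin.castLE h) := by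
    have h2 := congrArg Matrix.conjTranspose (submatrix_mul_upper hR Nᴴ h)
    rw [Matrix.conjTranspose_submatrix, Matrix.conjTranspose_mul, Matrix.conjTranspose_conjTranspose,
      Matrix.conjTranspose_mul, Matrix.conjTranspose_submatrix, Matrix.conjTranspose_submatrix,
      Matrix.conjTranspose_conjTranspose] at h2
    rw [h2, Matrix.conjTranspose_submatrix]
  rw [leadMinor, submatrix_mul_upper hR, h1, Matrix.det_mul, Matrix.det_mul, Matrix.det_conjTranspose,
    leadMinor, mul_right_comm, RCLike.star_def, RCLike.conj_mul]
  push_cast; rfl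

theorem upper_of_smul_stdFlag {R : SL d 𝕜} (h : toG R • (stdFlag : FullFlag d 𝕜) = stdFlag)
    (i k : Fin d) (hik : i < k) : (R : Mat d 𝕜) k i = 0 := by
  have h1 : (R : Mat d 𝕜).col i ∈ (toG R • (stdFlag : FullFlag d 𝕜)).sub i.succ := by
    rw [smul_stdFlag_sub]
    exact Submodule.mem_iSup_of_mem i (Submodule.mem_iSup_of_mem Fin.castSucc_lt_succ
      (Submodule.mem_span_singleton_self _))
  rw [h, stdFlag_sub] at h1
  have h2 : (⨆ l : Fin d, ⨆ _ : l.castSucc < i.succ, lineOf (1 : Mat d 𝕜) l) ≤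
      LinearMap.ker (LinearMap.proj k : (Fin d → 𝕜) →ₗ[𝕜] 𝕜) := by
    refine iSup₂_le fun l hl => ?_
    rw [lineOf, Submodule.span_singleton_le_iff_mem, LinearMap.mem_ker]
    change (1 : Mat d 𝕜) k l = 0
    rw [Fin.castSucc_lt_succ_iff] at hl
    exact Matrix.one_apply_ne (lt_of_le_of_lt hl hik).ne'
  exact h2 h1

/-- Two bases of the same flag differ by an upper triangular matrix. The factor `c` does not depend
on the form `N`, so signs of minors, and ratios of minors of two forms, depend only on the flag. -/
theorem exists_upper {S B B' : SL d 𝕜}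
    (h : toG (S * B) • (stdFlag : FullFlag d 𝕜) = toG (S * B') • stdFlag) (j : ℕ) (hj : j ≤ d) :
    ∃ c : ℝ, 0 < c ∧ ∀ N : Mat d 𝕜, leadMinor ((B' : Mat d 𝕜)ᴴ * N * (B' : Mat d 𝕜)) j hj
      = (c : 𝕜) * leadMinor ((B : Mat d 𝕜)ᴴ * N * (B : Mat d 𝕜)) j hj := by
  obtain ⟨R, rfl⟩ : ∃ R, B' = B * R := ⟨B⁻¹ * B', by group⟩
  rw [← mul_assoc, map_mul toG (S * B) R, mul_smul] at h
  have h1 := (smul_left_cancel _ h).symm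
  have h2 : toG R⁻¹ • (stdFlag : FullFlag d 𝕜) = stdFlag := by
    rw [map_inv, inv_smul_eq_iff]; exact h1.symm
  have hR := upper_of_smul_stdFlag h1
  have hR' := upper_of_smul_stdFlag h2
  have hne : ((R : Mat d 𝕜).submatrix (Fin.castLE hj) (Fin.castLE hj)).det ≠ 0 := by
    intro h0
    have h3 := congrArg Matrix.det (submatrix_mul_upper hR' (R : Mat d 𝕜) hj)
    rw [SL.mul_inv_coe, Matrix.det_mul, h0, zero_mul, Matrix.submatrix_one _ (Fin.castLE_injective hj),
      Matrix.det_one] at h3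
    exact one_ne_zero h3
  refine ⟨_, pow_pos (norm_pos_iff.2 hne) 2, fun N => ?_⟩
  rw [← leadMinor_conj_upper hR]
  congr 1
  rw [Matrix.SpecialLinearGroup.coe_mul, Matrix.conjTranspose_mul]
  simp only [mul_assoc]

theorem continuous_leadMinor_conj (S : SL d 𝕜) (N : Mat d 𝕜) (j : ℕ) (h : j ≤ d) :
    Continuous fun A : SL d 𝕜 => leadMinor (((S⁻¹ * A : SL d 𝕜) : Mat d 𝕜)ᴴ * N
      * ((S⁻¹ * A : SL d 𝕜) : Mat d 𝕜)) j h := by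
  have h1 : Continuous fun A : SL d 𝕜 => ((S⁻¹ * A : SL d 𝕜) : Mat d 𝕜) := by
    simp only [Matrix.SpecialLinearGroup.coe_mul]
    exact continuous_const.matrix_mul continuous_subtype_val
  exact (((h1.matrix_conjTranspose.matrix_mul continuous_const).matrix_mul h1).matrix_submatrix
    _ _).matrix_det

/-- On a compact set of flags where all leading minors are nonzero, they are bounded below. -/
theorem exists_minor_bound (S : SL d 𝕜) (N : Mat d 𝕜) {C : Set (FullFlag d 𝕜)} (hC : IsCompact C)
    (h : ∀ B : SL d 𝕜, toG (S * B) • stdFlag ∈ C → ∀ j hj,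
      leadMinor ((B : Mat d 𝕜)ᴴ * N * (B : Mat d 𝕜)) j hj ≠ 0) :
    ∃ δ : ℝ, 0 < δ ∧ ∀ K : SL d 𝕜, (K : Mat d 𝕜)ᴴ * (K : Mat d 𝕜) = 1 →
      toG (S * K) • stdFlag ∈ C → ∀ j hj,
        δ ≤ ‖leadMinor ((K : Mat d 𝕜)ᴴ * N * (K : Mat d 𝕜)) j hj‖ := by
  -- The minor of `N` is compared with that of the identity, since this ratio depends only on the
  -- flag; for a unitary representative the reference minor is 1.
  set P : ℕ → SL d 𝕜 → Prop := fun n B => ∀ j : Fin (d + 1), ((n : ℝ) + 1)⁻¹ *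
    ‖leadMinor ((B : Mat d 𝕜)ᴴ * 1 * (B : Mat d 𝕜)) j (Nat.lt_succ_iff.1 j.2)‖ <
      ‖leadMinor ((B : Mat d 𝕜)ᴴ * N * (B : Mat d 𝕜)) j (Nat.lt_succ_iff.1 j.2)‖ with hP
  have hinv : ∀ n B B', toG (S * B) • (stdFlag : FullFlag d 𝕜) = toG (S * B') • stdFlag →
      P n B → P n B' := by
    intro n B B' hBB hB j
    obtain ⟨c, hc, hc'⟩ := exists_upper hBB j (Nat.lt_succ_iff.1 j.2)
    rw [hc', hc', norm_mul, norm_mul, RCLike.norm_ofReal, abs_of_pos hc, mul_left_comm]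
    exact mul_lt_mul_of_pos_left (hB j) hc
  set U : ℕ → Set (FullFlag d 𝕜) := fun n => {ξ | ∀ B, toG (S * B) • stdFlag = ξ → P n B} with hU
  -- The topology of flags is coinduced from SL(V), so openness is checked on representatives, where
  -- the minors are continuous.
  have hopen : ∀ n, IsOpen (U n) := by
    intro n
    refine isOpen_coinduced.2 ?_
    have : (fun A : SL d 𝕜 => toG A • (stdFlag : FullFlag d 𝕜)) ⁻¹' U n = {A | P n (S⁻¹ * A)} := by
      ext A
      constructor
      · intro hA
        exact hA (S⁻¹ * A) (by rw [mul_inv_cancel_left])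
      · intro hA B hB
        exact hinv n _ _ (by rw [mul_inv_cancel_left]; exact hB.symm) hA
    refine Eq.mpr (congrArg IsOpen this) ?_
    simp only [hP, Set.ofPred_forall]
    refine isOpen_iInter_of_finite fun j => ?_
    exact isOpen_lt (continuous_const.mul (continuous_leadMinor_conj S 1 _ _).norm)
      (continuous_leadMinor_conj S N _ _).norm
  have hmono : Monotone U := by
    intro m n hmn ξ hξ B hB j
    refine lt_of_le_of_lt ?_ (hξ B hB j)
    refine mul_le_mul_of_nonneg_right ?_ (norm_nonneg _)
    refine inv_anti₀ (by positivity) ?_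
    have : (m : ℝ) ≤ n := by exact_mod_cast hmn
    linarith
  have hcover : C ⊆ ⋃ n, U n := by
    intro ξ hξ
    by_cases hB : ∃ B, toG (S * B) • stdFlag = ξ
    · obtain ⟨B, rfl⟩ := hB
      have hlim : ∀ j : Fin (d + 1), ∀ᶠ n : ℕ in atTop, ((n : ℝ) + 1)⁻¹ *
          ‖leadMinor ((B : Mat d 𝕜)ᴴ * 1 * (B : Mat d 𝕜)) j (Nat.lt_succ_iff.1 j.2)‖ <
          ‖leadMinor ((B : Mat d 𝕜)ᴴ * N * (B : Mat d 𝕜)) j (Nat.lt_succ_iff.1 j.2)‖ := by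
        intro j
        have h1 : Tendsto (fun n : ℕ => ((n : ℝ) + 1)⁻¹ *
            ‖leadMinor ((B : Mat d 𝕜)ᴴ * 1 * (B : Mat d 𝕜)) j (Nat.lt_succ_iff.1 j.2)‖) atTop
            (𝓝 (0 *
            ‖leadMinor ((B : Mat d 𝕜)ᴴ * 1 * (B : Mat d 𝕜)) j (Nat.lt_succ_iff.1 j.2)‖)) := by
          refine Tendsto.mul_const _ ?_
          simpa using tendsto_one_div_add_atTop_nhds_zero_nat (𝕜 := ℝ)
        rw [zero_mul] at h1
        exact h1.eventually_lt_const (norm_pos_iff.2 (h B hξ j _))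
      obtain ⟨n, hn⟩ := (eventually_all.2 hlim).exists
      refine Set.mem_iUnion.2 ⟨n, fun B' hB' => hinv n B B' hB'.symm hn⟩
    -- A flag without representative satisfies the condition vacuously, so transitivity on flags is
    -- not needed.
    · exact Set.mem_iUnion.2 ⟨0, fun B hB' => absurd ⟨B, hB'⟩ hB⟩
  obtain ⟨n, hn⟩ := hC.elim_directed_cover U hopen hcover hmono.directed_le
  refine ⟨((n : ℝ) + 1)⁻¹, by positivity, fun K hK hKC j hj => ?_⟩
  have h1 := hn hKC K rfl ⟨j, Nat.lt_succ_iff.2 hj⟩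
  rw [mul_one, hK] at h1
  have h2 : leadMinor (1 : Mat d 𝕜) j hj = 1 := by
    rw [leadMinor, Matrix.submatrix_one _ (Fin.castLE_injective hj), Matrix.det_one]
  simp only [h2, norm_one, mul_one] at h1
  exact h1.le

theorem leadMinor_diagR (x : Fin d → ℝ) (j : ℕ) (h : j ≤ d) :
    leadMinor (diagR 𝕜 x) j h = ((∏ i : Fin j, x (Fin.castLE h i) : ℝ) : 𝕜) := by
  rw [leadMinor, diagR, Matrix.submatrix_diagonal _ _ (Fin.castLE_injective h), Matrix.det_diagonal]
  push_cast; rfl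

theorem HermForm.form_symm (o : HermForm d 𝕜) (u v : Fin d → 𝕜) : star (o.form u v) = o.form v u := by
  rw [HermForm.form, HermForm.form, ← Matrix.star_dotProduct, Matrix.star_mulVec, o.isHermitian.eq,
    Matrix.dotProduct_mulVec]

variable {𝔟 : LieSubalgebra ℝ (Mat d 𝕜)} {o τ : HermForm d 𝕜} {S : SL d 𝕜} {t s : ℝ}
  {ε : Fin d → ℝ}

/-- The orbit flag has a representative of the form isometry times monomial matrix, for which the
form is exactly `diag (ε ∘ σ)`; any other representative changes the minors by positive factors. -/
theorem IsFrame.leadMinor_of_orbit (i0 : Fin d)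
    (hF : IsFrame o τ 𝔟 (S : Mat d 𝕜) ((S⁻¹ : SL d 𝕜) : Mat d 𝕜) t s ε) {ξ η : FullFlag d 𝕜}
    {σ : Equiv.Perm (Fin d)} (hξ : IsPermFlag (S : Mat d 𝕜) ξ σ) (hη : η ∈ o.orbit ξ) {B : SL d 𝕜}
    (hB : toG (S * B) • stdFlag = η) (j : ℕ) (h : j ≤ d) : ∃ c : ℝ, 0 < c ∧
      leadMinor ((B : Mat d 𝕜)ᴴ * diagR 𝕜 ε * (B : Mat d 𝕜)) j h
        = ((c * ∏ i : Fin j, ε (σ (Fin.castLE h i)) : ℝ) : 𝕜) := by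
  obtain ⟨g, hg, rfl⟩ := hη
  obtain ⟨H, rfl⟩ := frameHom_surjective S g
  rw [hF.mem_stab_o_iff i0] at hg
  obtain ⟨N, p, hp, hN⟩ := exists_permSL 𝕜 i0 σ
  rw [hξ.flag_eq (isPermFlag_smul S N hp hN), frameHom_apply, ← mul_smul, ← map_mul,
    show S * H * S⁻¹ * (S * N) = S * (H * N) by group] at hB
  obtain ⟨c, hc, hcN⟩ := exists_upper hB.symm j h
  refine ⟨c, hc, ?_⟩
  have h1 : ((H * N : SL d 𝕜) : Mat d 𝕜)ᴴ * diagR 𝕜 ε * ((H * N : SL d 𝕜) : Mat d 𝕜)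
      = diagR 𝕜 (ε ∘ σ) := by
    rw [Matrix.SpecialLinearGroup.coe_mul, Matrix.conjTranspose_mul]
    calc (N : Mat d 𝕜)ᴴ * (H : Mat d 𝕜)ᴴ * diagR 𝕜 ε * (H * N)
        = (N : Mat d 𝕜)ᴴ * ((H : Mat d 𝕜)ᴴ * diagR 𝕜 ε * H) * N := by simp only [mul_assoc]
      _ = _ := by
        rw [hg, hN, mul_assoc, diagR_mul_monomial, ← mul_assoc, monomial_unitary hp, one_mul]
  rw [hcN, h1, leadMinor_diagR]
  push_cast; rfl

/-- A vector killed by the leading block, extended by zero, gives a nonzero vector of `ξʲ`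
orthogonal to `ξʲ`. -/
theorem IsFrame.leadMinor_ne_zero_of_generic
    (hF : IsFrame o τ 𝔟 (S : Mat d 𝕜) ((S⁻¹ : SL d 𝕜) : Mat d 𝕜) t s ε) {B : SL d 𝕜}
    (hB : toG (S * B) • stdFlag ∈ o.generic) (j : ℕ) (h : j ≤ d) :
    leadMinor ((B : Mat d 𝕜)ᴴ * diagR 𝕜 ε * (B : Mat d 𝕜)) j h ≠ 0 := by
  intro h0
  set N := (B : Mat d 𝕜)ᴴ * diagR 𝕜 ε * (B : Mat d 𝕜) with hN
  set A := ((S * B : SL d 𝕜) : Mat d 𝕜) with hA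
  have hAN : Aᴴ * o.mat * A = (s : 𝕜) • N := by
    rw [hA, Matrix.SpecialLinearGroup.coe_mul, Matrix.conjTranspose_mul]
    calc (B : Mat d 𝕜)ᴴ * (S : Mat d 𝕜)ᴴ * o.mat * (S * B)
        = (B : Mat d 𝕜)ᴴ * ((S : Mat d 𝕜)ᴴ * o.mat * S) * B := by simp only [mul_assoc]
      _ = _ := by rw [hF.conj_o, Matrix.mul_smul, Matrix.smul_mul]
  obtain ⟨c, hc0, hc⟩ := Matrix.exists_mulVec_eq_zero_iff.2 h0
  set x : Fin d → 𝕜 := fun k => if hk : (k : ℕ) < j then c ⟨k, hk⟩ else 0 with hx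
  have hxc : ∀ k : Fin j, x (Fin.castLE h k) = c k := fun k => by simp [hx]
  have hx0 : ∀ k : Fin d, j ≤ k → x k = 0 := fun k hk => by simp [hx, not_lt.2 hk]
  set ξ : FullFlag d 𝕜 := toG (S * B) • stdFlag with hξ
  have hmem : A *ᵥ x ∈ ξ.sub ⟨j, Nat.lt_succ_iff.2 h⟩ := by
    rw [hξ, smul_stdFlag_sub]
    have h1 : A *ᵥ x = ∑ k, x k • A.col k := by
      ext i
      simp [Matrix.mulVec, dotProduct, mul_comm]
    rw [h1]
    refine Submodule.sum_mem _ fun k _ => ?_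
    by_cases hk : (k : ℕ) < j
    · refine Submodule.smul_mem _ _ (Submodule.mem_iSup_of_mem k (Submodule.mem_iSup_of_mem ?_
        (Submodule.mem_span_singleton_self _)))
      exact hk
    · rw [hx0 k (not_lt.1 hk), zero_smul]; exact Submodule.zero_mem _
  have horth : ξ.sub ⟨j, Nat.lt_succ_iff.2 h⟩ ≤ o.perp (Submodule.span 𝕜 {A *ᵥ x}) := by
    rw [hξ, smul_stdFlag_sub]
    refine iSup₂_le fun l hl => ?_
    rw [lineOf, Submodule.span_singleton_le_iff_mem]
    intro u hu
    obtain ⟨a, rfl⟩ := Submodule.mem_span_singleton.1 hu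
    rw [← o.form_symm]
    have h2 : o.form (A.col l) (A *ᵥ x) = (s : 𝕜) * (N *ᵥ x) l := by
      have : o.form (A.col l) (A *ᵥ x) = ((Aᴴ * o.mat * A) *ᵥ x) l := by
        rw [mul_assoc, ← Matrix.mulVec_mulVec, ← Matrix.mulVec_mulVec]
        rfl
      rw [this, hAN, Matrix.smul_mulVec]
      rfl
    have h3 : (N *ᵥ x) l = 0 := by
      have h4 := congrFun hc ⟨l, hl⟩
      refine Eq.trans ?_ h4
      refine (sum_castLE h (f := fun k => N l k * x k) fun k hk => ?_).symm.trans ?_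
      · rw [hx0 k hk, mul_zero]
      · refine Finset.sum_congr rfl fun k _ => ?_
        rw [hxc]; rfl
    have h5 : o.form (A.col l) (a • (A *ᵥ x)) = a * o.form (A.col l) (A *ᵥ x) := by
      simp [HermForm.form, Matrix.mulVec_smul]
    rw [h5, h2, h3]
    simp
  have hperp : A *ᵥ x ∈ o.perp (ξ.sub ⟨j, Nat.lt_succ_iff.2 h⟩) := by
    intro u hu
    rw [← o.form_symm, horth hu _ (Submodule.mem_span_singleton_self _), star_zero]
  have hd := hB ⟨j, Nat.lt_succ_iff.2 h⟩
  rw [HermForm.perpFlag, Fin.rev_rev] at hd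
  have h6 := Submodule.disjoint_def.1 hd _ hmem hperp
  have h7 : x = 0 := by
    have := congrArg (fun v => (((S * B)⁻¹ : SL d 𝕜) : Mat d 𝕜) *ᵥ v) h6
    simpa only [Matrix.mulVec_mulVec, hA, SL.inv_mul_coe, Matrix.one_mulVec, Matrix.mulVec_zero]
      using this
  apply hc0
  funext k
  rw [← hxc, h7]; rfl

end FlagMinors

/-! ### From a diagonalized pencil to the (p,q)-Cartan projection -/

section Diagonalization

/-- The columns of `Q` are orthogonal for the form `ε`, as are their images by `B`, with
eigenvalues of decreasing moduli. -/
structure IsPencilDiag (B Q : SL d 𝕜) (ε ε' μ : Fin d → ℝ) : Prop where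
  signs : IsSigns ε
  signs' : IsSigns ε'
  conj : (Q : Mat d 𝕜)ᴴ * diagR 𝕜 ε * Q = diagR 𝕜 ε'
  conj_mul : ((B * Q : SL d 𝕜) : Mat d 𝕜)ᴴ * diagR 𝕜 ε * ((B * Q : SL d 𝕜) : Mat d 𝕜)
    = diagR 𝕜 (μ * ε')
  ne_zero : ∀ i, μ i ≠ 0
  abs_lt : ∀ i j, i < j → |μ j| < |μ i|

variable {B Q : SL d 𝕜} {ε ε' μ : Fin d → ℝ}

/-- The relation between the two sign forms gives `Q` a determinant of modulus 1, and a diagonal of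
phases corrects it without disturbing the diagonal forms. -/
theorem exists_isPencilDiag (i0 : Fin d) {Q : Mat d 𝕜} (hε : IsSigns ε) (hε' : IsSigns ε')
    (h1 : Qᴴ * diagR 𝕜 ε * Q = diagR 𝕜 ε')
    (h2 : ((B : Mat d 𝕜) * Q)ᴴ * diagR 𝕜 ε * ((B : Mat d 𝕜) * Q) = diagR 𝕜 (μ * ε'))
    (h3 : ∀ i, μ i ≠ 0) (h4 : ∀ i j, i < j → |μ j| < |μ i|) :
    ∃ Q : SL d 𝕜, IsPencilDiag B Q ε ε' μ := by
  have hdet : ‖Q.det‖ = 1 := by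
    have hJ : ∀ η : Fin d → ℝ, IsSigns η → ‖(diagR 𝕜 η).det‖ = 1 := by
      intro η hη
      rw [diagR, Matrix.det_diagonal, norm_prod]
      refine Finset.prod_eq_one fun i _ => ?_
      rw [RCLike.norm_ofReal, hη.abs]
    have h := congrArg (fun M => ‖Matrix.det M‖) h1
    simp only [Matrix.det_mul, norm_mul, Matrix.det_conjTranspose, norm_star, hJ ε hε, hJ ε' hε',
      mul_one] at h
    nlinarith [norm_nonneg Q.det]
  obtain ⟨p, hp, hpd⟩ := exists_phase i0 hdet
  have hc : ∀ (M : Mat d 𝕜) (x : Fin d → ℝ), Mᴴ * diagR 𝕜 ε * M = diagR 𝕜 x →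
      (M * Matrix.diagonal p)ᴴ * diagR 𝕜 ε * (M * Matrix.diagonal p) = diagR 𝕜 x := by
    intro M x hM
    rw [Matrix.conjTranspose_mul, ← diagonal_phase_conj hp x, ← hM]
    simp only [mul_assoc]
  refine ⟨⟨Q * Matrix.diagonal p, by rw [Matrix.det_mul, hpd]⟩, hε, hε', hc _ _ h1, ?_, h3, h4⟩
  have := hc _ _ h2
  rw [mul_assoc (B : Mat d 𝕜)] at this
  exact this

namespace IsPencilDiag

/-- The product of the moduli of the `μ i` is the ratio of the determinants of two forms related by
matrices of determinant 1. -/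
theorem sum_log (h : IsPencilDiag B Q ε ε' μ) : ∑ i, Real.log |μ i| = 0 := by
  have h1 := congrArg (fun M => ‖Matrix.det M‖) h.conj
  have h2 := congrArg (fun M => ‖Matrix.det M‖) h.conj_mul
  simp only [Matrix.det_mul, Matrix.det_conjTranspose, Q.2, (B * Q).2, star_one, one_mul,
    mul_one] at h1 h2
  rw [h1] at h2
  have h3 : ∀ x : Fin d → ℝ, ‖(diagR 𝕜 x).det‖ = ∏ i, |x i| := by
    intro x
    rw [diagR, Matrix.det_diagonal, norm_prod]
    simp only [RCLike.norm_ofReal]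
  rw [h3, h3] at h2
  simp only [Pi.mul_apply, abs_mul, h.signs'.abs, mul_one, Finset.prod_const_one] at h2
  rw [← Real.log_prod (fun i _ => abs_ne_zero.2 (h.ne_zero i)), ← h2, Real.log_one]

theorem sum_half_log (h : IsPencilDiag B Q ε ε' μ) : ∑ i, Real.log |μ i| / 2 = 0 := by
  rw [← Finset.sum_div, h.sum_log, zero_div]

theorem log_antitone (h : IsPencilDiag B Q ε ε' μ) : Antitone fun i => Real.log |μ i| := by
  intro i j hij
  rcases hij.eq_or_lt with rfl | hij
  · exact le_rfl
  · exact Real.log_le_log (abs_pos.2 (h.ne_zero j)) (h.abs_lt i j hij).le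

end IsPencilDiag

/-- Reordering a decreasing vector by a permutation increasing on the classes of `ε`. -/
theorem SortedOn.of_antitone {ε y : Fin d → ℝ} (hy : Antitone y) {θ : Equiv.Perm (Fin d)}
    (hθ : ∀ i j, i < j → ε (θ i) = ε (θ j) → θ i < θ j) : SortedOn ε (y ∘ θ.symm) := by
  intro i j hij hε
  refine hy (not_lt.1 fun hlt => ?_)
  have := hθ _ _ hlt (by simpa using hε.symm)
  rw [Equiv.apply_symm_apply, Equiv.apply_symm_apply] at this
  exact absurd hij this.not_gt

variable {𝔟 : LieSubalgebra ℝ (Mat d 𝕜)} {o τ : HermForm d 𝕜} {S : SL d 𝕜} {t s : ℝ}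
  {aplus bplus : Set 𝔟}

theorem range_lineOf_mem_lineBases (o : HermForm d 𝕜) {A : SL d 𝕜} {c : 𝕜} {x : Fin d → ℝ}
    (h : (A : Mat d 𝕜)ᴴ * o.mat * A = c • diagR 𝕜 x) :
    Set.range (lineOf (A : Mat d 𝕜)) ∈ o.lineBases := by
  refine ⟨⟨?_, ?_, ?_⟩, ?_⟩
  · rintro _ ⟨i, rfl⟩
    exact finrank_span_singleton (col_ne_zero A i)
  · rw [← Set.image_univ, Set.ncard_image_of_injective _ (lineOf_injective A), Set.ncard_univ,
      Nat.card_eq_fintype_card, Fintype.card_fin]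
  · rw [sSup_range, eq_top_iff]
    intro v _
    have h1 : v = ∑ k, (((A⁻¹ : SL d 𝕜) : Mat d 𝕜) *ᵥ v) k • (A : Mat d 𝕜).col k := by
      have h2 : v = (A : Mat d 𝕜) *ᵥ (((A⁻¹ : SL d 𝕜) : Mat d 𝕜) *ᵥ v) := by
        rw [Matrix.mulVec_mulVec, SL.mul_inv_coe, Matrix.one_mulVec]
      conv_lhs => rw [h2]
      generalize ((A⁻¹ : SL d 𝕜) : Mat d 𝕜) *ᵥ v = w
      ext i
      simp [Matrix.mulVec, dotProduct, mul_comm]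
    rw [h1]
    exact Submodule.sum_mem _ fun k _ => Submodule.smul_mem _ _
      (Submodule.mem_iSup_of_mem k (Submodule.mem_span_singleton_self _))
  · rintro _ ⟨i, rfl⟩ _ ⟨j, rfl⟩ hne u hu v hv
    obtain ⟨a, rfl⟩ := Submodule.mem_span_singleton.1 hu
    obtain ⟨b, rfl⟩ := Submodule.mem_span_singleton.1 hv
    have h1 : o.form ((A : Mat d 𝕜).col i) ((A : Mat d 𝕜).col j) = 0 := by
      have h2 : o.form ((A : Mat d 𝕜).col i) ((A : Mat d 𝕜).col j)
          = ((A : Mat d 𝕜)ᴴ * o.mat * A) i j := by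
        rw [mul_assoc, Matrix.mul_apply]; rfl
      rw [h2, h, Matrix.smul_apply, diagR_apply, if_neg (fun h => hne (by rw [h])), smul_zero]
    have h3 : o.form (a • (A : Mat d 𝕜).col i) (b • (A : Mat d 𝕜).col j)
        = star a * b * o.form ((A : Mat d 𝕜).col i) ((A : Mat d 𝕜).col j) := by
      simp only [HermForm.form, star_smul, Matrix.mulVec_smul, smul_dotProduct, dotProduct_smul,
        smul_eq_mul]
      ring
    rw [h3, h1, mul_zero]

theorem IsFrame.conj_o_mul (hF : IsFrame o τ 𝔟 (S : Mat d 𝕜) ((S⁻¹ : SL d 𝕜) : Mat d 𝕜) t s ε)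
    (A : SL d 𝕜) : ((S * A : SL d 𝕜) : Mat d 𝕜)ᴴ * o.mat * ((S * A : SL d 𝕜) : Mat d 𝕜)
      = (s : 𝕜) • ((A : Mat d 𝕜)ᴴ * diagR 𝕜 ε * A) := by
  rw [Matrix.SpecialLinearGroup.coe_mul, Matrix.conjTranspose_mul]
  calc (A : Mat d 𝕜)ᴴ * (S : Mat d 𝕜)ᴴ * o.mat * (S * A)
      = (A : Mat d 𝕜)ᴴ * ((S : Mat d 𝕜)ᴴ * o.mat * S) * A := by simp only [mul_assoc]
    _ = _ := by rw [hF.conj_o, Matrix.mul_smul, Matrix.smul_mul]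

theorem IsPencilDiag.mem_basisTakers (h : IsPencilDiag B Q ε ε' μ)
    (hF : IsFrame o τ 𝔟 (S : Mat d 𝕜) ((S⁻¹ : SL d 𝕜) : Mat d 𝕜) t s ε) :
    frameHom S B ∈ o.basisTakers := by
  refine ⟨Set.range (lineOf ((S * Q : SL d 𝕜) : Mat d 𝕜)), ?_, ?_⟩
  · exact range_lineOf_mem_lineBases o ((hF.conj_o_mul Q).trans (by rw [h.conj]))
  · have h1 : (fun l : Sub d 𝕜 => frameHom S B • l) '' Set.range (lineOf ((S * Q : SL d 𝕜) : Mat d 𝕜))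
        = Set.range (lineOf ((S * (B * Q) : SL d 𝕜) : Mat d 𝕜)) := by
      rw [← Set.range_comp]
      congr 1
      funext i
      change frameHom S B • lineOf _ _ = _
      rw [frameHom_apply, toG_smul_lineOf, ← Matrix.SpecialLinearGroup.coe_mul]
      have : S * B * S⁻¹ * (S * Q) = S * (B * Q) := by group
      rw [this]
    rw [h1]
    exact range_lineOf_mem_lineBases o ((hF.conj_o_mul (B * Q)).trans (by rw [h.conj_mul]))

/-- Conjugation of a form in normal form by a monomial matrix. -/
theorem monomial_inv_conj {N : SL d 𝕜} {p : Fin d → 𝕜} {π : Equiv.Perm (Fin d)}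
    (hp : ∀ i, ‖p i‖ = 1) (hN : (N : Mat d 𝕜) = permM 𝕜 π * Matrix.diagonal p) {A : SL d 𝕜}
    {x y : Fin d → ℝ} (hA : (A : Mat d 𝕜)ᴴ * diagR 𝕜 x * A = diagR 𝕜 (y ∘ π)) :
    ((A * N⁻¹ : SL d 𝕜) : Mat d 𝕜)ᴴ * diagR 𝕜 x * ((A * N⁻¹ : SL d 𝕜) : Mat d 𝕜) = diagR 𝕜 y := by
  have h1 : (N : Mat d 𝕜)ᴴ * N = 1 := by rw [hN, monomial_unitary hp]
  have h2 : ((N⁻¹ : SL d 𝕜) : Mat d 𝕜) = (N : Mat d 𝕜)ᴴ := by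
    calc ((N⁻¹ : SL d 𝕜) : Mat d 𝕜) = ((N : Mat d 𝕜)ᴴ * N) * ((N⁻¹ : SL d 𝕜) : Mat d 𝕜) := by
          rw [h1, one_mul]
      _ = _ := by rw [mul_assoc, SL.mul_inv_coe, mul_one]
  have h3 : diagR 𝕜 y * N = N * diagR 𝕜 (y ∘ π) := by rw [hN, diagR_mul_monomial]
  rw [Matrix.SpecialLinearGroup.coe_mul, Matrix.conjTranspose_mul]
  calc ((N⁻¹ : SL d 𝕜) : Mat d 𝕜)ᴴ * (A : Mat d 𝕜)ᴴ * diagR 𝕜 x * (A * ((N⁻¹ : SL d 𝕜) : Mat d 𝕜))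
      = ((N⁻¹ : SL d 𝕜) : Mat d 𝕜)ᴴ * ((A : Mat d 𝕜)ᴴ * diagR 𝕜 x * A) * ((N⁻¹ : SL d 𝕜) : Mat d 𝕜) := by
        simp only [mul_assoc]
    _ = diagR 𝕜 y * (N * ((N⁻¹ : SL d 𝕜) : Mat d 𝕜)) := by
        rw [hA]
        conv_lhs => rw [h2, Matrix.conjTranspose_conjTranspose, ← h3, ← h2, mul_assoc]
    _ = _ := by rw [SL.mul_inv_coe, mul_one]

/-- Existence of the `(p,q)`-Cartan decomposition. -/
theorem IsPencilDiag.isPQCartanPart (i0 : Fin d) (h : IsPencilDiag B Q ε ε' μ)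
    (hA : IsAdaptedFrame o τ 𝔟 aplus bplus (S : Mat d 𝕜) ((S⁻¹ : SL d 𝕜) : Mat d 𝕜) t s ε)
    {θ : Equiv.Perm (Fin d)} (hθ : ∀ i, ε (θ i) = ε' i)
    (hθ' : ∀ i j, i < j → ε (θ i) = ε (θ j) → θ i < θ j) {X : 𝔟}
    (hX : crd S X = (fun i => Real.log |μ i| / 2) ∘ θ.symm) :
    IsPQCartanPart τ 𝔟 o bplus (frameHom S B) X := by
  have hF := hA.toIsFrame
  set y : Fin d → ℝ := fun i => Real.log |μ i| / 2 with hy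
  have hsum : ∑ i, (-y) i = 0 := by
    simp only [Pi.neg_apply, Finset.sum_neg_distrib, hy, h.sum_half_log, neg_zero]
  have hyanti : Antitone y := fun i j hij => by
    have := h.log_antitone hij
    simp only [hy]; linarith
  -- The image basis, rescaled to have signs as norms; `y` is half the logarithm because norms are
  -- quadratic in the vectors.
  set Z : SL d 𝕜 := B * Q * expSL 𝕜 (-y) hsum with hZ
  -- The sign of `μ i` tells whether g changes the sign of the `i`-th line, so these signs may
  -- differ from `ε'`. Inertia supplies a permutation relating them to `ε`, and this is where the
  -- Weyl group factor is needed.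
  set ε'' : Fin d → ℝ := fun i => μ i / |μ i| * ε' i with hε''
  have hsg : IsSigns ε'' := by
    intro i
    refine (abs_eq zero_le_one).1 ?_
    simp only [hε'']
    rw [abs_mul, abs_div, abs_abs, h.signs'.abs, div_self (abs_ne_zero.2 (h.ne_zero i)), mul_one]
  have hZc : (Z : Mat d 𝕜)ᴴ * diagR 𝕜 ε * Z = diagR 𝕜 ε'' := by
    have : (Z : Mat d 𝕜) = ((B * Q : SL d 𝕜) : Mat d 𝕜) * expD 𝕜 (-y) := rfl
    rw [this, Matrix.conjTranspose_mul]
    calc (expD 𝕜 (-y))ᴴ * ((B * Q : SL d 𝕜) : Mat d 𝕜)ᴴ * diagR 𝕜 ε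
          * (((B * Q : SL d 𝕜) : Mat d 𝕜) * expD 𝕜 (-y))
        = (expD 𝕜 (-y))ᴴ * (((B * Q : SL d 𝕜) : Mat d 𝕜)ᴴ * diagR 𝕜 ε
          * ((B * Q : SL d 𝕜) : Mat d 𝕜)) * expD 𝕜 (-y) := by simp only [mul_assoc]
      _ = _ := by
        rw [h.conj_mul, expD_conjTranspose, expD, diagR_mul, diagR_mul]
        congr 1
        funext i
        have h1 : Real.exp ((-y) i) * Real.exp ((-y) i) = |μ i|⁻¹ := by
          rw [← Real.exp_add]
          have : (-y) i + (-y) i = -Real.log |μ i| := by simp only [hy, Pi.neg_apply]; ring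
          rw [this, Real.exp_neg, Real.exp_log (abs_pos.2 (h.ne_zero i))]
        simp only [Pi.mul_apply, hε'']
        rw [div_eq_mul_inv, ← h1]; ring
  obtain ⟨ρ, hρ⟩ := exists_perm_signs h.signs hsg hZc
  obtain ⟨Nρ, pρ, hpρ, hNρ⟩ := exists_permSL 𝕜 i0 ρ
  obtain ⟨Nθ, pθ, hpθ, hNθ⟩ := exists_permSL 𝕜 i0 θ
  -- The inverse of `exp(-y)` is `exp(y)`, and `X` is `y` carried to the order `θ`.
  have hEX : expSL 𝕜 (crd S X) (hF.sum_coord X) = Nθ * (expSL 𝕜 (-y) hsum)⁻¹ * Nθ⁻¹ := by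
    rw [eq_mul_inv_iff_mul_eq, eq_mul_inv_iff_mul_eq]
    apply Subtype.ext
    change expD 𝕜 (crd S X) * (Nθ : Mat d 𝕜) * expD 𝕜 (-y) = Nθ
    rw [hX, hNθ, expD, diagR_mul_monomial, mul_assoc]
    have : diagR 𝕜 ((fun i => Real.exp ((y ∘ θ.symm) i)) ∘ θ) * expD 𝕜 (-y) = 1 := by
      rw [← expD_mul_neg y]
      congr 2
      funext i; simp
    rw [this, mul_one]
  have hmθ : frameHom S Nθ ∈ hatW τ 𝔟 := IsMonomial.mem_hatW i0 hF ⟨Nθ, pθ, hpθ, hNθ, rfl⟩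
  have hmρ : frameHom S Nρ ∈ hatW τ 𝔟 := IsMonomial.mem_hatW i0 hF ⟨Nρ, pρ, hpρ, hNρ, rfl⟩
  refine ⟨?_, frameHom S (Z * Nρ⁻¹), ?_, frameHom S Nρ * (frameHom S Nθ)⁻¹,
    mul_mem hmρ (inv_mem hmθ), (frameHom S (Q * Nθ⁻¹))⁻¹, inv_mem ?_, ?_⟩
  · rw [hA.bplus_eq]
    change SortedOn ε (crd S X)
    rw [hX]
    exact SortedOn.of_antitone hyanti hθ'
  · rw [hF.mem_stab_o_iff i0]
    refine monomial_inv_conj hpρ hNρ (hZc.trans ?_)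
    congr 1
    exact funext fun i => (hρ i).symm
  · rw [hF.mem_stab_o_iff i0]
    refine monomial_inv_conj hpθ hNθ (h.conj.trans ?_)
    congr 1
    exact funext fun i => (hθ i).symm
  · rw [hF.expG_eq, hEX, ← map_inv, ← map_inv, ← map_mul, ← map_mul, ← map_mul, ← map_mul, hZ]
    congr 1
    group

/-- Uniqueness of the `(p,q)`-Cartan projection. -/
theorem IsPencilDiag.eq_of_isPQCartanPart (i0 : Fin d) (h : IsPencilDiag B Q ε ε' μ)
    (hA : IsAdaptedFrame o τ 𝔟 aplus bplus (S : Mat d 𝕜) ((S⁻¹ : SL d 𝕜) : Mat d 𝕜) t s ε)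
    {θ : Equiv.Perm (Fin d)} (hθ : ∀ i, ε (θ i) = ε' i)
    (hθ' : ∀ i j, i < j → ε (θ i) = ε (θ j) → θ i < θ j) {X : 𝔟}
    (hX : IsPQCartanPart τ 𝔟 o bplus (frameHom S B) X) :
    crd S X = (fun i => Real.log |μ i| / 2) ∘ θ.symm := by
  have hF := hA.toIsFrame
  set y : Fin d → ℝ := fun i => Real.log |μ i| / 2 with hy
  have hyanti : Antitone y := fun i j hij => by
    have := h.log_antitone hij
    simp only [hy]; linarith
  obtain ⟨hXb, k, hk, w, hw, k', hk', hg⟩ := hX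
  obtain ⟨H, rfl⟩ := frameHom_surjective S k
  obtain ⟨H', rfl⟩ := frameHom_surjective S k'
  obtain ⟨π, N, p, hp, hN, rfl⟩ := exists_isMonomial i0 hF hw
  rw [hF.mem_stab_o_iff i0] at hk
  have hk' := inv_mem hk'
  rw [← map_inv, hF.mem_stab_o_iff i0] at hk'
  rw [hF.expG_eq, ← map_mul, ← map_mul, ← map_mul] at hg
  obtain ⟨r, hr1, hr⟩ := frameHom_eq _ _ _ hg.symm
  have hrn := norm_eq_one_of_pow i0 hr1
  set x := crd S X with hx
  set E := expSL 𝕜 x (hF.sum_coord X) with hE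
  have hBK : ((B * H'⁻¹ : SL d 𝕜) : Mat d 𝕜)ᴴ * diagR 𝕜 ε * ((B * H'⁻¹ : SL d 𝕜) : Mat d 𝕜)
      = diagR 𝕜 (fun i => Real.exp (x i) * ε (π i) * Real.exp (x i)) := by
    have e1 : ((B * H'⁻¹ : SL d 𝕜) : Mat d 𝕜) = r • (H * (N : Mat d 𝕜) * expD 𝕜 x) := by
      rw [Matrix.SpecialLinearGroup.coe_mul, hr, Matrix.smul_mul,
        ← Matrix.SpecialLinearGroup.coe_mul, mul_inv_cancel_right]
      rfl
    rw [e1, Matrix.conjTranspose_smul, Matrix.smul_mul, Matrix.smul_mul, Matrix.mul_smul, smul_smul,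
      RCLike.star_def, RCLike.conj_mul, hrn, Matrix.conjTranspose_mul, Matrix.conjTranspose_mul]
    calc ((1 : ℝ) : 𝕜) ^ 2 • ((expD 𝕜 x)ᴴ * ((N : Mat d 𝕜)ᴴ * (H : Mat d 𝕜)ᴴ) * diagR 𝕜 ε
          * (H * (N : Mat d 𝕜) * expD 𝕜 x))
        = (expD 𝕜 x)ᴴ * ((N : Mat d 𝕜)ᴴ * ((H : Mat d 𝕜)ᴴ * diagR 𝕜 ε * H) * N) * expD 𝕜 x := by
          simp [mul_assoc]
      _ = _ := by
        have : (N : Mat d 𝕜)ᴴ * diagR 𝕜 ε * N = diagR 𝕜 (ε ∘ π) := by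
          rw [hN, mul_assoc, diagR_mul_monomial, ← mul_assoc, monomial_unitary hp, one_mul]
        rw [hk, this, expD_conjTranspose, expD, diagR_mul, diagR_mul]
        rfl
  -- The columns of `H'⁻¹` also diagonalize the pencil; `R` compares them with the columns of `Q`.
  obtain ⟨R, hR⟩ : ∃ R, H'⁻¹ = Q * R := ⟨Q⁻¹ * H'⁻¹, by group⟩
  rw [hR] at hBK hk'
  have h1 : (R : Mat d 𝕜)ᴴ * diagR 𝕜 ε' * R = diagR 𝕜 ε := by
    refine Eq.trans ?_ hk'
    rw [← h.conj, Matrix.SpecialLinearGroup.coe_mul, Matrix.conjTranspose_mul]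
    simp only [mul_assoc]
  have h2 : (R : Mat d 𝕜)ᴴ * diagR 𝕜 (μ * ε') * R
      = diagR 𝕜 (fun i => Real.exp (x i) * ε (π i) * Real.exp (x i)) := by
    rw [← mul_assoc] at hBK
    refine Eq.trans ?_ hBK
    rw [← h.conj_mul, Matrix.SpecialLinearGroup.coe_mul (B * Q) R, Matrix.conjTranspose_mul]
    simp only [mul_assoc]
  set ν : Fin d → ℝ := fun i => ε i * (Real.exp (x i) * ε (π i) * Real.exp (x i)) with hν
  -- `R` intertwines the two diagonalizations of the same operator. Since the `μ i` have distinct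
  -- moduli, it is monomial.
  have h3 : diagR 𝕜 μ * R = R * diagR 𝕜 ν := by
    have e1 : (R : Mat d 𝕜) * (diagR 𝕜 ε * (R : Mat d 𝕜)ᴴ * diagR 𝕜 ε') = 1 := by
      refine mul_eq_one_comm.1 ?_
      calc diagR 𝕜 ε * (R : Mat d 𝕜)ᴴ * diagR 𝕜 ε' * (R : Mat d 𝕜)
          = diagR 𝕜 ε * ((R : Mat d 𝕜)ᴴ * diagR 𝕜 ε' * R) := by simp only [mul_assoc]
        _ = 1 := by rw [h1, h.signs.diagR_mul_self]
    have e2 : diagR 𝕜 (μ * ε') = diagR 𝕜 ε' * diagR 𝕜 μ := by rw [diagR_mul, mul_comm]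
    have e3 : diagR 𝕜 ν = diagR 𝕜 ε * ((R : Mat d 𝕜)ᴴ * diagR 𝕜 (μ * ε') * R) := by
      rw [h2, diagR_mul]; rfl
    rw [e3, e2]
    calc diagR 𝕜 μ * R = ((R : Mat d 𝕜) * (diagR 𝕜 ε * (R : Mat d 𝕜)ᴴ * diagR 𝕜 ε'))
          * (diagR 𝕜 μ * R) := by rw [e1, one_mul]
      _ = _ := by simp only [mul_assoc]
  have h4 : ∀ i j, (R : Mat d 𝕜) i j ≠ 0 → μ i = ν j := by
    intro i j hij
    have := congrFun (congrFun h3 i) j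
    rw [diagR, diagR, Matrix.diagonal_mul, Matrix.mul_diagonal, mul_comm] at this
    exact_mod_cast mul_left_cancel₀ hij this
  have hinj : ∀ i j, |μ i| = |μ j| → i = j := by
    intro i j hij
    rcases lt_trichotomy i j with hlt | heq | hlt
    · exact absurd hij (h.abs_lt i j hlt).ne'
    · exact heq
    · exact absurd hij (h.abs_lt j i hlt).ne
  obtain ⟨φ, hφ⟩ := exists_perm_ne_zero (M := (R : Mat d 𝕜)) (by rw [R.2]; exact one_ne_zero)
  have h5 : ∀ i j, i ≠ φ j → (R : Mat d 𝕜) i j = 0 := by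
    intro i j hij
    by_contra hne
    exact hij (hinj _ _ (by rw [h4 i j hne, h4 _ _ (hφ j)]))
  -- The permutation of `R` respects signs, because the nonzero entry of `R` rescales a norm by a
  -- positive factor.
  have h6 : ∀ j, ε' (φ j) = ε j := by
    intro j
    have e := congrFun (congrFun h1 j) j
    rw [mul_assoc, Matrix.mul_apply, Finset.sum_eq_single (φ j)] at e
    · rw [Matrix.conjTranspose_apply, diagR, Matrix.diagonal_mul, mul_left_comm, RCLike.star_def,
        RCLike.conj_mul, diagR_apply, if_pos rfl] at e
      have e' : ε' (φ j) * ‖(R : Mat d 𝕜) (φ j) j‖ ^ 2 = ε j := by exact_mod_cast e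
      have hpos : 0 < ‖(R : Mat d 𝕜) (φ j) j‖ ^ 2 := pow_pos (norm_pos_iff.2 (hφ j)) 2
      rcases h.signs' (φ j) with a | a <;> rcases h.signs j with b | b <;> rw [a, b] at e' ⊢ <;>
        exfalso <;> linarith
    · intro i _ hi
      rw [Matrix.conjTranspose_apply, h5 i j hi, star_zero, zero_mul]
    · simp
  have h7 : x = y ∘ φ := by
    funext j
    have e := h4 _ _ (hφ j)
    have e2 : |μ (φ j)| = Real.exp (2 * x j) := by
      rw [e]
      simp only [hν]
      rw [abs_mul, abs_mul, abs_mul, h.signs.abs, h.signs.abs, abs_of_pos (Real.exp_pos _), one_mul,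
        mul_one, ← Real.exp_add]
      congr 1; ring
    simp only [Function.comp_apply, hy]
    rw [e2, Real.log_exp]; ring
  -- Both vectors are sorted on each sign class and differ by a sign-preserving permutation, hence
  -- coincide.
  have h8 : (y ∘ θ.symm) ∘ (θ * φ : Equiv.Perm (Fin d)) = x := by
    rw [h7]; funext i; simp
  rw [← h8]
  refine SortedOn.eq_of_perm (fun i => ?_) (SortedOn.of_antitone hyanti hθ') ?_
  · rw [Equiv.Perm.mul_apply, hθ, h6]
  · rw [h8]
    rw [hA.bplus_eq] at hXb
    exact hXb

end Diagonalization

/-! ### The Jordan projection of σᵒ(g⁻¹)g -/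

section JordanProjection

variable {𝔟 : LieSubalgebra ℝ (Mat d 𝕜)} {o τ : HermForm d 𝕜} {S : SL d 𝕜} {t s : ℝ}
  {ε ε' μ : Fin d → ℝ} {aplus bplus : Set 𝔟} {B Q : SL d 𝕜}

theorem IsFrame.tendsto_of_crd (hF : IsFrame o τ 𝔟 (S : Mat d 𝕜) ((S⁻¹ : SL d 𝕜) : Mat d 𝕜) t s ε)
    {u : ℕ → 𝔟} {X : 𝔟} (h : ∀ i, Tendsto (fun n => crd S (u n) i) atTop (𝓝 (crd S X i))) :
    Tendsto u atTop (𝓝 X) := by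
  rw [tendsto_subtype_rng]
  have hc : Continuous fun x : Fin d → ℝ =>
      (S : Mat d 𝕜) * diagR 𝕜 x * ((S⁻¹ : SL d 𝕜) : Mat d 𝕜) := by
    refine (continuous_const.matrix_mul ?_).matrix_mul continuous_const
    exact Continuous.matrix_diagonal
      (continuous_pi fun i => RCLike.continuous_ofReal.comp (continuous_apply i))
  have h1 := (hc.tendsto (crd S X)).comp (tendsto_pi_nhds.2 h)
  rw [← hF.eq_coord X] at h1
  refine h1.congr fun n => ?_
  exact (hF.eq_coord (u n)).symm

/-- The norm of elements of `𝔟` with bounded coordinates is bounded. -/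
theorem IsFrame.exists_normB_le
    (hF : IsFrame o τ 𝔟 (S : Mat d 𝕜) ((S⁻¹ : SL d 𝕜) : Mat d 𝕜) t s ε)
    (β : LinearMap.BilinForm ℝ (Mat d 𝕜)) (D : ℝ) : ∃ D' : ℝ, 0 < D' ∧ ∀ X : 𝔟,
      (∀ i, |crd S X i| ≤ D) → normB β X ≤ D' := by
  set E : Fin d → Mat d 𝕜 := fun i =>
    (S : Mat d 𝕜) * diagR 𝕜 (Pi.single i 1) * ((S⁻¹ : SL d 𝕜) : Mat d 𝕜) with hE
  have hX : ∀ X : 𝔟, (X : Mat d 𝕜) = ∑ i, crd S X i • E i := by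
    intro X
    have h1 : diagR 𝕜 (crd S X) = ∑ i, crd S X i • diagR 𝕜 (Pi.single i 1) := by
      ext k l
      rw [Matrix.sum_apply, Finset.sum_eq_single k]
      · rw [Matrix.smul_apply, diagR_apply, diagR_apply]
        split_ifs <;> simp [RCLike.real_smul_eq_coe_mul]
      · intro i _ hi
        rw [Matrix.smul_apply, diagR_apply, Pi.single_eq_of_ne hi.symm]
        simp
      · simp
    conv_lhs => rw [hF.eq_coord X]
    change (S : Mat d 𝕜) * diagR 𝕜 (crd S X) * ((S⁻¹ : SL d 𝕜) : Mat d 𝕜) = _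
    rw [h1, Finset.mul_sum, Finset.sum_mul]
    refine Finset.sum_congr rfl fun i _ => ?_
    rw [Matrix.mul_smul, Matrix.smul_mul]
  refine ⟨Real.sqrt (∑ i, ∑ j, D * (D * |β (E j) (E i)|)) + 1, by positivity, fun X hXD => ?_⟩
  refine (Real.sqrt_le_sqrt ?_).trans (le_add_of_nonneg_right zero_le_one)
  rw [hX X]
  simp only [map_sum, map_smul, LinearMap.sum_apply, LinearMap.smul_apply, smul_eq_mul, Finset.mul_sum]
  refine Finset.sum_le_sum fun i _ => Finset.sum_le_sum fun j _ => ?_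
  refine (le_abs_self _).trans ?_
  rw [abs_mul, abs_mul]
  have hD : 0 ≤ D := (abs_nonneg _).trans (hXD i)
  gcongr
  · exact hXD _
  · exact hXD _

/-- The adjoint with respect to the form `ε`. -/
def signAdj (B : SL d 𝕜) {ε : Fin d → ℝ} (hε : IsSigns ε) : SL d 𝕜 :=
  ⟨diagR 𝕜 ε * (B : Mat d 𝕜)ᴴ * diagR 𝕜 ε, by
    rw [Matrix.det_mul, Matrix.det_mul, Matrix.det_conjTranspose, B.2, star_one, mul_one,
      ← Matrix.det_mul, hε.diagR_mul_self, Matrix.det_one]⟩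

/-- σᵒ(g⁻¹) is the o-adjoint of g, and in the frame o is a multiple of the sign form. -/
theorem IsFrame.sigma_inv_mul (hF : IsFrame o τ 𝔟 (S : Mat d 𝕜) ((S⁻¹ : SL d 𝕜) : Mat d 𝕜) t s ε)
    (B : SL d 𝕜) : o.sigma (frameHom S B)⁻¹ * frameHom S B
      = frameHom S (signAdj B hF.signs * B) := by
  rw [map_mul]
  congr 1
  rw [map_inv]
  have h1 : o.sigma (frameHom S B) = toG (o.adjSL (S * B * S⁻¹))⁻¹ := rfl
  rw [h1, ← map_inv, inv_inv, frameHom_apply]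
  congr 1
  apply Subtype.ext
  change o.mat⁻¹ * ((S * B * S⁻¹ : SL d 𝕜) : Mat d 𝕜)ᴴ * o.mat
    = (S : Mat d 𝕜) * (diagR 𝕜 ε * (B : Mat d 𝕜)ᴴ * diagR 𝕜 ε) * ((S⁻¹ : SL d 𝕜) : Mat d 𝕜)
  have hs : (s : 𝕜) ≠ 0 := by exact_mod_cast hF.s_pos.ne'
  have e1 : (S : Mat d 𝕜)ᴴ * ((S⁻¹ : SL d 𝕜) : Mat d 𝕜)ᴴ = 1 := by
    rw [← Matrix.conjTranspose_mul, SL.inv_mul_coe, Matrix.conjTranspose_one]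
  have e2 : ((S⁻¹ : SL d 𝕜) : Mat d 𝕜)ᴴ * (S : Mat d 𝕜)ᴴ = 1 := mul_eq_one_comm.1 e1
  have h2 : o.mat = (s : 𝕜) • (((S⁻¹ : SL d 𝕜) : Mat d 𝕜)ᴴ * diagR 𝕜 ε
      * ((S⁻¹ : SL d 𝕜) : Mat d 𝕜)) := by
    calc o.mat = (((S⁻¹ : SL d 𝕜) : Mat d 𝕜)ᴴ * (S : Mat d 𝕜)ᴴ) * o.mat
          * (S * ((S⁻¹ : SL d 𝕜) : Mat d 𝕜)) := by rw [e2, SL.mul_inv_coe, one_mul, mul_one]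
      _ = ((S⁻¹ : SL d 𝕜) : Mat d 𝕜)ᴴ * ((S : Mat d 𝕜)ᴴ * o.mat * S) * ((S⁻¹ : SL d 𝕜) : Mat d 𝕜) := by
          simp only [mul_assoc]
      _ = _ := by rw [hF.conj_o]; simp only [Matrix.mul_smul, Matrix.smul_mul]
  have h3 : o.mat⁻¹ = (s : 𝕜)⁻¹ • ((S : Mat d 𝕜) * diagR 𝕜 ε * (S : Mat d 𝕜)ᴴ) := by
    refine Matrix.inv_eq_right_inv ?_
    rw [h2, Matrix.smul_mul, Matrix.mul_smul, smul_smul, mul_inv_cancel₀ hs, one_smul]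
    calc ((S⁻¹ : SL d 𝕜) : Mat d 𝕜)ᴴ * diagR 𝕜 ε * ((S⁻¹ : SL d 𝕜) : Mat d 𝕜)
          * ((S : Mat d 𝕜) * diagR 𝕜 ε * (S : Mat d 𝕜)ᴴ)
        = ((S⁻¹ : SL d 𝕜) : Mat d 𝕜)ᴴ * (diagR 𝕜 ε * (((S⁻¹ : SL d 𝕜) : Mat d 𝕜) * S)
          * diagR 𝕜 ε) * (S : Mat d 𝕜)ᴴ := by simp only [mul_assoc]
      _ = 1 := by rw [SL.inv_mul_coe, mul_one, hF.signs.diagR_mul_self, mul_one, e2]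
  rw [h3, Matrix.SpecialLinearGroup.coe_mul, Matrix.SpecialLinearGroup.coe_mul,
    Matrix.conjTranspose_mul, Matrix.conjTranspose_mul]
  calc (s : 𝕜)⁻¹ • ((S : Mat d 𝕜) * diagR 𝕜 ε * (S : Mat d 𝕜)ᴴ)
        * (((S⁻¹ : SL d 𝕜) : Mat d 𝕜)ᴴ * ((B : Mat d 𝕜)ᴴ * (S : Mat d 𝕜)ᴴ)) * o.mat
      = (s : 𝕜)⁻¹ • ((S : Mat d 𝕜) * diagR 𝕜 ε * ((S : Mat d 𝕜)ᴴ * ((S⁻¹ : SL d 𝕜) : Mat d 𝕜)ᴴ)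
        * (B : Mat d 𝕜)ᴴ * ((S : Mat d 𝕜)ᴴ * o.mat * (S * ((S⁻¹ : SL d 𝕜) : Mat d 𝕜)))) := by
        rw [SL.mul_inv_coe, mul_one]; simp only [Matrix.smul_mul, mul_assoc]
    _ = (s : 𝕜)⁻¹ • ((S : Mat d 𝕜) * diagR 𝕜 ε * (B : Mat d 𝕜)ᴴ
        * (((S : Mat d 𝕜)ᴴ * o.mat * S) * ((S⁻¹ : SL d 𝕜) : Mat d 𝕜))) := by
        rw [e1, mul_one]; simp only [mul_assoc]
    _ = _ := by
        rw [hF.conj_o, Matrix.smul_mul, Matrix.mul_smul, smul_smul, inv_mul_cancel₀ hs, one_smul]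
        simp only [mul_assoc]

/-- The relation `Qᴴ J Q = J'` says that `J' Qᴴ J` is the inverse of `Q`, which turns the pencil
relation into a diagonalization of the operator. -/
theorem IsPencilDiag.signAdj_mul (h : IsPencilDiag B Q ε ε' μ) (hε : IsSigns ε) :
    ((signAdj B hε * B : SL d 𝕜) : Mat d 𝕜) = Q * diagR 𝕜 μ * ((Q⁻¹ : SL d 𝕜) : Mat d 𝕜) := by
  have e1 : (Q : Mat d 𝕜) * (diagR 𝕜 ε' * (Q : Mat d 𝕜)ᴴ * diagR 𝕜 ε) = 1 := by
    refine mul_eq_one_comm.1 ?_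
    rw [mul_assoc, mul_assoc, ← mul_assoc (Q : Mat d 𝕜)ᴴ, h.conj, h.signs'.diagR_mul_self]
  have e2 : diagR 𝕜 μ = diagR 𝕜 ε' * diagR 𝕜 (μ * ε') := by
    rw [diagR_mul]
    congr 1
    funext i
    simp only [Pi.mul_apply]
    linear_combination -(μ i) * h.signs'.mul_self i
  have e3 : (diagR 𝕜 ε * (B : Mat d 𝕜)ᴴ * diagR 𝕜 ε * B) * Q = Q * diagR 𝕜 μ := by
    rw [e2, ← h.conj_mul, Matrix.SpecialLinearGroup.coe_mul, Matrix.conjTranspose_mul]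
    calc diagR 𝕜 ε * (B : Mat d 𝕜)ᴴ * diagR 𝕜 ε * B * Q
        = ((Q : Mat d 𝕜) * (diagR 𝕜 ε' * (Q : Mat d 𝕜)ᴴ * diagR 𝕜 ε)) * diagR 𝕜 ε * (B : Mat d 𝕜)ᴴ
          * diagR 𝕜 ε * B * Q := by rw [e1, one_mul]
      _ = (Q : Mat d 𝕜) * (diagR 𝕜 ε' * (Q : Mat d 𝕜)ᴴ * (diagR 𝕜 ε * diagR 𝕜 ε) * (B : Mat d 𝕜)ᴴ
          * diagR 𝕜 ε * B * Q) := by simp only [mul_assoc]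
      _ = _ := by rw [h.signs.diagR_mul_self, mul_one]; simp only [mul_assoc]
  change diagR 𝕜 ε * (B : Mat d 𝕜)ᴴ * diagR 𝕜 ε * B = _
  rw [← e3, mul_assoc _ (Q : Mat d 𝕜), SL.mul_inv_coe, mul_one]

/-- Modulus and sign of `μ i` are kept apart, in the shape that `exists_cartan_bound` accepts. -/
theorem IsPencilDiag.pow_eq (h : IsPencilDiag B Q ε ε' μ) (hε : IsSigns ε) (n : ℕ) :
    (((signAdj B hε * B) ^ n : SL d 𝕜) : Mat d 𝕜) = Q * (expD 𝕜 (fun i => n * Real.log |μ i|)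
      * Matrix.diagonal fun i => (((μ i / |μ i|) ^ n : ℝ) : 𝕜)) * ((Q⁻¹ : SL d 𝕜) : Mat d 𝕜) := by
  have e : ∀ n : ℕ, expD 𝕜 (fun i => n * Real.log |μ i|) * Matrix.diagonal (fun i => (((μ i / |μ i|) ^ n : ℝ) : 𝕜))
      = diagR 𝕜 (fun i => μ i ^ n) := by
    intro n
    rw [expD, diagR, diagR, Matrix.diagonal_mul_diagonal]
    congr 1
    funext i
    have hpos := abs_pos.2 (h.ne_zero i)
    rw [← RCLike.ofReal_mul]
    congr 1
    rw [Real.exp_nat_mul, Real.exp_log hpos, div_pow, mul_div_cancel₀ _ (pow_pos hpos n).ne']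
  rw [e]
  induction n with
  | zero =>
    have : diagR 𝕜 (fun i => μ i ^ 0) = 1 := by simp [diagR]
    rw [this, mul_one, SL.mul_inv_coe, pow_zero, Matrix.SpecialLinearGroup.coe_one]
  | succ n ih =>
    have h1 : diagR 𝕜 (fun i => μ i ^ (n + 1)) = diagR 𝕜 (fun i => μ i ^ n) * diagR 𝕜 μ := by
      rw [diagR_mul]; congr 1
    rw [pow_succ, Matrix.SpecialLinearGroup.coe_mul, h.signAdj_mul, ih, h1]
    calc (Q : Mat d 𝕜) * diagR 𝕜 (fun i => μ i ^ n) * ((Q⁻¹ : SL d 𝕜) : Mat d 𝕜)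
          * (Q * diagR 𝕜 μ * ((Q⁻¹ : SL d 𝕜) : Mat d 𝕜))
        = (Q : Mat d 𝕜) * diagR 𝕜 (fun i => μ i ^ n) * (((Q⁻¹ : SL d 𝕜) : Mat d 𝕜)
          * Q) * diagR 𝕜 μ * ((Q⁻¹ : SL d 𝕜) : Mat d 𝕜) := by simp only [mul_assoc]
      _ = _ := by rw [SL.inv_mul_coe, mul_one, ← mul_assoc]

/-- The distance from the Cartan projection of the `n`-th power to `n log|μ|` is bounded by a
constant depending only on `Q`, so it vanishes after division by `n`. -/
theorem IsPencilDiag.tendsto_jordan (i0 : Fin d) (h : IsPencilDiag B Q ε ε' μ)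
    (hA : IsAdaptedFrame o τ 𝔟 aplus bplus (S : Mat d 𝕜) ((S⁻¹ : SL d 𝕜) : Mat d 𝕜) t s ε) {Y : 𝔟}
    (hY : crd S Y = fun i => Real.log |μ i|) :
    Tendsto (fun n : ℕ => (n : ℝ)⁻¹ • cartanProj τ 𝔟 aplus
      ((o.sigma (frameHom S B)⁻¹ * frameHom S B) ^ n)) atTop (𝓝 Y) := by
  have hF := hA.toIsFrame
  obtain ⟨C, hC⟩ := exists_cartan_bound (SL.mul_inv_coe Q)
  have hb : ∀ (n : ℕ) i, abs (crd S (cartanProj τ 𝔟 aplus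
      ((o.sigma (frameHom S B)⁻¹ * frameHom S B) ^ n)) i - n * Real.log |μ i|) ≤ C := by
    intro n
    rw [hF.sigma_inv_mul, ← map_pow]
    obtain ⟨K, L, hK, hL, ha, hKL, -⟩ := hA.exists_cartan i0 ((signAdj B hF.signs * B) ^ n)
    refine hC K L _ _ (fun i => (((μ i / |μ i|) ^ n : ℝ) : 𝕜)) hK hL ha ?_ ?_
      (hKL.symm.trans (h.pow_eq _ n))
    · intro i j hij
      exact mul_le_mul_of_nonneg_left (h.log_antitone hij) (Nat.cast_nonneg n)
    · intro i
      rw [RCLike.norm_ofReal, abs_pow, abs_div, abs_abs, div_self (abs_ne_zero.2 (h.ne_zero i)),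
        one_pow]
  refine hF.tendsto_of_crd fun i => ?_
  rw [hY, tendsto_iff_norm_sub_tendsto_zero]
  have hlim : Tendsto (fun n : ℕ => C * (n : ℝ)⁻¹) atTop (𝓝 0) := by
    have := (tendsto_inv_atTop_nhds_zero_nat (𝕜 := ℝ)).const_mul C
    rwa [mul_zero] at this
  refine squeeze_zero' (Eventually.of_forall fun n => norm_nonneg _) ?_ hlim
  filter_upwards [eventually_gt_atTop 0] with n hn
  have hn' : (0 : ℝ) < n := by exact_mod_cast hn
  rw [map_smul, Pi.smul_apply, smul_eq_mul, Real.norm_eq_abs]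
  have e : ∀ a b : ℝ, (n : ℝ)⁻¹ * a - b = (a - n * b) * (n : ℝ)⁻¹ := by
    intro a b; field_simp
  rw [e, abs_mul, abs_of_pos (inv_pos.2 hn')]
  exact mul_le_mul_of_nonneg_right (hb n i) (inv_pos.2 hn').le

end JordanProjection

/-! ### Assembly of the main theorem -/

theorem exists_isAdaptedFrame_SL (i0 : Fin d) {o τ : HermForm d 𝕜} (hτ : o.MemS τ)
    {𝔟 : LieSubalgebra ℝ (Mat d 𝕜)} (h𝔟 : IsMaximalSubalgebra o τ 𝔟) {aplus bplus : Set 𝔟}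
    (hb : IsWeylChamber (restrictedRoots 𝔟 (lieGTauO o τ)) bplus)
    (ha : IsCompatibleChamber 𝔟 bplus aplus) : ∃ (S : SL d 𝕜) (t s : ℝ) (ε : Fin d → ℝ),
      IsAdaptedFrame o τ 𝔟 aplus bplus (S : Mat d 𝕜) ((S⁻¹ : SL d 𝕜) : Mat d 𝕜) t s ε := by
  obtain ⟨P, P', t, s, ε, h⟩ := exists_isAdaptedFrame i0 hτ h𝔟 hb ha
  obtain ⟨S, rfl⟩ : ∃ S : SL d 𝕜, (S : Mat d 𝕜) = P := ⟨⟨P, h.det_eq⟩, rfl⟩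
  refine ⟨S, t, s, ε, ?_⟩
  rw [S.coe_inv_eq, Matrix.inv_eq_right_inv h.inv]
  exact h

/-- Simultaneous diagonalization of `B` and its adjoint for elements with large gaps. -/
theorem IsAdaptedFrame.exists_pencilDiag (i0 : Fin d) {o τ : HermForm d 𝕜}
    {𝔟 : LieSubalgebra ℝ (Mat d 𝕜)} {aplus bplus : Set 𝔟} {S : SL d 𝕜} {t s : ℝ} {ε : Fin d → ℝ}
    (hA : IsAdaptedFrame o τ 𝔟 aplus bplus (S : Mat d 𝕜) ((S⁻¹ : SL d 𝕜) : Mat d 𝕜) t s ε)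
    {ξs : FullFlag d 𝕜} {σ : Equiv.Perm (Fin d)} (hσ : IsPermFlag (S : Mat d 𝕜) ξs σ)
    {Cs C : Set (FullFlag d 𝕜)} (hCs : IsCompact Cs) (hCs' : Cs ⊆ o.orbit ξs)
    (hC : IsCompact C) (hC' : C ⊆ o.generic) :
    ∃ L : ℝ, 0 < L ∧ ∃ D : ℝ, 0 < D ∧ ∀ B : SL d 𝕜,
      (∀ α ∈ posRoots 𝔟 aplus, L < α (cartanProj τ 𝔟 aplus (frameHom S B))) →
      repellor τ 𝔟 aplus (frameHom S B) ∈ Cs → attractor τ 𝔟 aplus (frameHom S B) ∈ C →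
      ∃ (Q : SL d 𝕜) (μ : Fin d → ℝ), IsPencilDiag B Q ε (ε ∘ σ ∘ Fin.rev) μ ∧
        ∀ i, |Real.log |μ i| - 2 * crd S (cartanProj τ 𝔟 aplus (frameHom S B)) i| ≤ D := by
  have hF := hA.toIsFrame
  obtain ⟨δ₁, hδ₁, hb₁⟩ := exists_minor_bound S (diagR 𝕜 ε) hC
    fun B hB j hj => hF.leadMinor_ne_zero_of_generic (hC' hB) j hj
  -- For the repellors, membership in the orbit of `ξs` gives nonvanishing minors; it will be used
  -- again for their signs.
  obtain ⟨δ₂, hδ₂, hb₂⟩ := exists_minor_bound S (diagR 𝕜 ε) hCs fun B hB j hj h0 => by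
    obtain ⟨c, hc, h⟩ := hF.leadMinor_of_orbit i0 hσ (hCs' hB) rfl j hj
    rw [h] at h0
    have h1 : c * ∏ i : Fin j, ε (σ (Fin.castLE hj i)) = 0 := by exact_mod_cast h0
    exact mul_ne_zero hc.ne' (Finset.prod_ne_zero_iff.2 fun i _ => hF.signs.ne_zero _) h1
  obtain ⟨L, hL, D, hD, H⟩ := exists_orthogonal_diag (𝕜 := 𝕜) d (min δ₁ δ₂) (lt_min hδ₁ hδ₂)
  refine ⟨L, hL, D, hD, fun B hgap hrep hatt => ?_⟩
  obtain ⟨K, M, hK, hM, ha, hB, hKa⟩ := hA.exists_cartan i0 B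
  obtain ⟨K', M', hK', hM', ha', hB', hKa'⟩ := hA.exists_cartan i0 B⁻¹
  -- The reversal appears because g contracts most the first line of its repellor, while the
  -- eigenvalues are listed by decreasing moduli.
  have hε' : IsSigns (ε ∘ σ ∘ Fin.rev) := fun i => hF.signs _
  rw [repellor, ← map_inv, hKa'] at hrep
  rw [hKa] at hatt
  have hinv := SL.mul_inv_coe B
  rw [hB'] at hinv
  conv at hinv => lhs; lhs; rw [hB]
  obtain ⟨Q, μ, h1, h2, h3, h4, h5⟩ := H _ _ _ _ _ _ ε (ε ∘ σ ∘ Fin.rev) hK hM hK' hM'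
    (fun i j hij => hA.lt_of_posRoots hgap hij) ha' hinv hF.signs hε'
    (fun j h => (min_le_left _ _).trans (hb₁ K hK hatt j h))
    (fun j h => (min_le_right _ _).trans (hb₂ K' hK' hrep j h))
    (fun j h => by
      obtain ⟨c, hc, h⟩ := hF.leadMinor_of_orbit i0 hσ (hCs' hrep) rfl j h
      refine ⟨c, hc, h.trans ?_⟩
      simp only [Function.comp_apply, Fin.rev_rev])
  rw [← hB] at h2
  obtain ⟨Q', hQ'⟩ := exists_isPencilDiag i0 hF.signs hε' h1 h2 h4 h5
  exact ⟨Q', μ, hQ', h3⟩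

end PQCartan

end

theorem mainTheorem5 {𝕜 : Type*} [RCLike 𝕜] {d p q : ℕ} (hd : 3 ≤ d) (hp : 0 < p) (hq : 0 < q)
    (o τ : PQCartan.HermForm d 𝕜) (ho : o.HasSignature p q) (hτ : o.MemS τ)
    (𝔟 : LieSubalgebra ℝ (PQCartan.Mat d 𝕜)) (h𝔟 : PQCartan.IsMaximalSubalgebra o τ 𝔟)
    (bplus : Set 𝔟)
    (hbplus : PQCartan.IsWeylChamber
      (PQCartan.restrictedRoots 𝔟 (PQCartan.lieGTauO o τ)) bplus)
    (aplus : Set 𝔟) (haplus : PQCartan.IsCompatibleChamber 𝔟 bplus aplus)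
    (B : LinearMap.BilinForm ℝ (PQCartan.Mat d 𝕜)) (hB : PQCartan.IsInvariantMetric τ B)
    (ξs : PQCartan.FullFlag d 𝕜) (hξs : PQCartan.IsCompatibleFlag 𝔟 bplus ξs)
    (Cs C : Set (PQCartan.FullFlag d 𝕜)) (hCs : IsCompact Cs) (hCs' : Cs ⊆ o.orbit ξs)
    (hC : IsCompact C) (hC' : C ⊆ o.generic) :
    ∃ L : ℝ, 0 < L ∧ ∃ D : ℝ, 0 < D ∧ ∀ g : PQCartan.G d 𝕜,
      (∀ α ∈ PQCartan.posRoots 𝔟 aplus, L < α (PQCartan.cartanProj τ 𝔟 aplus g)) →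
      PQCartan.repellor τ 𝔟 aplus g ∈ Cs →
      PQCartan.attractor τ 𝔟 aplus g ∈ C →
      g ∈ o.basisTakers ∧
      (∃! X : 𝔟, PQCartan.IsPQCartanPart τ 𝔟 o bplus g X) ∧
      Tendsto
        (fun n : ℕ => (n : ℝ)⁻¹ • PQCartan.cartanProj τ 𝔟 aplus ((o.sigma g⁻¹ * g) ^ n)) atTop
        (𝓝 (PQCartan.jordanProj τ 𝔟 aplus (o.sigma g⁻¹ * g))) ∧
      PQCartan.pqCartanProj τ 𝔟 o bplus g =
        (1 / 2 : ℝ) • PQCartan.weylAct τ 𝔟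
          (PQCartan.weylTo τ 𝔟 (PQCartan.iotaFlag τ 𝔟 o bplus ξs) (PQCartan.chamberFlag 𝔟 aplus))
          (PQCartan.jordanProj τ 𝔟 aplus (o.sigma g⁻¹ * g)) ∧
      (PQCartan.iotaFlag τ 𝔟 o bplus ξs = PQCartan.chamberFlag 𝔟 aplus →
        PQCartan.pqCartanProj τ 𝔟 o bplus g =
          (1 / 2 : ℝ) • PQCartan.jordanProj τ 𝔟 aplus (o.sigma g⁻¹ * g)) ∧
      PQCartan.normB B
        (PQCartan.pqCartanProj τ 𝔟 o bplus g -
          PQCartan.weylAct τ 𝔟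
            (PQCartan.weylTo τ 𝔟 (PQCartan.iotaFlag τ 𝔟 o bplus ξs)
              (PQCartan.chamberFlag 𝔟 aplus))
            (PQCartan.cartanProj τ 𝔟 aplus g)) ≤ D := by
  have i0 : Fin d := ⟨0, by omega⟩
  obtain ⟨S, t, s, ε, hA⟩ := PQCartan.exists_isAdaptedFrame_SL i0 hτ h𝔟 hbplus haplus
  have hF := hA.toIsFrame
  obtain ⟨σ, hσ, hσ'⟩ := hA.exists_of_compatibleFlag hξs
  obtain ⟨ω, hω, hω', hι⟩ := hA.exists_iotaFlag i0 hσ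
  obtain ⟨L, hL, D, hD, H⟩ := hA.exists_pencilDiag i0 hσ hCs hCs' hC hC'
  -- The estimate bounds `log|μ| - 2a` by `D`, and the (p,q)-Cartan projection takes half of the
  -- logarithm.
  obtain ⟨D', hD', hnorm⟩ := hF.exists_normB_le B (D / 2)
  refine ⟨L, hL, D', hD', fun g hgap hrep hatt => ?_⟩
  obtain ⟨A, rfl⟩ := PQCartan.frameHom_surjective S g
  obtain ⟨Q, μ, hQ, hμ⟩ := H A hgap hrep hatt
  -- The order of the lines in ι(ξ_s). Being increasing on sign classes comes from two reversals, by
  -- `ω` and by `Fin.rev`, composed with the compatibility of ξ_s.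
  set θ : Equiv.Perm (Fin d) := ω * σ * Fin.revPerm with hθ
  have hθε : ∀ i, ε (θ i) = (ε ∘ σ ∘ Fin.rev) i := fun i => hω _
  have hθmono : ∀ i j, i < j → ε (θ i) = ε (θ j) → θ i < θ j := by
    intro i j hij hε
    have h1 : ε (σ i.rev) = ε (σ j.rev) := by rw [← hω (σ i.rev), ← hω (σ j.rev)]; exact hε
    exact hω' _ _ (hσ' _ _ (Fin.rev_lt_rev.2 hij) h1.symm) h1.symm
  obtain ⟨Y, hY⟩ := hF.exists_coord hQ.sum_log
  obtain ⟨X, hX⟩ := hF.exists_coord (x := (fun i => Real.log |μ i| / 2) ∘ θ.symm)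
    ((Equiv.sum_comp θ.symm fun i => Real.log |μ i| / 2).trans hQ.sum_half_log)
  have hpart := hQ.isPQCartanPart i0 hA hθε hθmono hX
  have huniq : ∀ X', PQCartan.IsPQCartanPart τ 𝔟 o bplus (PQCartan.frameHom S A) X' → X' = X :=
    fun X' hX' => hF.coord_injective
      ((hQ.eq_of_isPQCartanPart i0 hA hθε hθmono hX').trans hX.symm)
  -- Existence makes the chosen projection a genuine (p,q)-Cartan part, and uniqueness identifies
  -- it.
  have hproj : PQCartan.pqCartanProj τ 𝔟 o bplus (PQCartan.frameHom S A) = X :=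
    huniq _ (Classical.epsilon_spec ⟨X, hpart⟩)
  have hlim := hQ.tendsto_jordan i0 hA hY
  have hjordan : PQCartan.jordanProj τ 𝔟 aplus
      (o.sigma (PQCartan.frameHom S A)⁻¹ * PQCartan.frameHom S A) = Y := hlim.limUnder_eq
  have hweyl := PQCartan.crd_weylTo i0 hF hι hA.chamberFlag_aplus
  rw [hproj, hjordan]
  refine ⟨hQ.mem_basisTakers hF, ⟨X, hpart, huniq⟩, hlim, ?_, fun heq => ?_, hnorm _ fun i => ?_⟩
  · apply hF.coord_injective
    rw [map_smul, hX]
    refine Eq.trans ?_ (congrArg _ (hweyl Y).symm)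
    rw [one_mul, hY]
    funext i
    simp only [Function.comp_apply, Pi.smul_apply, smul_eq_mul, Equiv.Perm.inv_def]
    ring
  -- A flag determines its order, so equality of the two flags makes the permutation trivial.
  · have h1 : θ = 1 := hι.perm_eq (PQCartan.SL.inv_mul_coe S) (heq ▸ hA.chamberFlag_aplus)
    apply hF.coord_injective
    rw [map_smul, hX, hY, h1]
    funext i
    simp only [Function.comp_apply, Pi.smul_apply, smul_eq_mul]
    change Real.log |μ i| / 2 = _
    ring
  · rw [map_sub, hweyl, Pi.sub_apply, hX, one_mul]
    have h1 := hμ (θ.symm i)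
    change |Real.log |μ (θ.symm i)| / 2 - _| ≤ D / 2
    simp only [Function.comp_apply, Equiv.Perm.inv_def]
    rw [abs_le] at h1 ⊢
    constructor <;> linarith [h1.1, h1.2]
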